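/- **Setting.** A partition of $[0,1]$ is $\pi^n=(0=t^n_0<\dots<t^n_{N(\pi^n)}=1)$; $|\pi^n|$ and $\underline{\pi^n}$ denote the largest and smallest length of its intervals. Let $\pi=(\pi^n)_{n\ge1}$ be a finitely refining sequence of partitions of $[0,1]$: $\pi^n\subseteq\pi^{n+1}$, $|\pi^n|\to0$, and the number of points of $\pi^{n+1}$ strictly between two consecutive points of $\pi^n$ is bounded uniformly. Put $\pi^0=\{0,1\}$ and $p(m,k)=\inf\{j\ge 0: t^{m+1}_j\ge t^m_k\}$. For $m\ge0$, $0\le k<N(\pi^m)$ and $2\le i\le p(m,k+1)-p(m,k)$ let $$t_1=t^{m+1}_{p(m,k)},\qquad t_2=t^{m+1}_{p(m,k)+i-1},\qquad t_3=t^{m+1}_{p(m,k)+i},$$ let the Haar function $\psi_{m,k,i}$ be equal to $\Big(\frac{t_3-t_2}{t_2-t_1}\,\frac1{t_3-t_1}\Big)^{1/2}$ on $[t_1,t_2)$, to $-\Big(\frac{t_2-t_1}{t_3-t_2}\,\frac1{t_3-t_1}\Big)^{1/2}$ on $[t_2,t_3)$ and to $0$ elsewhere, and let $e^\pi_{m,k,i}(t)=\int_0^t\psi_{m,k,i}(s)\,ds$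 be the Schauder functions. Write $q=(m,k,i)$ for such an index. Let $\phi:[0,\infty)\to[0,\infty)$ be continuous and increasing (not necessarily strictly) with $\phi(0)=0$ (only its restriction to $[0,1]$ matters), and let $$w^{\pi,\phi}_{q}=\frac{(\phi(t_2)-\phi(t_1))(t_3-t_2)^2+(t_2-t_1)^2(\phi(t_3)-\phi(t_2))}{(t_2-t_1)(t_3-t_2)(t_3-t_1)} .$$ Let $(\eta_q)$ be random variables on a probability space such that $$\mathbb E\,\eta_q=0,\qquad \mathbb E\,\eta_q\eta_{q'}=\mathbf 1_{q=q'}\,w^{\pi,\phi}_q,\qquad \sup_q\mathbb E\,\eta_q^4<\infty,$$ and, for all pairwise distinct $q_0,q_1,q_2,q_3$ and all integers $\alpha,\beta,\gamma,\delta\ge0$ with $\alpha+\beta+\gamma+\delta=4$, $$\mathbb E(\eta_{q_0}^\alpha\eta_{q_1}^\beta\eta_{q_2}^\gamma\eta_{q_3}^\delta)=\mathbb E(\eta_{q_0}^\alpha)\,\mathbb E(\eta_{q_1}^\beta)\,\mathbb E(\eta_{q_2}^\gamma)\,\mathbb E(\eta_{q_3}^\delta).$$ Let $x(0),x(1)$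 be random variables and let $x$ be the process $$x(t)=x(0)+(x(1)-x(0))\,t+\sum_{m=0}^\infty\sum_{k,i}\eta_{m,k,i}\,e^\pi_{m,k,i}(t),\qquad t\in[0,1],$$ where the series is summed level by level in $m$ and $x(t)$ is its sum wherever it converges. Let $[x]_{\pi^n}(t)=\sum_{j}\big(x(t^n_{j+1}\wedge t)-x(t^n_j\wedge t)\big)^2$. **Theorem.** (i) For every $t\in[0,1]$ at which the series defining $x(t)$ converges almost surely, $$\forall\,\varepsilon>0:\qquad \lim_{n\to\infty}\mathbb P\big(|[x]_{\pi^n}(t)-\phi(t)|>\varepsilon\big)=0 .$$ (ii) Suppose moreover that $\pi$ is complete refining (there are $\epsilon,M>0$ with $1+\epsilon\le|\pi^n|/|\pi^{n+1}|\le M$ for all $n\ge1$) and balanced (there is $c>0$ with $|\pi^n|/\underline{\pi^n}\le c$ for all $n\ge1$), and that $\phi$ is differentiable on $[0,1]$ with bounded derivative. Then, almost surely, the series converges uniformly on $[0,1]$ to $x$, and $x\in Q_\pi([0,1],\mathbb R)$ with $[x]_\pi(t)=\phi(t)$ for all $t\in[0,1]$. Here $x\in Q_\pi([0,1],\mathbb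 R)$ means that $x$ is càdlàg and the measures $\sum_j (x(t^n_{j+1})-x(t^n_j))^2\delta_{t^n_j}$ converge weakly on $[0,1]$ to a finite measure $\mu$ such that $t\mapsto\mu([0,t])-\sum_{0<s\le t}|\Delta x(s)|^2$ is continuous and increasing and $[x]_\pi(t):=\mu([0,t])=\lim_n[x]_{\pi^n}(t)$ for all $t\in[0,1]$. -/

import Mathlib

open MeasureTheory Filter Topology

/-- A finite partition `0 = t_0 < t_1 < ⋯ < t_N = 1` of `[0,1]`. Only the values `pt 0, …, pt N`
are meaningful. -/
structure UnitPartition where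
  N : ℕ
  pt : ℕ → ℝ
  pt_zero : pt 0 = 0
  pt_last : pt N = 1
  pt_lt : ∀ i < N, pt i < pt (i + 1)

/-- The set of partition points. -/
noncomputable def UnitPartition.points (p : UnitPartition) : Finset ℝ :=
  (Finset.range (p.N + 1)).image p.pt

/-- The length of the largest interval of the partition, `|π^n|`. -/
noncomputable def UnitPartition.mesh (p : UnitPartition) : ℝ :=
  ⨆ i : Fin p.N, (p.pt ((i : ℕ) + 1) - p.pt (i : ℕ))

/-- The length of the smallest interval of the partition. -/
noncomputable def UnitPartition.minMesh (p : UnitPartition) : ℝ :=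
  ⨅ i : Fin p.N, (p.pt ((i : ℕ) + 1) - p.pt (i : ℕ))

/-- A sequence of partitions `(π^n)_{n ≥ 1}` is stored as `π : ℕ → UnitPartition`; the entry `π 0`
is the level from which the Haar system starts (the trivial partition `{0, 1}` in the theorem).
Finitely refining: nested, with vanishing mesh, and with a bounded number of points of `π^{n+1}`
strictly between two consecutive points of `π^n`. -/
def IsFinitelyRefining (π : ℕ → UnitPartition) : Prop :=
  (∀ m n, m ≤ n → (π m).points ⊆ (π n).points) ∧
  Tendsto (fun n => (π n).mesh) atTop (𝓝 0) ∧
  ∃ M : ℕ, ∀ n, 1 ≤ n → ∀ k < (π n).N,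
    ((π (n + 1)).points.filter
      (fun u => (π n).pt k < u ∧ u < (π n).pt (k + 1))).card ≤ M

/-- Balanced: `|π^n|` divided by the smallest interval length is bounded over `n ≥ 1`. -/
def IsBalanced (π : ℕ → UnitPartition) : Prop :=
  ∃ c : ℝ, 0 < c ∧ ∀ n, 1 ≤ n → (π n).mesh / (π n).minMesh ≤ c

/-- Complete refining: `1 + ε ≤ |π^n| / |π^{n+1}| ≤ M` for all `n ≥ 1`. -/
def IsCompleteRefining (π : ℕ → UnitPartition) : Prop :=
  ∃ ε M : ℝ, 0 < ε ∧ 0 < M ∧ ∀ n, 1 ≤ n →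
    1 + ε ≤ (π n).mesh / (π (n + 1)).mesh ∧ (π n).mesh / (π (n + 1)).mesh ≤ M

/-- `p(n,k) = inf {j ≥ 0 : t^{n+1}_j ≥ t^n_k}`. -/
noncomputable def refIndex (π : ℕ → UnitPartition) (n k : ℕ) : ℕ :=
  sInf {j : ℕ | (π n).pt k ≤ (π (n + 1)).pt j}

/-- `t_1 = t^{m+1}_{p(m,k)}`, left end of the support of the `(m,k,i)`-th Haar function. -/
noncomputable def suppLeft (π : ℕ → UnitPartition) (q : ℕ × ℕ × ℕ) : ℝ :=
  (π (q.1 + 1)).pt (refIndex π q.1 q.2.1)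

/-- `t_2 = t^{m+1}_{p(m,k)+i-1}`, where the `(m,k,i)`-th Schauder function is maximal. -/
noncomputable def suppMid (π : ℕ → UnitPartition) (q : ℕ × ℕ × ℕ) : ℝ :=
  (π (q.1 + 1)).pt (refIndex π q.1 q.2.1 + q.2.2 - 1)

/-- `t_3 = t^{m+1}_{p(m,k)+i}`, right end of the support of the `(m,k,i)`-th Haar function. -/
noncomputable def suppRight (π : ℕ → UnitPartition) (q : ℕ × ℕ × ℕ) : ℝ :=
  (π (q.1 + 1)).pt (refIndex π q.1 q.2.1 + q.2.2)

/-- The range of `i` for given `(m,k)`: it starts at `2`, since `i = 1` would give an empty left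
half; level `m` has `N(π^{m+1}) - N(π^m)` triples in total. -/
noncomputable def branchRange (π : ℕ → UnitPartition) (m k : ℕ) : Finset ℕ :=
  Finset.Icc 2 (refIndex π m (k + 1) - refIndex π m k)

/-- `(m,k,i)` is an index of the Haar system along `π`. -/
def IsHaarIndex (π : ℕ → UnitPartition) (q : ℕ × ℕ × ℕ) : Prop :=
  q.2.1 < (π q.1).N ∧ q.2.2 ∈ branchRange π q.1 q.2.1

/-- The non-uniform Haar function `ψ_{m,k,i}`. -/
noncomputable def haarFn (π : ℕ → UnitPartition) (q : ℕ × ℕ × ℕ) (t : ℝ) : ℝ :=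
  let t₁ := suppLeft π q
  let t₂ := suppMid π q
  let t₃ := suppRight π q
  if t₁ ≤ t ∧ t < t₂ then Real.sqrt ((t₃ - t₂) / (t₂ - t₁) * (1 / (t₃ - t₁)))
  else if t₂ ≤ t ∧ t < t₃ then -Real.sqrt ((t₂ - t₁) / (t₃ - t₂) * (1 / (t₃ - t₁)))
  else 0

/-- The Schauder function `e_{m,k,i}(t) = ∫_0^t ψ_{m,k,i}(s) ds`. -/
noncomputable def schauderFn (π : ℕ → UnitPartition) (q : ℕ × ℕ × ℕ) (t : ℝ) : ℝ :=
  ∫ s in (0 : ℝ)..t, haarFn π q s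

/-- `a₀ + (a₁ - a₀) t + ∑_{m < n} ∑_{k,i} θ_{m,k,i} e_{m,k,i}(t)`. -/
noncomputable def schauderPartialSum (π : ℕ → UnitPartition) (a₀ a₁ : ℝ)
    (θ : ℕ × ℕ × ℕ → ℝ) (n : ℕ) (t : ℝ) : ℝ :=
  a₀ + (a₁ - a₀) * t +
    ∑ m ∈ Finset.range n, ∑ k ∈ Finset.range (π m).N, ∑ i ∈ branchRange π m k,
      θ (m, k, i) * schauderFn π (m, k, i) t

/-- The variance weight `w^{π,φ}_{m,k,i}`. -/
noncomputable def schauderWeight (π : ℕ → UnitPartition) (φ : ℝ → ℝ) (q : ℕ × ℕ × ℕ) : ℝ :=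
  let t₁ := suppLeft π q
  let t₂ := suppMid π q
  let t₃ := suppRight π q
  ((φ t₂ - φ t₁) * (t₃ - t₂) ^ 2 + (t₂ - t₁) ^ 2 * (φ t₃ - φ t₂)) /
    ((t₂ - t₁) * (t₃ - t₂) * (t₃ - t₁))

/-- `[x]_{π^n}(t) = ∑_i (x(t_{i+1} ∧ t) - x(t_i ∧ t))²` for a single partition. -/
noncomputable def qvAlong (p : UnitPartition) (x : ℝ → ℝ) (t : ℝ) : ℝ :=
  ∑ i ∈ Finset.range p.N, (x (min (p.pt (i + 1)) t) - x (min (p.pt i) t)) ^ 2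

/-- `x` restricted to `[0,1]` is right-continuous with left limits. -/
def IsCadlagUnit (x : ℝ → ℝ) : Prop :=
  (∀ t ∈ Set.Ico (0 : ℝ) 1, Tendsto x (𝓝[>] t) (𝓝 (x t))) ∧
  (∀ t ∈ Set.Ioc (0 : ℝ) 1, ∃ l, Tendsto x (𝓝[<] t) (𝓝 l))

/-- `x ∈ Q_π([0,1], ℝ)` with quadratic variation `[x]_π = A` on `[0,1]`: `x` is càdlàg, the mesh
vanishes, the measures `∑_j (x(t_{j+1}) - x(t_j))² δ_{t_j}` converge weakly on `[0,1]` to a finite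
measure `μ`, the function `μ([0,t]) - ∑_{0 < s ≤ t} |Δx(s)|²` is continuous and increasing, and
`A(t) = μ([0,t]) = lim_n [x]_{π^n}(t)` for every `t ∈ [0,1]`. -/
def HasQuadraticVariation (π : ℕ → UnitPartition) (x A : ℝ → ℝ) : Prop :=
  IsCadlagUnit x ∧
  Tendsto (fun n => (π n).mesh) atTop (𝓝 0) ∧
  ∃ μ : Measure ℝ, IsFiniteMeasure μ ∧ μ (Set.Icc 0 1)ᶜ = 0 ∧
    (∀ f : ℝ → ℝ, Continuous f →
      Tendsto (fun n => ∑ j ∈ Finset.range (π n).N,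
          (x ((π n).pt (j + 1)) - x ((π n).pt j)) ^ 2 * f ((π n).pt j))
        atTop (𝓝 (∫ s, f s ∂μ))) ∧
    Summable (fun s : Set.Ioc (0 : ℝ) 1 => |x s - Function.leftLim x s| ^ 2) ∧
    ContinuousOn (fun t => μ.real (Set.Icc 0 t) -
      ∑' s : Set.Ioc (0 : ℝ) t, |x s - Function.leftLim x s| ^ 2) (Set.Icc 0 1) ∧
    MonotoneOn (fun t => μ.real (Set.Icc 0 t) -
      ∑' s : Set.Ioc (0 : ℝ) t, |x s - Function.leftLim x s| ^ 2) (Set.Icc 0 1) ∧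
    ∀ t ∈ Set.Icc (0 : ℝ) 1, A t = μ.real (Set.Icc 0 t) ∧
      Tendsto (fun n => qvAlong (π n) x t) atTop (𝓝 (A t))

/-- `φ` is differentiable on `[0,1]` (one-sidedly at the end points) with bounded derivative. -/
def HasBoundedDerivUnit (φ : ℝ → ℝ) : Prop :=
  ∃ (φ' : ℝ → ℝ) (C : ℝ), ∀ t ∈ Set.Icc (0 : ℝ) 1,
    HasDerivWithinAt φ (φ' t) (Set.Icc 0 1) t ∧ |φ' t| ≤ C

/-! Schauder functions of level at least n vanish at the points of π^n, and those of lower level are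
affine between them. So an increment of x along π^n is a finite linear combination of the η_q plus a
drift proportional to the interval length, and the drift does not affect limits of sums of squares.
Up to the last incomplete interval, [x]_{π^n}(t) is thus governed by a quadratic form in the η_q
with matrix A_{qr} = ∑_j |I_j|² ψ_q(t_j) ψ_r(t_j). Its variance must vanish and its mean must tend
to φ(t).

Variance. If M bounds the fourth moments, the factorization of mixed moments bounds the variance by
4M times the squared Hilbert–Schmidt norm of A (`HasFactorizingMoments.integral_sq_quadratic_le`).
The Haar functions of level below n have the reproducing kernel 1_{same interval I of π^n}/|I| - 1
(`IsNested.sum_haarFn_mul`), and this makes the squared norm at most 4|π^n|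
(`IsNested.sum_sq_kernel_le`).

Mean. The weight w_q is the average of the slopes of φ against the probability density ψ_q². Bounded
fourth moments bound the weights, and bounded weights bound the slopes of φ over all partition
intervals (`slope_le_of_weight_le`). The slopes along π^n are then a bounded martingale, hence
Cauchy in L². Freezing them at a level m costs an error small in L², uniformly in n, because the
supports are nested (`sum_mul_sq_sum_le`). With frozen slopes, w_q for q of level at least m is the
slope on the interval containing its support, and the diagonal of the kernel reproduces φ as |π^n| →
0 (`IsNested.abs_meanQV_sub_le`).

For (i), every subsequence has a further one with summable mesh, along which second moments are
summable and convergence is almost sure. For (ii), the mesh itself is summable. Convergence holds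
almost surely at all rational times, then at all times because the sums of squares increase in t and
φ is continuous. Fourth moments and balance make the levels of the series summable in sup norm, so x
is continuous, and pointwise convergence of [x]_{π^n} upgrades to weak convergence of measures. -/

namespace UnitPartition

/-! ### Partitions of the unit interval, their cells and refinements. -/

theorem pt_lt_pt (p : UnitPartition) {i j : ℕ} (hij : i < j) (hj : j ≤ p.N) :
    p.pt i < p.pt j := by
  induction j, hij using Nat.le_induction with
  | base => exact p.pt_lt i hj
  | succ j hij ih => exact (ih (by omega)).trans (p.pt_lt j hj)

theorem pt_le_pt (p : UnitPartition) {i j : ℕ} (hij : i ≤ j) (hj : j ≤ p.N) :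
    p.pt i ≤ p.pt j := by
  rcases hij.eq_or_lt with rfl | h
  · exact le_rfl
  · exact (p.pt_lt_pt h hj).le

theorem pt_lt_pt_iff (p : UnitPartition) {i j : ℕ} (hi : i ≤ p.N) (hj : j ≤ p.N) :
    p.pt i < p.pt j ↔ i < j := by
  refine ⟨fun h => ?_, fun h => p.pt_lt_pt h hj⟩
  by_contra hc
  exact absurd (p.pt_le_pt (not_lt.1 hc) hi) (not_le.2 h)

theorem pt_le_pt_iff (p : UnitPartition) {i j : ℕ} (hi : i ≤ p.N) (hj : j ≤ p.N) :
    p.pt i ≤ p.pt j ↔ i ≤ j := by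
  rw [← not_lt, p.pt_lt_pt_iff hj hi, not_lt]

theorem pt_injOn (p : UnitPartition) {i j : ℕ} (hi : i ≤ p.N) (hj : j ≤ p.N)
    (h : p.pt i = p.pt j) : i = j :=
  le_antisymm ((p.pt_le_pt_iff hi hj).1 h.le) ((p.pt_le_pt_iff hj hi).1 h.ge)

theorem N_pos (p : UnitPartition) : 0 < p.N := by
  rcases Nat.eq_zero_or_pos p.N with h | h
  · have h1 := p.pt_last
    rw [h, p.pt_zero] at h1
    norm_num at h1
  · exact h

theorem pt_nonneg (p : UnitPartition) {i : ℕ} (hi : i ≤ p.N) : 0 ≤ p.pt i := by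
  rw [← p.pt_zero]
  exact p.pt_le_pt (Nat.zero_le _) hi

theorem pt_le_one (p : UnitPartition) {i : ℕ} (hi : i ≤ p.N) : p.pt i ≤ 1 := by
  rw [← p.pt_last]
  exact p.pt_le_pt hi le_rfl

theorem pt_mem (p : UnitPartition) {i : ℕ} (hi : i ≤ p.N) : p.pt i ∈ Set.Icc (0 : ℝ) 1 :=
  ⟨p.pt_nonneg hi, p.pt_le_one hi⟩

theorem pt_lt_one (p : UnitPartition) {i : ℕ} (hi : i < p.N) : p.pt i < 1 := by
  rw [← p.pt_last]
  exact p.pt_lt_pt hi le_rfl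

/-- The length of the `j`-th interval. -/
noncomputable def len (p : UnitPartition) (j : ℕ) : ℝ := p.pt (j + 1) - p.pt j

theorem len_pos (p : UnitPartition) {j : ℕ} (hj : j < p.N) : 0 < p.len j :=
  sub_pos.2 (p.pt_lt j hj)

theorem len_le_mesh (p : UnitPartition) {j : ℕ} (hj : j < p.N) : p.len j ≤ p.mesh :=
  le_ciSup (f := fun i : Fin p.N => p.pt ((i : ℕ) + 1) - p.pt (i : ℕ))
    (Set.finite_range _).bddAbove ⟨j, hj⟩

theorem minMesh_le_len (p : UnitPartition) {j : ℕ} (hj : j < p.N) : p.minMesh ≤ p.len j :=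
  ciInf_le (f := fun i : Fin p.N => p.pt ((i : ℕ) + 1) - p.pt (i : ℕ))
    (Set.finite_range _).bddBelow ⟨j, hj⟩

theorem exists_len_eq_minMesh (p : UnitPartition) : ∃ j < p.N, p.len j = p.minMesh := by
  have : Nonempty (Fin p.N) := ⟨⟨0, p.N_pos⟩⟩
  obtain ⟨i, hi⟩ := exists_eq_ciInf_of_finite
    (f := fun i : Fin p.N => p.pt ((i : ℕ) + 1) - p.pt (i : ℕ))
  exact ⟨i, i.2, hi⟩

theorem minMesh_pos (p : UnitPartition) : 0 < p.minMesh := by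
  obtain ⟨j, hj, h⟩ := p.exists_len_eq_minMesh
  exact h ▸ p.len_pos hj

theorem mesh_pos (p : UnitPartition) : 0 < p.mesh :=
  (p.len_pos p.N_pos).trans_le (p.len_le_mesh p.N_pos)

theorem sum_len_range (p : UnitPartition) (J : ℕ) :
    ∑ j ∈ Finset.range J, p.len j = p.pt J := by
  unfold len
  rw [Finset.sum_range_sub, p.pt_zero, sub_zero]

theorem sum_len (p : UnitPartition) : ∑ j ∈ Finset.range p.N, p.len j = 1 := by
  rw [p.sum_len_range, p.pt_last]

theorem sum_len_sq_le (p : UnitPartition) :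
    ∑ j ∈ Finset.range p.N, p.len j ^ 2 ≤ p.mesh := by
  calc ∑ j ∈ Finset.range p.N, p.len j ^ 2
      ≤ ∑ j ∈ Finset.range p.N, p.mesh * p.len j := Finset.sum_le_sum fun j hj => by
        rw [sq]
        exact mul_le_mul_of_nonneg_right (p.len_le_mesh (Finset.mem_range.1 hj))
          (p.len_pos (Finset.mem_range.1 hj)).le
    _ = p.mesh := by rw [← Finset.mul_sum, p.sum_len, mul_one]

theorem len_le_one (p : UnitPartition) {j : ℕ} (hj : j < p.N) : p.len j ≤ 1 := by
  have h1 := p.pt_le_one (i := j + 1) hj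
  have h2 := p.pt_nonneg hj.le
  unfold len
  linarith

theorem mesh_le_one (p : UnitPartition) : p.mesh ≤ 1 := by
  have : Nonempty (Fin p.N) := ⟨⟨0, p.N_pos⟩⟩
  exact ciSup_le fun i => p.len_le_one i.2

theorem N_mul_minMesh_le (p : UnitPartition) : p.N * p.minMesh ≤ 1 := by
  rw [← p.sum_len]
  calc (p.N : ℝ) * p.minMesh = ∑ j ∈ Finset.range p.N, p.minMesh := by simp
    _ ≤ _ := Finset.sum_le_sum fun j hj => p.minMesh_le_len (Finset.mem_range.1 hj)

theorem mem_points (p : UnitPartition) {u : ℝ} : u ∈ p.points ↔ ∃ j ≤ p.N, p.pt j = u := by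
  simp [points]

open Classical in
/-- The index of the interval containing `s`. -/
noncomputable def cell (p : UnitPartition) (s : ℝ) : ℕ :=
  Nat.findGreatest (fun j => p.pt j ≤ s) (p.N - 1)

theorem cell_lt (p : UnitPartition) (s : ℝ) : p.cell s < p.N := by
  have h1 : p.cell s ≤ p.N - 1 := Nat.findGreatest_le _
  have h2 := p.N_pos
  omega

theorem pt_cell_le (p : UnitPartition) {s : ℝ} (hs : 0 ≤ s) : p.pt (p.cell s) ≤ s := by
  classical
  have h := Nat.findGreatest_spec (P := fun j => p.pt j ≤ s) (n := p.N - 1) (Nat.zero_le _)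
    (by rwa [p.pt_zero])
  unfold cell
  convert h

theorem le_cell (p : UnitPartition) {s : ℝ} {j : ℕ} (hj : j < p.N) (h : p.pt j ≤ s) :
    j ≤ p.cell s := by
  classical
  unfold cell
  exact Nat.le_findGreatest (by omega) h

/-- The search in `cell` stops at `N - 1`, so `s = 1` belongs to the last cell. There the
equivalence fails for `j = N`, which is why `s < 1` is required. -/
theorem le_cell_iff (p : UnitPartition) {s : ℝ} (hs : 0 ≤ s) (hs1 : s < 1) {j : ℕ}
    (hj : j ≤ p.N) : j ≤ p.cell s ↔ p.pt j ≤ s := by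
  constructor
  · intro h
    exact (p.pt_le_pt h (p.cell_lt s).le).trans (p.pt_cell_le hs)
  · intro h
    rcases hj.eq_or_lt with rfl | h1
    · rw [p.pt_last] at h
      exact absurd h (not_le.2 hs1)
    · exact p.le_cell h1 h

theorem lt_pt_cell_succ (p : UnitPartition) {s : ℝ} (hs : 0 ≤ s) (hs1 : s < 1) :
    s < p.pt (p.cell s + 1) := by
  by_contra h
  have := (p.le_cell_iff hs hs1 (p.cell_lt s)).2 (not_lt.1 h)
  omega

theorem le_pt_cell_succ (p : UnitPartition) {s : ℝ} (hs : 0 ≤ s) (hs1 : s ≤ 1) :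
    s ≤ p.pt (p.cell s + 1) := by
  rcases hs1.eq_or_lt with rfl | h
  · have h1 : p.N - 1 ≤ p.cell 1 :=
      p.le_cell (Nat.sub_lt p.N_pos one_pos) (p.pt_le_one (Nat.sub_le _ _))
    have h2 := p.cell_lt 1
    have h3 : p.cell 1 + 1 = p.N := by omega
    rw [h3, p.pt_last]
  · exact (p.lt_pt_cell_succ hs h).le

theorem cell_pt (p : UnitPartition) {j : ℕ} (hj : j < p.N) : p.cell (p.pt j) = j := by
  refine le_antisymm ?_ (p.le_cell hj le_rfl)
  have h := p.pt_cell_le (p.pt_nonneg hj.le)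
  exact (p.pt_le_pt_iff (p.cell_lt _).le hj.le).1 h

theorem cell_eq_iff (p : UnitPartition) {s : ℝ} (hs : 0 ≤ s) (hs1 : s < 1) {j : ℕ}
    (hj : j < p.N) : p.cell s = j ↔ p.pt j ≤ s ∧ s < p.pt (j + 1) := by
  constructor
  · rintro rfl
    exact ⟨p.pt_cell_le hs, p.lt_pt_cell_succ hs hs1⟩
  · rintro ⟨h1, h2⟩
    have h3 := (p.le_cell_iff hs hs1 hj.le).2 h1
    have h4 : ¬ (j + 1 ≤ p.cell s) := by
      rw [p.le_cell_iff hs hs1 hj, not_le]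
      exact h2
    omega

theorem le_iff_of_cell_eq (p : UnitPartition) {s s' u : ℝ} (hs : 0 ≤ s) (hs1 : s < 1)
    (hs' : 0 ≤ s') (hs1' : s' < 1) (h : p.cell s = p.cell s') (hu : u ∈ p.points) :
    u ≤ s ↔ u ≤ s' := by
  obtain ⟨j, hj, rfl⟩ := p.mem_points.1 hu
  rw [← p.le_cell_iff hs hs1 hj, h, p.le_cell_iff hs' hs1' hj]

theorem cell_eq_of_le_iff (p : UnitPartition) {s s' : ℝ} (hs : 0 ≤ s) (hs1 : s < 1)
    (hs' : 0 ≤ s') (hs1' : s' < 1) (h : ∀ u ∈ p.points, u ≤ s ↔ u ≤ s') :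
    p.cell s = p.cell s' := by
  have key : ∀ j ≤ p.N, j ≤ p.cell s ↔ j ≤ p.cell s' := fun j hj => by
    rw [p.le_cell_iff hs hs1 hj, p.le_cell_iff hs' hs1' hj]
    exact h _ (p.mem_points.2 ⟨j, hj, rfl⟩)
  exact le_antisymm ((key _ (p.cell_lt s).le).1 le_rfl) ((key _ (p.cell_lt s').le).2 le_rfl)

/-- The index in `p'` of the `k`-th point of `p`, when `p'` refines `p`. -/
noncomputable def subIndex (p p' : UnitPartition) (k : ℕ) : ℕ := sInf {j : ℕ | p.pt k ≤ p'.pt j}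

theorem subIndex_eq {p p' : UnitPartition} {j k : ℕ} (hj : j ≤ p'.N) (h : p'.pt j = p.pt k) :
    p.subIndex p' k = j := by
  have hmem : j ∈ {j : ℕ | p.pt k ≤ p'.pt j} := h.ge
  have h1 : p.subIndex p' k ≤ j := Nat.sInf_le hmem
  have h2 : p.pt k ≤ p'.pt (p.subIndex p' k) := Nat.sInf_mem (s := {j : ℕ | p.pt k ≤ p'.pt j})
    ⟨j, hmem⟩
  rw [← h] at h2
  exact le_antisymm h1 ((p'.pt_le_pt_iff hj (h1.trans hj)).1 h2)

theorem subIndex_spec {p p' : UnitPartition} (h : p.points ⊆ p'.points) {k : ℕ} (hk : k ≤ p.N) :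
    p.subIndex p' k ≤ p'.N ∧ p'.pt (p.subIndex p' k) = p.pt k := by
  obtain ⟨j, hj, h1⟩ := p'.mem_points.1 (h (p.mem_points.2 ⟨k, hk, rfl⟩))
  rw [subIndex_eq hj h1]
  exact ⟨hj, h1⟩

theorem subIndex_zero {p p' : UnitPartition} : p.subIndex p' 0 = 0 :=
  subIndex_eq (Nat.zero_le _) (by rw [p.pt_zero, p'.pt_zero])

theorem subIndex_last {p p' : UnitPartition} : p.subIndex p' p.N = p'.N :=
  subIndex_eq le_rfl (by rw [p.pt_last, p'.pt_last])

theorem subIndex_lt {p p' : UnitPartition} (h : p.points ⊆ p'.points) {k l : ℕ} (hkl : k < l)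
    (hl : l ≤ p.N) : p.subIndex p' k < p.subIndex p' l := by
  obtain ⟨h1, h2⟩ := subIndex_spec h (hkl.le.trans hl)
  obtain ⟨h3, h4⟩ := subIndex_spec h hl
  rw [← p'.pt_lt_pt_iff h1 h3, h2, h4]
  exact p.pt_lt_pt hkl hl

/-- Regrouping a sum over a refinement along the intervals of the coarser partition. -/
theorem sum_regroup {p p' : UnitPartition} (h : p.points ⊆ p'.points) (F : ℕ → ℝ) (g : ℝ → ℝ) :
    ∑ j ∈ Finset.range p'.N, (g (p'.pt (j + 1)) - g (p'.pt j)) * F (p.cell (p'.pt j)) =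
      ∑ k ∈ Finset.range p.N, (g (p.pt (k + 1)) - g (p.pt k)) * F k := by
  -- Induction over the coarse points: on the block of fine intervals inside one coarse interval `F`
  -- is constant and the increments of `g` telescope.
  have key : ∀ k ≤ p.N, ∑ j ∈ Finset.range (p.subIndex p' k),
      (g (p'.pt (j + 1)) - g (p'.pt j)) * F (p.cell (p'.pt j)) =
      ∑ k ∈ Finset.range k, (g (p.pt (k + 1)) - g (p.pt k)) * F k := by
    intro k hk
    induction k with
    | zero => simp [subIndex_zero]
    | succ k ih =>
      have h1 := subIndex_lt h (Nat.lt_succ_self k) hk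
      obtain ⟨h2, h3⟩ := subIndex_spec h (Nat.le_of_succ_le hk)
      obtain ⟨h4, h5⟩ := subIndex_spec h hk
      rw [Finset.sum_range_succ, ← ih (Nat.le_of_succ_le hk),
        ← Finset.sum_range_add_sum_Ico _ h1.le]
      congr 1
      rw [← h3, ← h5, ← Finset.sum_Ico_sub (fun j => g (p'.pt j)) h1.le, Finset.sum_mul]
      refine Finset.sum_congr rfl fun j hj => ?_
      obtain ⟨hj1, hj2⟩ := Finset.mem_Ico.1 hj
      have hjN : j < p'.N := hj2.trans_le h4
      congr 2
      rw [p.cell_eq_iff (p'.pt_nonneg hjN.le) (p'.pt_lt_one hjN) hk, ← h3, ← h5]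
      exact ⟨p'.pt_le_pt hj1 hjN.le, p'.pt_lt_pt hj2 h4⟩
  have := key p.N le_rfl
  rwa [subIndex_last] at this

end UnitPartition

/-! ### A single Haar function and the kernel of one split interval. -/

/-- The value of the Haar function with nodes `t₁ < t₂ < t₃` on `[t₁, t₂)`. -/
noncomputable def haarL (t₁ t₂ t₃ : ℝ) : ℝ := Real.sqrt ((t₃ - t₂) / (t₂ - t₁) * (1 / (t₃ - t₁)))

/-- The absolute value of the Haar function with nodes `t₁ < t₂ < t₃` on `[t₂, t₃)`. -/
noncomputable def haarR (t₁ t₂ t₃ : ℝ) : ℝ := Real.sqrt ((t₂ - t₁) / (t₃ - t₂) * (1 / (t₃ - t₁)))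

/-- The Haar function with nodes `t₁ < t₂ < t₃`. -/
noncomputable def stepHaar (t₁ t₂ t₃ t : ℝ) : ℝ :=
  if t₁ ≤ t ∧ t < t₂ then haarL t₁ t₂ t₃ else if t₂ ≤ t ∧ t < t₃ then -haarR t₁ t₂ t₃ else 0

theorem haarFn_eq_stepHaar (π : ℕ → UnitPartition) (q : ℕ × ℕ × ℕ) (t : ℝ) :
    haarFn π q t = stepHaar (suppLeft π q) (suppMid π q) (suppRight π q) t := rfl

section nodes

variable {t₁ t₂ t₃ : ℝ}

theorem haarL_sq (h₁ : t₁ < t₂) (h₂ : t₂ < t₃) :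
    haarL t₁ t₂ t₃ ^ 2 = (t₃ - t₂) / ((t₂ - t₁) * (t₃ - t₁)) := by
  have a := sub_pos.2 h₁
  have b := sub_pos.2 h₂
  have c := sub_pos.2 (h₁.trans h₂)
  rw [haarL, Real.sq_sqrt (by positivity)]
  field_simp

theorem haarR_sq (h₁ : t₁ < t₂) (h₂ : t₂ < t₃) :
    haarR t₁ t₂ t₃ ^ 2 = (t₂ - t₁) / ((t₃ - t₂) * (t₃ - t₁)) := by
  have a := sub_pos.2 h₁
  have b := sub_pos.2 h₂
  have c := sub_pos.2 (h₁.trans h₂)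
  rw [haarR, Real.sq_sqrt (by positivity)]
  field_simp

theorem haarL_nonneg : 0 ≤ haarL t₁ t₂ t₃ := Real.sqrt_nonneg _

theorem haarR_nonneg : 0 ≤ haarR t₁ t₂ t₃ := Real.sqrt_nonneg _

theorem haarL_mul_haarR (h₁ : t₁ < t₂) (h₂ : t₂ < t₃) :
    haarL t₁ t₂ t₃ * haarR t₁ t₂ t₃ = 1 / (t₃ - t₁) := by
  have a := sub_pos.2 h₁
  have b := sub_pos.2 h₂
  have c := sub_pos.2 (h₁.trans h₂)
  rw [haarL, haarR, ← Real.sqrt_mul (by positivity), Real.sqrt_eq_iff_mul_self_eq (by positivity)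
    (by positivity)]
  field_simp

/-- The Haar function has integral zero; this is why its primitive vanishes beyond `t₃`. -/
theorem haarL_mul_len (h₁ : t₁ < t₂) (h₂ : t₂ < t₃) :
    haarL t₁ t₂ t₃ * (t₂ - t₁) = haarR t₁ t₂ t₃ * (t₃ - t₂) := by
  have a := sub_pos.2 h₁
  have b := sub_pos.2 h₂
  have c := sub_pos.2 (h₁.trans h₂)
  rw [← sq_eq_sq₀ (mul_nonneg haarL_nonneg a.le) (mul_nonneg haarR_nonneg b.le), mul_pow, mul_pow,
    haarL_sq h₁ h₂, haarR_sq h₁ h₂]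
  field_simp

theorem stepHaar_left {t : ℝ} (h : t₁ ≤ t) (h' : t < t₂) :
    stepHaar t₁ t₂ t₃ t = haarL t₁ t₂ t₃ := if_pos ⟨h, h'⟩

theorem stepHaar_right {t : ℝ} (h : t₂ ≤ t) (h' : t < t₃) :
    stepHaar t₁ t₂ t₃ t = -haarR t₁ t₂ t₃ := by
  rw [stepHaar, if_neg (fun hh => absurd h (not_le.2 hh.2)), if_pos ⟨h, h'⟩]

theorem stepHaar_of_lt {t : ℝ} (h₁ : t₁ < t₂) (h : t < t₁) : stepHaar t₁ t₂ t₃ t = 0 := by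
  rw [stepHaar, if_neg (fun hh => absurd hh.1 (not_le.2 h)),
    if_neg (fun hh => absurd hh.1 (not_le.2 (h.trans h₁)))]

theorem stepHaar_of_le {t : ℝ} (h₂ : t₂ < t₃) (h : t₃ ≤ t) : stepHaar t₁ t₂ t₃ t = 0 := by
  rw [stepHaar, if_neg (fun hh => absurd (h₂.le.trans h) (not_le.2 hh.2)),
    if_neg (fun hh => absurd h (not_le.2 hh.2))]

theorem stepHaar_congr {s s' : ℝ} (h₁ : t₁ ≤ s ↔ t₁ ≤ s') (h₂ : t₂ ≤ s ↔ t₂ ≤ s')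
    (h₃ : t₃ ≤ s ↔ t₃ ≤ s') : stepHaar t₁ t₂ t₃ s = stepHaar t₁ t₂ t₃ s' := by
  unfold stepHaar
  simp only [← not_le, h₁, h₂, h₃]

theorem stepHaar_ne_zero {s : ℝ} (h₁ : t₁ < t₂) (h₂ : t₂ < t₃) (h : stepHaar t₁ t₂ t₃ s ≠ 0) :
    t₁ ≤ s ∧ s < t₃ :=
  ⟨not_lt.1 fun hh => h (stepHaar_of_lt h₁ hh), not_le.1 fun hh => h (stepHaar_of_le h₂ hh)⟩

/-- The reproducing kernel of the Haar functions that split one interval. -/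
theorem sum_stepHaar_mul (τ : ℕ → ℝ) {R : ℕ} (hR : 1 ≤ R) (hτ : ∀ i < R, τ i < τ (i + 1))
    {s s' : ℝ} {l l' : ℕ} (hl : l < R) (hl' : l' < R) (hs : τ l ≤ s) (hs1 : s < τ (l + 1))
    (hs' : τ l' ≤ s') (hs1' : s' < τ (l' + 1)) :
    ∑ i ∈ Finset.Icc 2 R, stepHaar (τ 0) (τ (i - 1)) (τ i) s * stepHaar (τ 0) (τ (i - 1)) (τ i) s' =
      (if l = l' then 1 / (τ (l + 1) - τ l) else 0) - 1 / (τ R - τ 0) := by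
  -- Passing from `R` to `R + 1` adds the function with nodes `τ 0`, `τ R`, `τ (R + 1)`, positive on
  -- everything split so far and negative on the new interval. All earlier functions vanish on the
  -- new interval, so there are four cases, according to whether each of `s`, `s'` lies in it.
  induction R, hR using Nat.le_induction generalizing s s' l l' with
  | base =>
    obtain rfl : l = 0 := by omega
    obtain rfl : l' = 0 := by omega
    simp
  | succ R hR ih =>
    have mono : ∀ i j, i ≤ j → j ≤ R + 1 → τ i ≤ τ j := by
      intro i j hij
      induction j, hij using Nat.le_induction with
      | base => exact fun _ => le_rfl
      | succ j hij ih => exact fun hj => (ih (by omega)).trans (hτ j (by omega)).le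
    have hτ' : ∀ i < R, τ i < τ (i + 1) := fun i hi => hτ i (by omega)
    have h0R : τ 0 < τ R := (hτ 0 (by omega)).trans_le (mono 1 R hR (by omega))
    have hRR : τ R < τ (R + 1) := hτ R (by omega)
    have a := sub_pos.2 h0R
    have b := sub_pos.2 hRR
    have c := sub_pos.2 (h0R.trans hRR)
    have zero : ∀ {u : ℝ}, τ R ≤ u → ∀ i ∈ Finset.Icc 2 R,
        stepHaar (τ 0) (τ (i - 1)) (τ i) u = 0 := by
      intro u hu i hi
      obtain ⟨h2, h3⟩ := Finset.mem_Icc.1 hi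
      refine stepHaar_of_le ?_ ((mono i R h3 (by omega)).trans hu)
      have := hτ (i - 1) (by omega)
      rwa [Nat.sub_add_cancel (by omega)] at this
    rw [Finset.sum_Icc_succ_top (by omega)]
    simp only [Nat.add_sub_cancel]
    rcases Nat.lt_succ_iff_lt_or_eq.1 hl with h1 | rfl <;>
      rcases Nat.lt_succ_iff_lt_or_eq.1 hl' with h2 | rfl
    · rw [ih hτ' h1 h2 hs hs1 hs' hs1',
        stepHaar_left ((mono 0 l (by omega) (by omega)).trans hs)
          (hs1.trans_le (mono _ _ h1 (by omega))),
        stepHaar_left ((mono 0 l' (by omega) (by omega)).trans hs')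
          (hs1'.trans_le (mono _ _ h2 (by omega))), ← sq, haarL_sq h0R hRR]
      have : (τ (R + 1) - τ R) / ((τ R - τ 0) * (τ (R + 1) - τ 0)) =
          1 / (τ R - τ 0) - 1 / (τ (R + 1) - τ 0) := by
        field_simp
        ring
      rw [this]
      ring
    · rw [Finset.sum_eq_zero (fun i hi => by rw [zero hs' i hi, mul_zero]),
        stepHaar_left ((mono 0 l (by omega) (by omega)).trans hs)
          (hs1.trans_le (mono _ _ h1 (by omega))), stepHaar_right hs' hs1', mul_neg,
        haarL_mul_haarR h0R hRR, if_neg h1.ne, zero_add, zero_sub]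
    · rw [Finset.sum_eq_zero (fun i hi => by rw [zero hs i hi, zero_mul]),
        stepHaar_left ((mono 0 l' (by omega) (by omega)).trans hs')
          (hs1'.trans_le (mono _ _ h2 (by omega))), stepHaar_right hs hs1, neg_mul, mul_comm,
        haarL_mul_haarR h0R hRR, if_neg h2.ne', zero_add, zero_sub]
    · rw [Finset.sum_eq_zero (fun i hi => by rw [zero hs i hi, zero_mul]),
        stepHaar_right hs hs1, stepHaar_right hs' hs1', neg_mul_neg, ← sq, haarR_sq h0R hRR,
        if_pos rfl]
      field_simp
      ring

theorem intervalIntegral_indicator_Ico {a b t c : ℝ} (ha : 0 ≤ a) (hab : a ≤ b) (ht : 0 ≤ t) :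
    IntervalIntegrable (Set.indicator (Set.Ico a b) fun _ => c) volume 0 t ∧
    ∫ s in (0 : ℝ)..t, Set.indicator (Set.Ico a b) (fun _ => c) s = c * (min t b - min t a) := by
  constructor
  · rw [intervalIntegrable_iff]
    exact (intervalIntegrable_iff.1 intervalIntegrable_const).indicator measurableSet_Ico
  · rw [intervalIntegral.integral_of_le ht, integral_indicator measurableSet_Ico,
      Measure.restrict_restrict measurableSet_Ico, setIntegral_const, smul_eq_mul, mul_comm]
    congr 1
    have h : (Set.Ico a b ∩ Set.Ioc 0 t : Set ℝ) =ᵐ[volume] Set.Ioc (min t a) (min t b) := by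
      have h1 : (Set.Ico a b : Set ℝ) =ᵐ[volume] Set.Ioc a b := Ico_ae_eq_Ioc
      refine (h1.inter (ae_eq_refl _)).trans ?_
      rw [Set.Ioc_inter_Ioc]
      rcases le_total t a with hta | hta
      · rw [Set.Ioc_eq_empty (by simp [hta]), Set.Ioc_eq_empty (by simp [hta])]
        exact ae_eq_refl _
      · rw [max_eq_left ha, min_eq_right hta, min_comm]
        exact ae_eq_refl _
    rw [measureReal_congr h, Real.volume_real_Ioc_of_le (min_le_min_left _ hab)]

theorem integral_stepHaar (h₀ : 0 ≤ t₁) (h₁ : t₁ < t₂) (h₂ : t₂ < t₃) {t : ℝ} (ht : 0 ≤ t) :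
    ∫ s in (0 : ℝ)..t, stepHaar t₁ t₂ t₃ s =
      haarL t₁ t₂ t₃ * (min t t₂ - min t t₁) - haarR t₁ t₂ t₃ * (min t t₃ - min t t₂) := by
  obtain ⟨i1, e1⟩ := intervalIntegral_indicator_Ico (c := haarL t₁ t₂ t₃) h₀ h₁.le ht
  obtain ⟨i2, e2⟩ := intervalIntegral_indicator_Ico (c := haarR t₁ t₂ t₃) (h₀.trans h₁.le) h₂.le ht
  rw [← e1, ← e2, ← intervalIntegral.integral_sub i1 i2]
  congr 1
  ext s
  by_cases ha : s ∈ Set.Ico t₁ t₂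
  · have hb : s ∉ Set.Ico t₂ t₃ := fun hb => absurd hb.1 (not_le.2 ha.2)
    rw [Set.indicator_of_mem ha, Set.indicator_of_notMem hb, stepHaar_left ha.1 ha.2, sub_zero]
  · rw [Set.indicator_of_notMem ha, zero_sub]
    by_cases hb : s ∈ Set.Ico t₂ t₃
    · rw [Set.indicator_of_mem hb, stepHaar_right hb.1 hb.2]
    · rw [Set.indicator_of_notMem hb, stepHaar, if_neg (by exact ha), if_neg (by exact hb),
        neg_zero]

end nodes

/-! ### Haar functions along nested partitions. -/

/-- The sequence of partitions is nested. -/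
def IsNested (π : ℕ → UnitPartition) : Prop := ∀ m n, m ≤ n → (π m).points ⊆ (π n).points

section nested

variable {π : ℕ → UnitPartition}

theorem IsNested.refIndex_spec (h : IsNested π) {m k : ℕ} (hk : k ≤ (π m).N) :
    refIndex π m k ≤ (π (m + 1)).N ∧ (π (m + 1)).pt (refIndex π m k) = (π m).pt k :=
  UnitPartition.subIndex_spec (h m (m + 1) (Nat.le_succ m)) hk

theorem IsNested.refIndex_lt (h : IsNested π) {m k : ℕ} (hk : k < (π m).N) :
    refIndex π m k < refIndex π m (k + 1) :=
  UnitPartition.subIndex_lt (h m (m + 1) (Nat.le_succ m)) (Nat.lt_succ_self k) hk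

theorem IsNested.haarIndex_bounds (h : IsNested π) {q : ℕ × ℕ × ℕ} (hq : IsHaarIndex π q) :
    2 ≤ q.2.2 ∧ refIndex π q.1 q.2.1 + q.2.2 ≤ refIndex π q.1 (q.2.1 + 1) ∧
      refIndex π q.1 (q.2.1 + 1) ≤ (π (q.1 + 1)).N := by
  obtain ⟨h1, h2⟩ := hq
  obtain ⟨h3, h4⟩ := Finset.mem_Icc.1 h2
  have := h.refIndex_lt h1
  exact ⟨h3, by omega, (h.refIndex_spec h1).1⟩

theorem IsNested.suppLeft_lt (h : IsNested π) {q : ℕ × ℕ × ℕ} (hq : IsHaarIndex π q) :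
    suppLeft π q < suppMid π q := by
  obtain ⟨h1, h2, h3⟩ := h.haarIndex_bounds hq
  exact (π (q.1 + 1)).pt_lt_pt (by omega) (by omega)

theorem IsNested.suppMid_lt (h : IsNested π) {q : ℕ × ℕ × ℕ} (hq : IsHaarIndex π q) :
    suppMid π q < suppRight π q := by
  obtain ⟨h1, h2, h3⟩ := h.haarIndex_bounds hq
  exact (π (q.1 + 1)).pt_lt_pt (by omega) (by omega)

theorem IsNested.suppLeft_eq (h : IsNested π) {q : ℕ × ℕ × ℕ} (hq : IsHaarIndex π q) :
    suppLeft π q = (π q.1).pt q.2.1 := (h.refIndex_spec hq.1.le).2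

theorem IsNested.suppRight_le (h : IsNested π) {q : ℕ × ℕ × ℕ} (hq : IsHaarIndex π q) :
    suppRight π q ≤ (π q.1).pt (q.2.1 + 1) := by
  obtain ⟨h1, h2, h3⟩ := h.haarIndex_bounds hq
  rw [← (h.refIndex_spec (m := q.1) (k := q.2.1 + 1) hq.1).2]
  exact (π (q.1 + 1)).pt_le_pt h2 h3

theorem IsNested.suppLeft_nonneg (h : IsNested π) {q : ℕ × ℕ × ℕ} (hq : IsHaarIndex π q) :
    0 ≤ suppLeft π q := by
  rw [h.suppLeft_eq hq]
  exact (π q.1).pt_nonneg hq.1.le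

theorem IsNested.suppRight_le_one (h : IsNested π) {q : ℕ × ℕ × ℕ} (hq : IsHaarIndex π q) :
    suppRight π q ≤ 1 := (h.suppRight_le hq).trans ((π q.1).pt_le_one hq.1)

/-- The right half of the support is a single interval of `π (q.1 + 1)`, whereas the left half may
contain many. -/
theorem IsNested.suppRight_sub_le (h : IsNested π) {q : ℕ × ℕ × ℕ} (hq : IsHaarIndex π q) :
    suppRight π q - suppMid π q ≤ (π (q.1 + 1)).mesh := by
  obtain ⟨h1, h2, h3⟩ := h.haarIndex_bounds hq
  have := (π (q.1 + 1)).len_le_mesh (j := refIndex π q.1 q.2.1 + q.2.2 - 1) (by omega)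
  rwa [UnitPartition.len, Nat.sub_add_cancel (by omega)] at this

theorem IsNested.exists_nodes (h : IsNested π) {q : ℕ × ℕ × ℕ} (hq : IsHaarIndex π q) {n : ℕ}
    (hn : q.1 < n) : ∃ j₁ j₂ j₃, j₁ < j₂ ∧ j₂ < j₃ ∧ j₃ ≤ (π n).N ∧
      (π n).pt j₁ = suppLeft π q ∧ (π n).pt j₂ = suppMid π q ∧ (π n).pt j₃ = suppRight π q := by
  obtain ⟨h1, h2, h3⟩ := h.haarIndex_bounds hq
  have key : ∀ i ≤ (π (q.1 + 1)).N, ∃ j ≤ (π n).N, (π n).pt j = (π (q.1 + 1)).pt i := fun i hi =>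
    (π n).mem_points.1 (h _ _ hn ((π (q.1 + 1)).mem_points.2 ⟨i, hi, rfl⟩))
  obtain ⟨j₁, b1, e1⟩ := key (refIndex π q.1 q.2.1) (by omega)
  obtain ⟨j₂, b2, e2⟩ := key (refIndex π q.1 q.2.1 + q.2.2 - 1) (by omega)
  obtain ⟨j₃, b3, e3⟩ := key (refIndex π q.1 q.2.1 + q.2.2) (by omega)
  refine ⟨j₁, j₂, j₃, ?_, ?_, b3, e1, e2, e3⟩
  · rw [← (π n).pt_lt_pt_iff b1 b2, e1, e2]
    exact h.suppLeft_lt hq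
  · rw [← (π n).pt_lt_pt_iff b2 b3, e2, e3]
    exact h.suppMid_lt hq

theorem IsNested.haarFn_congr (h : IsNested π) {q : ℕ × ℕ × ℕ} (hq : IsHaarIndex π q) {n : ℕ}
    (hn : q.1 < n) {s s' : ℝ} (hs : s ∈ Set.Ico (0 : ℝ) 1) (hs' : s' ∈ Set.Ico (0 : ℝ) 1)
    (hc : (π n).cell s = (π n).cell s') : haarFn π q s = haarFn π q s' := by
  obtain ⟨j₁, j₂, j₃, h12, h23, h3, e1, e2, e3⟩ := h.exists_nodes hq hn
  have key : ∀ j ≤ (π n).N, (π n).pt j ≤ s ↔ (π n).pt j ≤ s' := fun j hj =>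
    (π n).le_iff_of_cell_eq hs.1 hs.2 hs'.1 hs'.2 hc ((π n).mem_points.2 ⟨j, hj, rfl⟩)
  simp only [haarFn_eq_stepHaar, ← e1, ← e2, ← e3]
  exact stepHaar_congr (key _ (by omega)) (key _ (by omega)) (key _ h3)

theorem IsNested.cell_eq_of_le (h : IsNested π) {m n : ℕ} (hmn : m ≤ n) {s s' : ℝ}
    (hs : s ∈ Set.Ico (0 : ℝ) 1) (hs' : s' ∈ Set.Ico (0 : ℝ) 1)
    (hc : (π n).cell s = (π n).cell s') : (π m).cell s = (π m).cell s' :=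
  (π m).cell_eq_of_le_iff hs.1 hs.2 hs'.1 hs'.2 fun _ hu =>
    (π n).le_iff_of_cell_eq hs.1 hs.2 hs'.1 hs'.2 hc (h m n hmn hu)

theorem IsNested.cell_of_haarFn_ne_zero (h : IsNested π) {q : ℕ × ℕ × ℕ} (hq : IsHaarIndex π q)
    {s : ℝ} (hs : haarFn π q s ≠ 0) : s ∈ Set.Ico (0 : ℝ) 1 ∧ (π q.1).cell s = q.2.1 := by
  obtain ⟨h1, h2⟩ := stepHaar_ne_zero (h.suppLeft_lt hq) (h.suppMid_lt hq) hs
  have h3 := h.suppLeft_nonneg hq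
  have h4 := h.suppRight_le_one hq
  refine ⟨⟨h3.trans h1, h2.trans_le h4⟩, ?_⟩
  rw [(π q.1).cell_eq_iff (h3.trans h1) (h2.trans_le h4) hq.1, ← h.suppLeft_eq hq]
  exact ⟨h1, h2.trans_le (h.suppRight_le hq)⟩

theorem IsNested.cell_eq_of_haarFn_ne_zero (h : IsNested π) {q : ℕ × ℕ × ℕ}
    (hq : IsHaarIndex π q) {m : ℕ} (hm : m ≤ q.1) {s s' : ℝ} (hs : haarFn π q s ≠ 0)
    (hs' : haarFn π q s' ≠ 0) : (π m).cell s = (π m).cell s' := by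
  obtain ⟨h1, h2⟩ := h.cell_of_haarFn_ne_zero hq hs
  obtain ⟨h3, h4⟩ := h.cell_of_haarFn_ne_zero hq hs'
  exact h.cell_eq_of_le hm h1 h3 (h2.trans h4.symm)

/-- Of two distinct Haar functions, one is constant on the support of the other. -/
theorem IsNested.haarFn_const_on_supp (h : IsNested π) {q r : ℕ × ℕ × ℕ} (hq : IsHaarIndex π q)
    (hr : IsHaarIndex π r) (hqr : q ≠ r) :
    (∀ s s', haarFn π r s ≠ 0 → haarFn π r s' ≠ 0 → haarFn π q s = haarFn π q s') ∨
    (∀ s s', haarFn π q s ≠ 0 → haarFn π q s' ≠ 0 → haarFn π r s = haarFn π r s') := by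
  have level : ∀ {q r : ℕ × ℕ × ℕ}, IsHaarIndex π q → IsHaarIndex π r → q.1 < r.1 →
      ∀ s s', haarFn π r s ≠ 0 → haarFn π r s' ≠ 0 → haarFn π q s = haarFn π q s' := by
    intro q r hq hr hlt s s' hs hs'
    exact h.haarFn_congr hq hlt (h.cell_of_haarFn_ne_zero hr hs).1
      (h.cell_of_haarFn_ne_zero hr hs').1 (h.cell_eq_of_haarFn_ne_zero hr le_rfl hs hs')
  -- Both supports start at the same point, and the one with the smaller index ends no later than
  -- the midpoint of the other, hence inside its left half.
  have inner : ∀ {m k i i' : ℕ}, IsHaarIndex π (m, k, i) → IsHaarIndex π (m, k, i') → i' < i →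
      ∀ s s', haarFn π (m, k, i') s ≠ 0 → haarFn π (m, k, i') s' ≠ 0 →
        haarFn π (m, k, i) s = haarFn π (m, k, i) s' := by
    intro m k i i' hq hr hlt
    have key : ∀ s, haarFn π (m, k, i') s ≠ 0 →
        haarFn π (m, k, i) s = haarL (suppLeft π (m, k, i)) (suppMid π (m, k, i))
          (suppRight π (m, k, i)) := by
      intro s hs
      obtain ⟨h1, h2⟩ := stepHaar_ne_zero (h.suppLeft_lt hr) (h.suppMid_lt hr) hs
      refine stepHaar_left h1 (h2.trans_le ?_)
      obtain ⟨b1, b2, b3⟩ := h.haarIndex_bounds hq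
      dsimp only at b1 b2 b3
      exact (π (m + 1)).pt_le_pt (show refIndex π m k + i' ≤ refIndex π m k + i - 1 by omega)
        (show refIndex π m k + i - 1 ≤ (π (m + 1)).N by omega)
    intro s s' hs hs'
    rw [key s hs, key s' hs']
  rcases lt_trichotomy q.1 r.1 with hlt | heq | hgt
  · exact Or.inl (level hq hr hlt)
  · obtain ⟨m, k, i⟩ := q
    obtain ⟨m', k', i'⟩ := r
    dsimp only at heq
    subst heq
    by_cases hk : k = k'
    · subst hk
      rcases lt_trichotomy i i' with hlt | heq | hgt
      · exact Or.inr (inner hr hq hlt)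
      · exact absurd (by rw [heq]) hqr
      · exact Or.inl (inner hq hr hgt)
    · left
      have key : ∀ s, haarFn π (m, k', i') s ≠ 0 → haarFn π (m, k, i) s = 0 := by
        intro s hs
        by_contra hc
        exact hk ((h.cell_of_haarFn_ne_zero hq hc).2.symm.trans (h.cell_of_haarFn_ne_zero hr hs).2)
      intro s s' hs hs'
      rw [key s hs, key s' hs']
  · exact Or.inr (level hr hq hgt)

/-- `G 0 = 0` cuts the sum down to the support, where the Haar function takes two values. Keeping
`G` general serves squares and fourth powers alike. -/
theorem IsNested.sum_mul_haarFn (h : IsNested π) {q : ℕ × ℕ × ℕ} (hq : IsHaarIndex π q) {n : ℕ}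
    (hn : q.1 < n) : ∃ j₁ j₂ j₃, j₁ < j₂ ∧ j₂ < j₃ ∧ j₃ ≤ (π n).N ∧
      (π n).pt j₁ = suppLeft π q ∧ (π n).pt j₂ = suppMid π q ∧ (π n).pt j₃ = suppRight π q ∧
      ∀ (F : ℕ → ℝ) (G : ℝ → ℝ), G 0 = 0 →
        ∑ j ∈ Finset.range (π n).N, F j * G (haarFn π q ((π n).pt j)) =
          (∑ j ∈ Finset.Ico j₁ j₂, F j) * G (haarL (suppLeft π q) (suppMid π q) (suppRight π q)) +
          (∑ j ∈ Finset.Ico j₂ j₃, F j) *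
            G (-haarR (suppLeft π q) (suppMid π q) (suppRight π q)) := by
  obtain ⟨j₁, j₂, j₃, h12, h23, h3, e1, e2, e3⟩ := h.exists_nodes hq hn
  refine ⟨j₁, j₂, j₃, h12, h23, h3, e1, e2, e3, fun F G hG => ?_⟩
  have hsub : Finset.Ico j₁ j₃ ⊆ Finset.range (π n).N := fun j hj => by
    rw [Finset.mem_Ico] at hj
    exact Finset.mem_range.2 (hj.2.trans_le h3)
  rw [← Finset.sum_subset hsub, ← Finset.sum_Ico_consecutive _ h12.le h23.le, Finset.sum_mul,
    Finset.sum_mul]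
  · congr 1
    · refine Finset.sum_congr rfl fun j hj => ?_
      obtain ⟨a, b⟩ := Finset.mem_Ico.1 hj
      rw [haarFn_eq_stepHaar, stepHaar_left]
      · exact e1 ▸ (π n).pt_le_pt a (by omega)
      · exact e2 ▸ (π n).pt_lt_pt b (by omega)
    · refine Finset.sum_congr rfl fun j hj => ?_
      obtain ⟨a, b⟩ := Finset.mem_Ico.1 hj
      rw [haarFn_eq_stepHaar, stepHaar_right]
      · exact e2 ▸ (π n).pt_le_pt a (by omega)
      · exact e3 ▸ (π n).pt_lt_pt b (by omega)
  · intro j hj hj'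
    rw [Finset.mem_range] at hj
    rw [Finset.mem_Ico, not_and_or, not_le, not_lt] at hj'
    rw [haarFn_eq_stepHaar]
    rcases hj' with hj' | hj'
    · rw [stepHaar_of_lt (h.suppLeft_lt hq) (e1 ▸ (π n).pt_lt_pt hj' (by omega)), hG, mul_zero]
    · rw [stepHaar_of_le (h.suppMid_lt hq) (e3 ▸ (π n).pt_le_pt hj' hj.le), hG, mul_zero]

theorem IsNested.sum_increment_mul_haarFn (h : IsNested π) {q : ℕ × ℕ × ℕ}
    (hq : IsHaarIndex π q) {n : ℕ} (hn : q.1 < n) (g : ℝ → ℝ) (G : ℝ → ℝ) (hG : G 0 = 0) :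
    ∑ j ∈ Finset.range (π n).N, (g ((π n).pt (j + 1)) - g ((π n).pt j)) *
        G (haarFn π q ((π n).pt j)) =
      (g (suppMid π q) - g (suppLeft π q)) *
        G (haarL (suppLeft π q) (suppMid π q) (suppRight π q)) +
      (g (suppRight π q) - g (suppMid π q)) *
        G (-haarR (suppLeft π q) (suppMid π q) (suppRight π q)) := by
  obtain ⟨j₁, j₂, j₃, h12, h23, h3, e1, e2, e3, H⟩ := h.sum_mul_haarFn hq hn
  rw [H _ G hG, Finset.sum_Ico_sub (fun j => g ((π n).pt j)) h12.le,
    Finset.sum_Ico_sub (fun j => g ((π n).pt j)) h23.le, e1, e2, e3]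

/-- This identifies the weight as the integral of ψ_q² against dφ, that is, as a weighted mean of
slopes of φ. With φ the identity it becomes the L² normalization of the Haar function. -/
theorem IsNested.sum_increment_mul_haarFn_sq (h : IsNested π) {q : ℕ × ℕ × ℕ}
    (hq : IsHaarIndex π q) {n : ℕ} (hn : q.1 < n) (φ : ℝ → ℝ) :
    ∑ j ∈ Finset.range (π n).N, (φ ((π n).pt (j + 1)) - φ ((π n).pt j)) *
        haarFn π q ((π n).pt j) ^ 2 = schauderWeight π φ q := by
  rw [h.sum_increment_mul_haarFn hq hn φ (fun x => x ^ 2) (by norm_num)]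
  have h1 := h.suppLeft_lt hq
  have h2 := h.suppMid_lt hq
  simp only [neg_sq, haarL_sq h1 h2, haarR_sq h1 h2, schauderWeight]
  have a := sub_pos.2 h1
  have b := sub_pos.2 h2
  have c := sub_pos.2 (h1.trans h2)
  field_simp

theorem IsNested.sum_len_mul_haarFn_sq (h : IsNested π) {q : ℕ × ℕ × ℕ}
    (hq : IsHaarIndex π q) {n : ℕ} (hn : q.1 < n) :
    ∑ j ∈ Finset.range (π n).N, (π n).len j * haarFn π q ((π n).pt j) ^ 2 = 1 := by
  have := h.sum_increment_mul_haarFn_sq hq hn (fun x => x)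
  simp only [UnitPartition.len, this, schauderWeight]
  have a := sub_pos.2 (h.suppLeft_lt hq)
  have b := sub_pos.2 (h.suppMid_lt hq)
  have c := sub_pos.2 ((h.suppLeft_lt hq).trans (h.suppMid_lt hq))
  field_simp
  ring

/-- With half-lengths x and y, bounding ∑ len² by (∑ len)² on each half turns the product into 2(x³
+ y³)/(x + y)³. A badly unbalanced support makes the second factor large, but the first one small to
the same extent, so no balance assumption is needed. -/
theorem IsNested.sum_len_sq_mul_haarFn_sq_mul_le (h : IsNested π) {q : ℕ × ℕ × ℕ}
    (hq : IsHaarIndex π q) {n : ℕ} (hn : q.1 < n) :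
    (∑ j ∈ Finset.range (π n).N, (π n).len j ^ 2 * haarFn π q ((π n).pt j) ^ 2) *
      (∑ j ∈ Finset.range (π n).N, (π n).len j * (haarFn π q ((π n).pt j) ^ 2) ^ 2) ≤ 2 := by
  have h1 := h.suppLeft_lt hq
  have h2 := h.suppMid_lt hq
  have a := sub_pos.2 h1
  have b := sub_pos.2 h2
  have c := sub_pos.2 (h1.trans h2)
  obtain ⟨j₁, j₂, j₃, h12, h23, h3, e1, e2, e3, H⟩ := h.sum_mul_haarFn hq hn
  have e4 := h.sum_increment_mul_haarFn hq hn (fun x => x) (fun x => (x ^ 2) ^ 2) (by norm_num)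
  have sq_le : ∀ {i j}, i < j → j ≤ (π n).N →
      ∑ l ∈ Finset.Ico i j, (π n).len l ^ 2 ≤ ((π n).pt j - (π n).pt i) ^ 2 := by
    intro i j hij hj
    have e : ∑ l ∈ Finset.Ico i j, (π n).len l = (π n).pt j - (π n).pt i :=
      Finset.sum_Ico_sub (fun j => (π n).pt j) hij.le
    rw [← e]
    exact Finset.sum_sq_le_sq_sum_of_nonneg fun l hl =>
      ((π n).len_pos ((Finset.mem_Ico.1 hl).2.trans_le hj)).le
  have s1 := sq_le h12 (by omega)
  have s2 := sq_le h23 h3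
  rw [H _ (fun x => x ^ 2) (by norm_num)]
  simp only [UnitPartition.len] at s1 s2 ⊢
  rw [e4]
  rw [e1, e2] at s1
  rw [e2, e3] at s2
  simp only [neg_sq, haarL_sq h1 h2, haarR_sq h1 h2]
  set x := suppMid π q - suppLeft π q
  set y := suppRight π q - suppMid π q
  have hz : suppRight π q - suppLeft π q = x + y := by simp only [x, y]; ring
  rw [hz] at c ⊢
  calc _ ≤ (x ^ 2 * (y / (x * (x + y))) + y ^ 2 * (x / (y * (x + y)))) *
        (x * (y / (x * (x + y))) ^ 2 + y * (x / (y * (x + y))) ^ 2) := by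
        gcongr
    _ = 2 * ((x ^ 3 + y ^ 3) / (x + y) ^ 3) := by
        field_simp
        ring
    _ ≤ 2 * 1 := by
        gcongr
        rw [div_le_one (by positivity)]
        nlinarith [mul_pos a b, mul_pos (mul_pos a b) c]
    _ = 2 := by norm_num

end nested

/-! ### Haar indices by level and the reproducing kernel. -/

/-- The pairs `(k, i)` with `(m, k, i)` a Haar index. -/
noncomputable def haarPairs (π : ℕ → UnitPartition) (m : ℕ) : Finset (ℕ × ℕ) :=
  (Finset.range (π m).N).biUnion fun k => (branchRange π m k).image (Prod.mk k)

/-- The Haar indices of level smaller than `n`. -/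
noncomputable def haarIdx (π : ℕ → UnitPartition) (n : ℕ) : Finset (ℕ × ℕ × ℕ) :=
  (Finset.range n).biUnion fun m => (haarPairs π m).image (Prod.mk m)

section idx

variable {π : ℕ → UnitPartition}

theorem mem_haarPairs {m : ℕ} {p : ℕ × ℕ} :
    p ∈ haarPairs π m ↔ p.1 ∈ Finset.range (π m).N ∧ p.2 ∈ branchRange π m p.1 := by
  obtain ⟨k, i⟩ := p
  simp [haarPairs]

theorem mem_haarIdx' {n : ℕ} {q : ℕ × ℕ × ℕ} :
    q ∈ haarIdx π n ↔ q.1 ∈ Finset.range n ∧ q.2 ∈ haarPairs π q.1 := by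
  obtain ⟨m, p⟩ := q
  simp [haarIdx]

theorem mem_haarIdx {n : ℕ} {q : ℕ × ℕ × ℕ} :
    q ∈ haarIdx π n ↔ q.1 < n ∧ IsHaarIndex π q := by
  rw [mem_haarIdx', mem_haarPairs, Finset.mem_range, Finset.mem_range, IsHaarIndex]

theorem sum_haarPairs (m : ℕ) (f : ℕ × ℕ → ℝ) :
    ∑ p ∈ haarPairs π m, f p =
      ∑ k ∈ Finset.range (π m).N, ∑ i ∈ branchRange π m k, f (k, i) :=
  Finset.sum_finset_product _ _ _ fun _ => mem_haarPairs

theorem sum_haarIdx_eq_sum_pairs (n : ℕ) (f : ℕ × ℕ × ℕ → ℝ) :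
    ∑ q ∈ haarIdx π n, f q = ∑ m ∈ Finset.range n, ∑ p ∈ haarPairs π m, f (m, p) :=
  Finset.sum_finset_product _ _ _ fun _ => mem_haarIdx'

theorem sum_haarIdx (n : ℕ) (f : ℕ × ℕ × ℕ → ℝ) :
    ∑ q ∈ haarIdx π n, f q = ∑ m ∈ Finset.range n, ∑ k ∈ Finset.range (π m).N,
      ∑ i ∈ branchRange π m k, f (m, k, i) := by
  simp only [sum_haarIdx_eq_sum_pairs, sum_haarPairs]

theorem haarIdx_mono {m n : ℕ} (h : m ≤ n) : haarIdx π m ⊆ haarIdx π n := fun q hq => by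
  rw [mem_haarIdx] at hq ⊢
  exact ⟨hq.1.trans_le h, hq.2⟩

theorem IsNested.isHaarIndex_of_mem_pairs {m : ℕ} {p : ℕ × ℕ} (hp : p ∈ haarPairs π m) :
    IsHaarIndex π (m, p) := by
  rw [mem_haarPairs, Finset.mem_range] at hp
  exact hp

/-- Only the coarse interval containing both points contributes, and there `sum_stepHaar_mul`
applies. The difference form makes the sum over levels telescope. -/
theorem IsNested.sum_level_haarFn_mul (h : IsNested π) (m : ℕ) {s s' : ℝ}
    (hs : s ∈ Set.Ico (0 : ℝ) 1) (hs' : s' ∈ Set.Ico (0 : ℝ) 1) :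
    ∑ p ∈ haarPairs π m, haarFn π (m, p) s * haarFn π (m, p) s' =
      (if (π (m + 1)).cell s = (π (m + 1)).cell s'
        then 1 / (π (m + 1)).len ((π (m + 1)).cell s) else 0) -
      (if (π m).cell s = (π m).cell s' then 1 / (π m).len ((π m).cell s) else 0) := by
  by_cases hc : (π m).cell s = (π m).cell s'
  · set k := (π m).cell s with hk
    have hkN : k < (π m).N := (π m).cell_lt s
    rw [sum_haarPairs, Finset.sum_eq_single k]
    · have hlt := h.refIndex_lt hkN
      obtain ⟨b1, e1⟩ := h.refIndex_spec hkN.le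
      obtain ⟨b2, e2⟩ := h.refIndex_spec (m := m) (k := k + 1) hkN
      have cell_bounds : ∀ {u : ℝ}, u ∈ Set.Ico (0 : ℝ) 1 → (π m).cell u = k →
          refIndex π m k ≤ (π (m + 1)).cell u ∧ (π (m + 1)).cell u < refIndex π m (k + 1) := by
        intro u hu huk
        obtain ⟨c1, c2⟩ := ((π m).cell_eq_iff hu.1 hu.2 hkN).1 huk
        refine ⟨((π (m + 1)).le_cell_iff hu.1 hu.2 b1).2 (e1 ▸ c1), ?_⟩
        rw [← not_le, (π (m + 1)).le_cell_iff hu.1 hu.2 b2, not_le, e2]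
        exact c2
      obtain ⟨l1, l2⟩ := cell_bounds hs hk.symm
      obtain ⟨l3, l4⟩ := cell_bounds hs' hc.symm
      have e3 : refIndex π m k + (refIndex π m (k + 1) - refIndex π m k) =
        refIndex π m (k + 1) := by omega
      have e4 := Nat.add_sub_of_le l1
      have e5 := Nat.add_sub_of_le l3
      have key := sum_stepHaar_mul (fun i => (π (m + 1)).pt (refIndex π m k + i))
        (R := refIndex π m (k + 1) - refIndex π m k) (by omega)
        (fun i hi => (π (m + 1)).pt_lt _ (by omega)) (s := s) (s' := s')
        (l := (π (m + 1)).cell s - refIndex π m k) (l' := (π (m + 1)).cell s' - refIndex π m k)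
        (by omega) (by omega)
        (by rw [e4]; exact (π (m + 1)).pt_cell_le hs.1)
        (by rw [← add_assoc, e4]; exact (π (m + 1)).lt_pt_cell_succ hs.1 hs.2)
        (by rw [e5]; exact (π (m + 1)).pt_cell_le hs'.1)
        (by rw [← add_assoc, e5]; exact (π (m + 1)).lt_pt_cell_succ hs'.1 hs'.2)
      rw [if_pos hc]
      simp only [← add_assoc, e3, e4, add_zero, e1, e2] at key
      have e6 : (π (m + 1)).cell s - refIndex π m k = (π (m + 1)).cell s' - refIndex π m k ↔
          (π (m + 1)).cell s = (π (m + 1)).cell s' := by omega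
      simp only [e6] at key
      rw [UnitPartition.len, UnitPartition.len, ← key]
      refine Finset.sum_congr rfl fun i hi => ?_
      have hi2 := (Finset.mem_Icc.1 hi).1
      rw [haarFn_eq_stepHaar, haarFn_eq_stepHaar]
      simp only [suppLeft, suppMid, suppRight, e1, Nat.add_sub_assoc (show 1 ≤ i by omega)]
    · intro k' hk' hne
      refine Finset.sum_eq_zero fun i hi => ?_
      have hq : IsHaarIndex π (m, k', i) := ⟨Finset.mem_range.1 hk', hi⟩
      have : haarFn π (m, k', i) s = 0 := by
        by_contra hz
        exact hne (h.cell_of_haarFn_ne_zero hq hz).2.symm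
      rw [this, zero_mul]
    · intro hk'
      exact absurd (Finset.mem_range.2 hkN) hk'
  · rw [if_neg hc, if_neg (fun hh => hc (h.cell_eq_of_le (Nat.le_succ m) hs hs' hh)), sub_zero]
    refine Finset.sum_eq_zero fun p hp => ?_
    by_contra hz
    obtain ⟨h1, h2⟩ := mul_ne_zero_iff.1 hz
    exact hc (h.cell_eq_of_haarFn_ne_zero (isHaarIndex_of_mem_pairs hp) le_rfl h1 h2)

/-- The reproducing kernel of the Haar functions of level smaller than `n`. -/
theorem IsNested.sum_haarFn_mul (h : IsNested π) (h0 : (π 0).N = 1) (n : ℕ) {s s' : ℝ}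
    (hs : s ∈ Set.Ico (0 : ℝ) 1) (hs' : s' ∈ Set.Ico (0 : ℝ) 1) :
    ∑ q ∈ haarIdx π n, haarFn π q s * haarFn π q s' =
      (if (π n).cell s = (π n).cell s' then 1 / (π n).len ((π n).cell s) else 0) - 1 := by
  rw [sum_haarIdx_eq_sum_pairs]
  simp only [h.sum_level_haarFn_mul _ hs hs']
  rw [Finset.sum_range_sub (fun m => if (π m).cell s = (π m).cell s'
        then 1 / (π m).len ((π m).cell s) else 0)]
  have h1 : ∀ u, (π 0).cell u = 0 := fun u => by
    have := (π 0).cell_lt u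
    omega
  have h2 : (π 0).len 0 = 1 := by
    rw [UnitPartition.len, zero_add, ← h0, (π 0).pt_last, (π 0).pt_zero, sub_zero]
  rw [h1, h1, h2, if_pos rfl, div_one]

/-- The sum of the squares of the Haar functions whose level lies in `[m, n)`. -/
theorem IsNested.sum_haarFn_sq_sdiff (h : IsNested π) (h0 : (π 0).N = 1) {m n : ℕ} (hmn : m ≤ n)
    {s : ℝ} (hs : s ∈ Set.Ico (0 : ℝ) 1) :
    ∑ q ∈ haarIdx π n \ haarIdx π m, haarFn π q s ^ 2 =
      1 / (π n).len ((π n).cell s) - 1 / (π m).len ((π m).cell s) := by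
  have e : ∀ n, ∑ q ∈ haarIdx π n, haarFn π q s ^ 2 = 1 / (π n).len ((π n).cell s) - 1 := by
    intro n
    have := h.sum_haarFn_mul h0 n hs hs
    rw [if_pos rfl] at this
    rw [← this]
    exact Finset.sum_congr rfl fun q _ => sq _
  have := Finset.sum_sdiff (haarIdx_mono (π := π) hmn) (f := fun q => haarFn π q s ^ 2)
  rw [e, e] at this
  linarith

theorem IsNested.sum_haarFn_sq (h : IsNested π) (h0 : (π 0).N = 1) {n j : ℕ} (hj : j < (π n).N) :
    ∑ q ∈ haarIdx π n, haarFn π q ((π n).pt j) ^ 2 = 1 / (π n).len j - 1 := by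
  have hs : (π n).pt j ∈ Set.Ico (0 : ℝ) 1 := ⟨(π n).pt_nonneg hj.le, (π n).pt_lt_one hj⟩
  have := h.sum_haarFn_mul h0 n hs hs
  rw [if_pos rfl, (π n).cell_pt hj] at this
  rw [← this]
  exact Finset.sum_congr rfl fun q _ => sq _

end idx

/-! ### An L² bound from the nested structure of the supports. -/

/-- An `L²` bound for `∑_q a_q ∑_j μ_j² a_q(j)` when the probability densities `a_q` are such that
of any two, one is constant on the support of the other. -/
theorem sum_mul_sq_sum_le {ι : Type*} (Q : Finset ι) (N : ℕ) (μ : ℕ → ℝ) (a : ι → ℕ → ℝ)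
    (hμ : ∀ j < N, 0 < μ j) (hμ1 : ∑ j ∈ Finset.range N, μ j = 1) (ha : ∀ q j, 0 ≤ a q j)
    (h1 : ∀ j < N, ∑ q ∈ Q, a q j ≤ 1 / μ j)
    (h2 : ∀ q ∈ Q, ∑ j ∈ Finset.range N, μ j * a q j = 1)
    (h3 : ∀ q ∈ Q, ∀ r ∈ Q, q ≠ r →
      (∀ j j', a r j ≠ 0 → a r j' ≠ 0 → a q j = a q j') ∨
      (∀ j j', a q j ≠ 0 → a q j' ≠ 0 → a r j = a r j'))
    (h4 : ∀ q ∈ Q, (∑ j ∈ Finset.range N, μ j ^ 2 * a q j) *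
      (∑ j ∈ Finset.range N, μ j * a q j ^ 2) ≤ 2) :
    ∑ j ∈ Finset.range N, μ j *
      (∑ q ∈ Q, a q j * ∑ l ∈ Finset.range N, μ l ^ 2 * a q l) ^ 2 ≤ 4 := by
  classical
  set c : ι → ℝ := fun q => ∑ l ∈ Finset.range N, μ l ^ 2 * a q l with hc
  set d : ι → ι → ℝ := fun q r => ∑ j ∈ Finset.range N, μ j ^ 2 * (a q j * a r j) with hd
  have hμ0 : ∀ j ∈ Finset.range N, 0 ≤ μ j := fun j hj => (hμ j (Finset.mem_range.1 hj)).le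
  have c0 : ∀ q, 0 ≤ c q := fun q =>
    Finset.sum_nonneg fun j _ => mul_nonneg (sq_nonneg _) (ha q j)
  have d0 : ∀ q r, 0 ≤ d q r := fun q r =>
    Finset.sum_nonneg fun j _ => mul_nonneg (sq_nonneg _) (mul_nonneg (ha q j) (ha r j))
  have d_sum : ∀ q ∈ Q, ∑ r ∈ Q, d q r ≤ 1 := by
    intro q hq
    rw [← h2 q hq, hd, Finset.sum_comm]
    refine Finset.sum_le_sum fun j hj => ?_
    rw [← Finset.mul_sum, ← Finset.mul_sum]
    have hj' := hμ j (Finset.mem_range.1 hj)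
    calc μ j ^ 2 * (a q j * ∑ r ∈ Q, a r j) ≤ μ j ^ 2 * (a q j * (1 / μ j)) := by
          gcongr
          · exact ha q j
          · exact h1 j (Finset.mem_range.1 hj)
      _ = μ j * a q j := by field_simp
  have d_comm : ∀ q r, d q r = d r q := fun q r => by simp only [hd, mul_comm (a q _)]
  have c_sum : ∑ q ∈ Q, c q ≤ 1 := by
    rw [← hμ1, hc, Finset.sum_comm]
    refine Finset.sum_le_sum fun j hj => ?_
    rw [← Finset.mul_sum]
    have hj' := hμ j (Finset.mem_range.1 hj)
    calc μ j ^ 2 * ∑ r ∈ Q, a r j ≤ μ j ^ 2 * (1 / μ j) := by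
          gcongr
          exact h1 j (Finset.mem_range.1 hj)
      _ = μ j := by field_simp
  -- If `a q` is constant where `a r` is nonzero, integrating `a q` against the probability density
  -- `a r` returns that constant, which `d q r` also carries as a factor next to `c r`.
  have const : ∀ q ∈ Q, ∀ r ∈ Q, (∀ j j', a r j ≠ 0 → a r j' ≠ 0 → a q j = a q j') →
      c r * ∑ j ∈ Finset.range N, μ j * (a q j * a r j) = d q r := by
    intro q hq r hr hh
    by_cases hz : ∃ j, a r j ≠ 0
    · obtain ⟨j₀, hj₀⟩ := hz
      have e : ∀ j, a q j * a r j = a q j₀ * a r j := by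
        intro j
        by_cases hj : a r j = 0
        · rw [hj, mul_zero, mul_zero]
        · rw [hh j j₀ hj hj₀]
      simp only [hd, hc, e, mul_left_comm _ (a q j₀), ← Finset.mul_sum, h2 r hr]
      ring
    · push Not at hz
      simp [hd, hz]
  -- Which of the two is constant on the other depends on the pair, so both possible bounds are
  -- added. After summation each contributes at most 1 through `d_sum` and `c_sum`, and the diagonal
  -- contributes 2.
  have cross : ∀ q ∈ Q, ∀ r ∈ Q, q ≠ r →
      c q * c r * ∑ j ∈ Finset.range N, μ j * (a q j * a r j) ≤ c q * d q r + c r * d q r := by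
    intro q hq r hr hqr
    rcases h3 q hq r hr hqr with hh | hh
    · have := const q hq r hr hh
      rw [mul_assoc, this]
      linarith [mul_nonneg (c0 r) (d0 q r)]
    · have := const r hr q hq hh
      simp only [mul_comm (a r _)] at this
      rw [mul_comm (c q), mul_assoc, this, d_comm r q]
      linarith [mul_nonneg (c0 q) (d0 q r)]
  have diag : ∀ q ∈ Q, c q * c q * ∑ j ∈ Finset.range N, μ j * (a q j * a q j) ≤ c q * 2 := by
    intro q hq
    rw [mul_assoc]
    refine mul_le_mul_of_nonneg_left ?_ (c0 q)
    simpa only [hc, ← sq] using h4 q hq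
  calc ∑ j ∈ Finset.range N, μ j * (∑ q ∈ Q, a q j * c q) ^ 2
      = ∑ q ∈ Q, ∑ r ∈ Q, c q * c r * ∑ j ∈ Finset.range N, μ j * (a q j * a r j) := by
        have e : ∀ j, μ j * (∑ q ∈ Q, a q j * c q) ^ 2 =
            ∑ q ∈ Q, ∑ r ∈ Q, c q * c r * (μ j * (a q j * a r j)) := by
          intro j
          rw [sq, Finset.sum_mul_sum, Finset.mul_sum]
          refine Finset.sum_congr rfl fun q _ => ?_
          rw [Finset.mul_sum]
          exact Finset.sum_congr rfl fun r _ => by ring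
        simp only [e, Finset.mul_sum]
        rw [Finset.sum_comm]
        exact Finset.sum_congr rfl fun q _ => Finset.sum_comm
    _ ≤ ∑ q ∈ Q, ∑ r ∈ Q, ((c q * d q r + c r * d q r) + if q = r then c q * 2 else 0) := by
        refine Finset.sum_le_sum fun q hq => Finset.sum_le_sum fun r hr => ?_
        by_cases hqr : q = r
        · subst hqr
          rw [if_pos rfl]
          have := diag q hq
          have := mul_nonneg (c0 q) (d0 q q)
          linarith
        · rw [if_neg hqr, add_zero]
          exact cross q hq r hr hqr
    _ = ∑ q ∈ Q, c q * ∑ r ∈ Q, d q r + ∑ r ∈ Q, c r * ∑ q ∈ Q, d r q + 2 * ∑ q ∈ Q, c q := by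
        simp only [Finset.sum_add_distrib, Finset.mul_sum, Finset.sum_ite_eq]
        congr 1
        · congr 1
          rw [Finset.sum_comm]
          simp only [d_comm]
        · refine Finset.sum_congr rfl fun q hq => ?_
          rw [if_pos hq, mul_comm]
    _ ≤ ∑ q ∈ Q, c q * 1 + ∑ q ∈ Q, c q * 1 + 2 * ∑ q ∈ Q, c q := by
        gcongr with q hq q hq
        · exact c0 q
        · exact d_sum q hq
        · exact c0 q
        · exact d_sum q hq
    _ ≤ 4 := by
        simp only [mul_one]
        linarith

/-! ### Slopes of φ and the limit of the expected quadratic variation. -/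

theorem exists_forall_mesh_osc {π : ℕ → UnitPartition}
    (hmesh : Tendsto (fun n => (π n).mesh) atTop (𝓝 0)) {f : ℝ → ℝ}
    (hf : ContinuousOn f (Set.Icc 0 1)) {ε : ℝ} (hε : 0 < ε) :
    ∃ n₀, ∀ n ≥ n₀, ∀ s ∈ Set.Icc (0 : ℝ) 1, ∀ t ∈ Set.Icc (0 : ℝ) 1,
      |s - t| ≤ (π n).mesh → |f s - f t| ≤ ε := by
  obtain ⟨δ, hδ, H⟩ := Metric.uniformContinuousOn_iff.1
    (isCompact_Icc.uniformContinuousOn_of_continuous hf) ε hε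
  obtain ⟨n₀, hn₀⟩ := eventually_atTop.1 (hmesh.eventually (gt_mem_nhds hδ))
  exact ⟨n₀, fun n hn s hs t ht hst => (H s hs t ht (hst.trans_lt (hn₀ n hn))).le⟩

/-- The mean slope of `φ` over the `j`-th interval. -/
noncomputable def UnitPartition.slope (p : UnitPartition) (φ : ℝ → ℝ) (j : ℕ) : ℝ :=
  (φ (p.pt (j + 1)) - φ (p.pt j)) / p.len j

theorem UnitPartition.len_mul_slope (p : UnitPartition) (φ : ℝ → ℝ) {j : ℕ} (hj : j < p.N) :
    p.len j * p.slope φ j = φ (p.pt (j + 1)) - φ (p.pt j) :=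
  mul_div_cancel₀ _ (p.len_pos hj).ne'

theorem UnitPartition.slope_nonneg (p : UnitPartition) {φ : ℝ → ℝ}
    (hφ : MonotoneOn φ (Set.Icc 0 1)) {j : ℕ} (hj : j < p.N) : 0 ≤ p.slope φ j :=
  div_nonneg (sub_nonneg.2 (hφ (p.pt_mem hj.le) (p.pt_mem hj) (p.pt_lt j hj).le)) (p.len_pos hj).le

/-- The energy `∑ (Δφ)² / Δt` of `φ` along a partition. -/
noncomputable def UnitPartition.energy (p : UnitPartition) (φ : ℝ → ℝ) : ℝ :=
  ∑ j ∈ Finset.range p.N, p.len j * p.slope φ j ^ 2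

section mean

variable {π : ℕ → UnitPartition} {φ : ℝ → ℝ}

/-- Let `E` be the excess of an increment of φ over slope `2 * C`. A weight at most `C` forces slope
at most `2 * C` on the shorter half of a support, so the longer half has at least the excess of the
whole. Thus a positive excess would survive on ever shorter intervals, contradicting continuity of
φ. -/
theorem slope_le_of_weight_le (h : IsNested π)
    (hmesh : Tendsto (fun n => (π n).mesh) atTop (𝓝 0))
    (hφ : MonotoneOn φ (Set.Icc 0 1)) (hc : ContinuousOn φ (Set.Icc 0 1)) {C : ℝ} (hC : 0 ≤ C)
    (hw : ∀ q, IsHaarIndex π q → schauderWeight π φ q ≤ C) (n : ℕ) {j : ℕ} (hj : j < (π n).N) :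
    (π n).slope φ j ≤ 2 * C := by
  set E : ℝ → ℝ → ℝ := fun s t => φ t - φ s - 2 * C * (t - s) with hE
  have split : ∀ q, IsHaarIndex π q →
      E (suppLeft π q) (suppRight π q) ≤ E (suppLeft π q) (suppMid π q) ∨
      E (suppLeft π q) (suppRight π q) ≤ E (suppMid π q) (suppRight π q) := by
    intro q hq
    have h1 := h.suppLeft_lt hq
    have h2 := h.suppMid_lt hq
    have h3 := h.suppLeft_nonneg hq
    have h4 := h.suppRight_le_one hq
    have a := sub_pos.2 h1
    have b := sub_pos.2 h2
    have c := sub_pos.2 (h1.trans h2)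
    have m1 : φ (suppLeft π q) ≤ φ (suppMid π q) :=
      hφ ⟨h3, by linarith⟩ ⟨by linarith, by linarith⟩ h1.le
    have m2 : φ (suppMid π q) ≤ φ (suppRight π q) :=
      hφ ⟨by linarith, by linarith⟩ ⟨by linarith, h4⟩ h2.le
    have hw' := hw q hq
    simp only [schauderWeight] at hw'
    rw [div_le_iff₀ (by positivity)] at hw'
    rcases le_total (suppMid π q - suppLeft π q) (suppRight π q - suppMid π q) with hle | hle
    · right
      have : (φ (suppMid π q) - φ (suppLeft π q)) ≤ 2 * C * (suppMid π q - suppLeft π q) := by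
        have hb2 : 0 < (suppRight π q - suppMid π q) ^ 2 := by positivity
        refine le_of_mul_le_mul_right ?_ hb2
        have e1 : 0 ≤ (suppMid π q - suppLeft π q) ^ 2 * (φ (suppRight π q) - φ (suppMid π q)) :=
          mul_nonneg (sq_nonneg _) (sub_nonneg.2 m2)
        have e2 : C * ((suppMid π q - suppLeft π q) * (suppRight π q - suppMid π q) *
            (suppRight π q - suppLeft π q)) ≤ C * ((suppMid π q - suppLeft π q) *
            (suppRight π q - suppMid π q) * (2 * (suppRight π q - suppMid π q))) := by
          gcongr
          linarith
        linarith
      simp only [hE]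
      linarith
    · left
      have : (φ (suppRight π q) - φ (suppMid π q)) ≤ 2 * C * (suppRight π q - suppMid π q) := by
        have hb2 : 0 < (suppMid π q - suppLeft π q) ^ 2 := by positivity
        refine le_of_mul_le_mul_right ?_ hb2
        have e1 : 0 ≤ (φ (suppMid π q) - φ (suppLeft π q)) * (suppRight π q - suppMid π q) ^ 2 :=
          mul_nonneg (sub_nonneg.2 m1) (sq_nonneg _)
        have e2 : C * ((suppMid π q - suppLeft π q) * (suppRight π q - suppMid π q) *
            (suppRight π q - suppLeft π q)) ≤ C * ((suppMid π q - suppLeft π q) *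
            (suppRight π q - suppMid π q) * (2 * (suppMid π q - suppLeft π q))) := by
          gcongr
          linarith
        linarith
      simp only [hE]
      linarith
  -- Descent in `i`: the right half is already an interval of the next partition, and the left half
  -- is the stretch treated for the previous `i`.
  have inner : ∀ m, ∀ k < (π m).N, ∀ i, 1 ≤ i → i ≤ refIndex π m (k + 1) - refIndex π m k →
      ∃ l < i, E ((π (m + 1)).pt (refIndex π m k)) ((π (m + 1)).pt (refIndex π m k + i)) ≤
        E ((π (m + 1)).pt (refIndex π m k + l)) ((π (m + 1)).pt (refIndex π m k + l + 1)) := by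
    intro m k hk i hi
    induction i, hi using Nat.le_induction with
    | base => exact fun _ => ⟨0, one_pos, le_rfl⟩
    | succ i hi ih =>
      intro hi'
      have hq : IsHaarIndex π (m, k, i + 1) := ⟨hk, Finset.mem_Icc.2 ⟨Nat.succ_le_succ hi, hi'⟩⟩
      rcases split _ hq with hs | hs
      · obtain ⟨l, hl, hl'⟩ := ih (by omega)
        exact ⟨l, by omega, hs.trans hl'⟩
      · exact ⟨i, by omega, hs⟩
  have step : ∀ m, ∀ k < (π m).N, ∃ l < (π (m + 1)).N,
      E ((π m).pt k) ((π m).pt (k + 1)) ≤ E ((π (m + 1)).pt l) ((π (m + 1)).pt (l + 1)) := by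
    intro m k hk
    have hlt := h.refIndex_lt hk
    obtain ⟨_, e1⟩ := h.refIndex_spec hk.le
    obtain ⟨b2, e2⟩ := h.refIndex_spec (m := m) (k := k + 1) hk
    obtain ⟨l, hl, hl'⟩ := inner m k hk (refIndex π m (k + 1) - refIndex π m k) (by omega) le_rfl
    rw [Nat.add_sub_of_le hlt.le, e1, e2] at hl'
    exact ⟨_, by omega, hl'⟩
  have all : ∀ n' ≥ n, ∃ l < (π n').N,
      E ((π n).pt j) ((π n).pt (j + 1)) ≤ E ((π n').pt l) ((π n').pt (l + 1)) := by
    intro n' hn'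
    induction n', hn' using Nat.le_induction with
    | base => exact ⟨j, hj, le_rfl⟩
    | succ n' _ ih =>
      obtain ⟨l, hl, hl'⟩ := ih
      obtain ⟨l', hl1, hl2⟩ := step n' l hl
      exact ⟨l', hl1, hl'.trans hl2⟩
  have nonpos : E ((π n).pt j) ((π n).pt (j + 1)) ≤ 0 := by
    refine le_of_forall_pos_le_add fun ε hε => ?_
    obtain ⟨n₀, hn₀⟩ := exists_forall_mesh_osc hmesh hc hε
    obtain ⟨l, hl, hl'⟩ := all (max n n₀) (le_max_left _ _)
    have h1 := hn₀ _ (le_max_right n n₀) _ ((π (max n n₀)).pt_mem (i := l + 1) hl) _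
      ((π (max n n₀)).pt_mem hl.le) (by
        rw [abs_of_pos (sub_pos.2 ((π (max n n₀)).pt_lt l hl))]
        exact (π (max n n₀)).len_le_mesh hl)
    have h2 := (abs_le.1 h1).2
    have h3 := (π (max n n₀)).pt_lt l hl
    have h4 := mul_nonneg hC (sub_nonneg.2 h3.le)
    simp only [hE] at hl' ⊢
    linarith
  rw [UnitPartition.slope, div_le_iff₀ ((π n).len_pos hj)]
  simp only [hE] at nonpos
  rw [UnitPartition.len]
  linarith

/-- Coarse slopes are length-weighted averages of fine slopes, so this is the Pythagorean identity
for a martingale. Regrouping shows that the mixed term equals the coarse energy. -/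
theorem IsNested.sum_len_mul_slope_sub_sq (h : IsNested π) {m n : ℕ} (hmn : m ≤ n) :
    ∑ j ∈ Finset.range (π n).N, (π n).len j *
        ((π n).slope φ j - (π m).slope φ ((π m).cell ((π n).pt j))) ^ 2 =
      (π n).energy φ - (π m).energy φ := by
  have e1 := UnitPartition.sum_regroup (h m n hmn) (fun k => (π m).slope φ k) φ
  have e2 := UnitPartition.sum_regroup (h m n hmn) (fun k => (π m).slope φ k ^ 2) (fun x => x)
  have e3 : ∑ k ∈ Finset.range (π m).N, (φ ((π m).pt (k + 1)) - φ ((π m).pt k)) *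
      (π m).slope φ k = (π m).energy φ := by
    refine Finset.sum_congr rfl fun k hk => ?_
    rw [← (π m).len_mul_slope φ (Finset.mem_range.1 hk)]
    ring
  have e4 : ∑ k ∈ Finset.range (π m).N, ((π m).pt (k + 1) - (π m).pt k) *
      (π m).slope φ k ^ 2 = (π m).energy φ := rfl
  rw [e3] at e1
  rw [e4] at e2
  have e5 : (π n).energy φ - (π m).energy φ =
      (π n).energy φ - 2 * (π m).energy φ + (π m).energy φ := by ring
  rw [e5]
  nth_rewrite 1 [← e1]
  rw [← e2, UnitPartition.energy, Finset.mul_sum, ← Finset.sum_sub_distrib,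
    ← Finset.sum_add_distrib]
  refine Finset.sum_congr rfl fun j hj => ?_
  rw [← (π n).len_mul_slope φ (Finset.mem_range.1 hj), UnitPartition.len]
  ring

theorem energy_le (hφ : MonotoneOn φ (Set.Icc 0 1)) {Λ : ℝ} (p : UnitPartition)
    (hΛ : ∀ j < p.N, p.slope φ j ≤ Λ) : p.energy φ ≤ (φ 1 - φ 0) * Λ := by
  have : φ 1 - φ 0 = ∑ j ∈ Finset.range p.N, (φ (p.pt (j + 1)) - φ (p.pt j)) := by
    rw [Finset.sum_range_sub (fun j => φ (p.pt j)), p.pt_last, p.pt_zero]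
  rw [this, Finset.sum_mul]
  refine Finset.sum_le_sum fun j hj => ?_
  have hj' := Finset.mem_range.1 hj
  rw [← p.len_mul_slope φ hj', sq, ← mul_assoc]
  exact mul_le_mul_of_nonneg_left (hΛ j hj')
    (mul_nonneg (p.len_pos hj').le (p.slope_nonneg hφ hj'))

theorem IsNested.exists_energy_sub_le (h : IsNested π) {B : ℝ} (hB : ∀ n, (π n).energy φ ≤ B)
    {ε : ℝ} (hε : 0 < ε) : ∃ m, ∀ n ≥ m, (π n).energy φ - (π m).energy φ ≤ ε := by
  have mono : Monotone fun n => (π n).energy φ := by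
    intro m n hmn
    have := h.sum_len_mul_slope_sub_sq (φ := φ) hmn
    have h2 : 0 ≤ (π n).energy φ - (π m).energy φ := by
      rw [← this]
      exact Finset.sum_nonneg fun j hj =>
        mul_nonneg ((π n).len_pos (Finset.mem_range.1 hj)).le (sq_nonneg _)
    exact sub_nonneg.1 h2
  have bdd : BddAbove (Set.range fun n => (π n).energy φ) := ⟨B, by rintro _ ⟨n, rfl⟩; exact hB n⟩
  have lim := tendsto_atTop_ciSup mono bdd
  obtain ⟨m, hm⟩ := (lim.eventually (lt_mem_nhds (sub_lt_self _ hε))).exists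
  refine ⟨m, fun n _ => ?_⟩
  have := le_ciSup bdd n
  linarith

/-- The expected quadratic variation along `π n` of the Schauder series up to the `J`-th point. -/
noncomputable def meanQV (π : ℕ → UnitPartition) (φ : ℝ → ℝ) (n J : ℕ) : ℝ :=
  ∑ q ∈ haarIdx π n, schauderWeight π φ q *
    ∑ j ∈ Finset.range J, (π n).len j ^ 2 * haarFn π q ((π n).pt j) ^ 2

/-- Exchanging the sums pairs `|f|` with the function `K`, whose L² norm is at most 2 by
`sum_mul_sq_sum_le`; then Cauchy–Schwarz. The bound is uniform in `n`, so slopes close in L² give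
close expected quadratic variations. -/
theorem IsNested.sum_weighted_le (h : IsNested π) (h0 : (π 0).N = 1) (n : ℕ) (f : ℕ → ℝ)
    {J : ℕ} (hJ : J ≤ (π n).N) :
    |∑ q ∈ haarIdx π n, (∑ l ∈ Finset.range (π n).N, (π n).len l * f l *
        haarFn π q ((π n).pt l) ^ 2) *
      ∑ j ∈ Finset.range J, (π n).len j ^ 2 * haarFn π q ((π n).pt j) ^ 2| ≤
      2 * √(∑ j ∈ Finset.range (π n).N, (π n).len j * f j ^ 2) := by
  set p := π n
  have len0 : ∀ j ∈ Finset.range p.N, 0 ≤ p.len j := fun j hj =>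
    (p.len_pos (Finset.mem_range.1 hj)).le
  set a : ℕ × ℕ × ℕ → ℕ → ℝ := fun q j => haarFn π q (p.pt j) ^ 2 with ha
  have a0 : ∀ q j, 0 ≤ a q j := fun q j => sq_nonneg _
  set c : ℕ × ℕ × ℕ → ℝ := fun q => ∑ l ∈ Finset.range p.N, p.len l ^ 2 * a q l with hc
  set K : ℕ → ℝ := fun j => ∑ q ∈ haarIdx π n, a q j * c q with hK
  have K4 : ∑ j ∈ Finset.range p.N, p.len j * K j ^ 2 ≤ 4 := by
    refine sum_mul_sq_sum_le _ _ _ _ (fun j hj => p.len_pos hj) p.sum_len a0 ?_ ?_ ?_ ?_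
    · intro j hj
      rw [h.sum_haarFn_sq h0 hj]
      linarith
    · intro q hq
      rw [mem_haarIdx] at hq
      exact h.sum_len_mul_haarFn_sq hq.2 hq.1
    · intro q hq r hr hqr
      rw [mem_haarIdx] at hq hr
      have nz : ∀ q j, a q j ≠ 0 → haarFn π q (p.pt j) ≠ 0 := fun q j hz h0 =>
        hz (by simp only [ha, h0]; norm_num)
      refine (h.haarFn_const_on_supp hq.2 hr.2 hqr).imp ?_ ?_
      · intro hh j j' hj hj'
        simp only [ha]
        rw [hh _ _ (nz _ _ hj) (nz _ _ hj')]
      · intro hh j j' hj hj'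
        simp only [ha]
        rw [hh _ _ (nz _ _ hj) (nz _ _ hj')]
    · intro q hq
      rw [mem_haarIdx] at hq
      exact h.sum_len_sq_mul_haarFn_sq_mul_le hq.2 hq.1
  have CS : (∑ j ∈ Finset.range p.N, p.len j * |f j| * K j) ^ 2 ≤
      (∑ j ∈ Finset.range p.N, p.len j * f j ^ 2) *
        ∑ j ∈ Finset.range p.N, p.len j * K j ^ 2 := by
    refine Finset.sum_sq_le_sum_mul_sum_of_sq_le_mul _
      (fun j hj => mul_nonneg (len0 j hj) (sq_nonneg _))
      (fun j hj => mul_nonneg (len0 j hj) (sq_nonneg _)) fun j _ => ?_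
    rw [mul_pow, mul_pow, sq_abs]
    exact le_of_eq (by ring)
  have S0 : 0 ≤ ∑ j ∈ Finset.range p.N, p.len j * f j ^ 2 :=
    Finset.sum_nonneg fun j hj => mul_nonneg (len0 j hj) (sq_nonneg _)
  calc _ ≤ ∑ q ∈ haarIdx π n, (∑ l ∈ Finset.range p.N, p.len l * |f l| * a q l) * c q := by
        refine (Finset.abs_sum_le_sum_abs _ _).trans (Finset.sum_le_sum fun q _ => ?_)
        rw [abs_mul]
        refine mul_le_mul ?_ ?_ (abs_nonneg _) ?_
        · refine (Finset.abs_sum_le_sum_abs _ _).trans (Finset.sum_le_sum fun l hl => ?_)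
          rw [abs_mul, abs_mul, abs_of_nonneg (len0 l hl), abs_of_nonneg (a0 q l)]
        · rw [abs_of_nonneg (Finset.sum_nonneg fun j _ => mul_nonneg (sq_nonneg _) (a0 q j))]
          exact Finset.sum_le_sum_of_subset_of_nonneg
            (Finset.range_subset_range.2 hJ) fun j _ _ => mul_nonneg (sq_nonneg _) (a0 q j)
        · exact Finset.sum_nonneg fun l hl =>
            mul_nonneg (mul_nonneg (len0 l hl) (abs_nonneg _)) (a0 q l)
    _ = ∑ j ∈ Finset.range p.N, p.len j * |f j| * K j := by
        simp only [hK, Finset.sum_mul, Finset.mul_sum]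
        rw [Finset.sum_comm]
        exact Finset.sum_congr rfl fun j _ => Finset.sum_congr rfl fun q _ => by ring
    _ ≤ √((∑ j ∈ Finset.range p.N, p.len j * f j ^ 2) * 4) :=
        Real.le_sqrt_of_sq_le (CS.trans (mul_le_mul_of_nonneg_left K4 S0))
    _ = 2 * √(∑ j ∈ Finset.range p.N, p.len j * f j ^ 2) := by
        rw [Real.sqrt_mul S0, show (4 : ℝ) = 2 ^ 2 by norm_num, Real.sqrt_sq (by norm_num),
          mul_comm]

/-- The slopes at level `n` are split into the slopes `s` frozen at level `m` and the fluctuation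
`g`, with squared L² norm the energy difference. Frozen slopes can be summed exactly over levels at
least `m`, and the levels below `m` contribute little because `π n` is much finer than `π m`. -/
theorem IsNested.abs_meanQV_sub_le (h : IsNested π) (h0 : (π 0).N = 1) (hφ0 : φ 0 = 0)
    (hφ : MonotoneOn φ (Set.Icc 0 1)) {Λ : ℝ}
    (hΛ : ∀ n, ∀ j < (π n).N, (π n).slope φ j ≤ Λ) {m n : ℕ} (hmn : m ≤ n) {J : ℕ}
    (hJ : J ≤ (π n).N) :
    |meanQV π φ n J - φ ((π n).pt J)| ≤
      3 * √((π n).energy φ - (π m).energy φ) + Λ * ((π n).mesh / (π m).minMesh) := by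
  have hsub := h.sum_len_mul_slope_sub_sq (φ := φ) hmn
  set p := π n
  have len0 : ∀ j ∈ Finset.range p.N, 0 ≤ p.len j := fun j hj =>
    (p.len_pos (Finset.mem_range.1 hj)).le
  have hpt : ∀ j < p.N, p.pt j ∈ Set.Ico (0 : ℝ) 1 := fun j hj =>
    ⟨p.pt_nonneg hj.le, p.pt_lt_one hj⟩
  have memJ : ∀ j ∈ Finset.range J, j < p.N := fun j hj => (Finset.mem_range.1 hj).trans_le hJ
  set a : ℕ × ℕ × ℕ → ℕ → ℝ := fun q j => haarFn π q (p.pt j) ^ 2 with ha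
  have a0 : ∀ q j, 0 ≤ a q j := fun q j => sq_nonneg _
  set cJ : ℕ × ℕ × ℕ → ℝ := fun q => ∑ l ∈ Finset.range J, p.len l ^ 2 * a q l with hcJ
  have cJ0 : ∀ q, 0 ≤ cJ q := fun q =>
    Finset.sum_nonneg fun j _ => mul_nonneg (sq_nonneg _) (a0 q j)
  set s : ℕ → ℝ := fun j => (π m).slope φ ((π m).cell (p.pt j)) with hs
  set g : ℕ → ℝ := fun j => p.slope φ j - s j with hg
  set Lm : ℕ → ℝ := fun j => (π m).len ((π m).cell (p.pt j)) with hLm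
  have s0 : ∀ j, 0 ≤ s j := fun j => (π m).slope_nonneg hφ ((π m).cell_lt _)
  have sΛ : ∀ j, s j ≤ Λ := fun j => hΛ m _ ((π m).cell_lt _)
  have Λ0 : 0 ≤ Λ := (s0 0).trans (sΛ 0)
  have Lm0 : ∀ j, 0 < Lm j := fun j => (π m).len_pos ((π m).cell_lt _)
  have minm := (π m).minMesh_pos
  have small : ∑ j ∈ Finset.range J, p.len j ^ 2 / Lm j ≤ p.mesh / (π m).minMesh := by
    calc ∑ j ∈ Finset.range J, p.len j ^ 2 / Lm j
        ≤ ∑ j ∈ Finset.range J, p.len j ^ 2 / (π m).minMesh := by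
          refine Finset.sum_le_sum fun j _ => ?_
          gcongr
          exact (π m).minMesh_le_len ((π m).cell_lt _)
      _ ≤ ∑ j ∈ Finset.range p.N, p.len j ^ 2 / (π m).minMesh :=
          Finset.sum_le_sum_of_subset_of_nonneg (Finset.range_subset_range.2 hJ)
            fun j _ _ => by positivity
      _ ≤ p.mesh / (π m).minMesh := by
          rw [← Finset.sum_div]
          gcongr
          exact p.sum_len_sq_le
  set ws : ℕ × ℕ × ℕ → ℝ := fun q => ∑ l ∈ Finset.range p.N, p.len l * s l * a q l with hws
  set wg : ℕ × ℕ × ℕ → ℝ := fun q => ∑ l ∈ Finset.range p.N, p.len l * g l * a q l with hwg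
  have one : ∀ q ∈ haarIdx π n, ∑ l ∈ Finset.range p.N, p.len l * a q l = 1 := fun q hq => by
    rw [mem_haarIdx] at hq
    exact h.sum_len_mul_haarFn_sq hq.2 hq.1
  have w_split : ∀ q ∈ haarIdx π n, schauderWeight π φ q = ws q + wg q := by
    intro q hq
    rw [mem_haarIdx] at hq
    rw [← h.sum_increment_mul_haarFn_sq hq.2 hq.1 φ, hws, hwg, ← Finset.sum_add_distrib]
    refine Finset.sum_congr rfl fun j hj => ?_
    rw [← p.len_mul_slope φ (Finset.mem_range.1 hj)]
    simp only [hg, ha]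
    ring
  have ws0 : ∀ q, 0 ≤ ws q := fun q =>
    Finset.sum_nonneg fun l hl => mul_nonneg (mul_nonneg (len0 l hl) (s0 l)) (a0 q l)
  have wsΛ : ∀ q ∈ haarIdx π n, ws q ≤ Λ := fun q hq => by
    calc ws q ≤ ∑ l ∈ Finset.range p.N, Λ * (p.len l * a q l) := by
          refine Finset.sum_le_sum fun l hl => ?_
          rw [mul_comm (p.len l), mul_assoc]
          exact mul_le_mul_of_nonneg_right (sΛ l) (mul_nonneg (len0 l hl) (a0 q l))
      _ = Λ := by rw [← Finset.mul_sum, one q hq, mul_one]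
  have mean_split : meanQV π φ n J = ∑ q ∈ haarIdx π n \ haarIdx π m, ws q * cJ q +
      ∑ q ∈ haarIdx π m, ws q * cJ q + ∑ q ∈ haarIdx π n, wg q * cJ q := by
    rw [Finset.sum_sdiff (haarIdx_mono hmn), ← Finset.sum_add_distrib]
    refine Finset.sum_congr rfl fun q hq => ?_
    rw [w_split q hq, add_mul]
  have bound_g := h.sum_weighted_le h0 n g hJ
  have high : ∑ q ∈ haarIdx π n \ haarIdx π m, ws q * cJ q =
      ∑ j ∈ Finset.range J, p.len j * s j - ∑ j ∈ Finset.range J, s j * (p.len j ^ 2 / Lm j) := by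
    -- The support of such a function lies in one interval of `π m`, so its mean `ws q` of the
    -- frozen slopes is their common value there.
    have e : ∀ q ∈ haarIdx π n \ haarIdx π m, ∀ j ∈ Finset.range J,
        ws q * (p.len j ^ 2 * a q j) = s j * p.len j ^ 2 * a q j := by
      intro q hq j hj
      rw [Finset.mem_sdiff] at hq
      have hq1 := hq.1
      rw [mem_haarIdx, mem_haarIdx] at hq
      have hqm : m ≤ q.1 := by
        by_contra hc
        exact hq.2 ⟨by omega, hq.1.2⟩
      by_cases hz : a q j = 0
      · rw [hz, mul_zero, mul_zero, mul_zero]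
      · have : ws q = s j := by
          have e2 : ∀ l, p.len l * s l * a q l = s j * (p.len l * a q l) := by
            intro l
            by_cases hl : a q l = 0
            · rw [hl, mul_zero, mul_zero, mul_zero]
            · have : s l = s j := by
                simp only [hs]
                rw [h.cell_eq_of_haarFn_ne_zero hq.1.2 hqm (pow_ne_zero_iff two_ne_zero |>.1 hl)
                  (pow_ne_zero_iff two_ne_zero |>.1 hz)]
              rw [this]
              ring
          simp only [hws, e2, ← Finset.mul_sum, one q hq1, mul_one]
        rw [this]
        ring
    simp only [hcJ, Finset.mul_sum]
    rw [Finset.sum_congr rfl fun q hq => Finset.sum_congr rfl (e q hq), Finset.sum_comm,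
      ← Finset.sum_sub_distrib]
    refine Finset.sum_congr rfl fun j hj => ?_
    have hlen := p.len_pos (memJ j hj)
    have hL := Lm0 j
    rw [← Finset.mul_sum, h.sum_haarFn_sq_sdiff h0 hmn (hpt j (memJ j hj)), p.cell_pt (memJ j hj)]
    change s j * p.len j ^ 2 * (1 / p.len j - 1 / Lm j) = _
    field_simp
  have low0 : 0 ≤ ∑ q ∈ haarIdx π m, ws q * cJ q :=
    Finset.sum_nonneg fun q _ => mul_nonneg (ws0 q) (cJ0 q)
  -- At levels below `m` the kernel on the diagonal is at most `1 / Lm j`, however large `n` is.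
  have low : ∑ q ∈ haarIdx π m, ws q * cJ q ≤ Λ * (p.mesh / (π m).minMesh) := by
    calc ∑ q ∈ haarIdx π m, ws q * cJ q ≤ ∑ q ∈ haarIdx π m, Λ * cJ q :=
          Finset.sum_le_sum fun q hq =>
            mul_le_mul_of_nonneg_right (wsΛ q (haarIdx_mono hmn hq)) (cJ0 q)
      _ = Λ * ∑ j ∈ Finset.range J, p.len j ^ 2 * ∑ q ∈ haarIdx π m, a q j := by
          simp only [hcJ, ← Finset.mul_sum]
          rw [Finset.sum_comm]
          simp only [Finset.mul_sum]
      _ ≤ Λ * ∑ j ∈ Finset.range J, p.len j ^ 2 / Lm j := by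
          refine mul_le_mul_of_nonneg_left (Finset.sum_le_sum fun j hj => ?_) Λ0
          rw [div_eq_mul_one_div]
          refine mul_le_mul_of_nonneg_left ?_ (sq_nonneg _)
          have hj' := hpt j (memJ j hj)
          have := h.sum_haarFn_mul h0 m hj' hj'
          rw [if_pos rfl] at this
          simp only [ha, sq]
          rw [this]
          linarith
      _ ≤ _ := mul_le_mul_of_nonneg_left small Λ0
  have mid0 : 0 ≤ ∑ j ∈ Finset.range J, s j * (p.len j ^ 2 / Lm j) :=
    Finset.sum_nonneg fun j _ => mul_nonneg (s0 j) (div_nonneg (sq_nonneg _) (Lm0 j).le)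
  have mid : ∑ j ∈ Finset.range J, s j * (p.len j ^ 2 / Lm j) ≤ Λ * (p.mesh / (π m).minMesh) := by
    calc _ ≤ ∑ j ∈ Finset.range J, Λ * (p.len j ^ 2 / Lm j) := Finset.sum_le_sum fun j _ =>
          mul_le_mul_of_nonneg_right (sΛ j) (div_nonneg (sq_nonneg _) (Lm0 j).le)
      _ ≤ _ := by
          rw [← Finset.mul_sum]
          exact mul_le_mul_of_nonneg_left small Λ0
  have φ_eq : φ (p.pt J) = ∑ j ∈ Finset.range J, p.len j * s j +
      ∑ j ∈ Finset.range J, p.len j * g j := by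
    rw [← Finset.sum_add_distrib]
    calc φ (p.pt J) = ∑ j ∈ Finset.range J, (φ (p.pt (j + 1)) - φ (p.pt j)) := by
          rw [Finset.sum_range_sub (fun j => φ (p.pt j)), p.pt_zero, hφ0, sub_zero]
      _ = _ := by
          refine Finset.sum_congr rfl fun j hj => ?_
          rw [← p.len_mul_slope φ (memJ j hj)]
          simp only [hg]
          ring
  have g_bound : |∑ j ∈ Finset.range J, p.len j * g j| ≤
      √(∑ j ∈ Finset.range p.N, p.len j * g j ^ 2) := by
    refine Real.abs_le_sqrt ?_
    calc (∑ j ∈ Finset.range J, p.len j * g j) ^ 2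
        ≤ (∑ j ∈ Finset.range J, p.len j) * ∑ j ∈ Finset.range J, p.len j * g j ^ 2 := by
          refine Finset.sum_sq_le_sum_mul_sum_of_sq_le_mul _
            (fun j hj => (p.len_pos (memJ j hj)).le)
            (fun j hj => mul_nonneg (p.len_pos (memJ j hj)).le (sq_nonneg _)) fun j _ => ?_
          exact le_of_eq (by ring)
      _ ≤ 1 * ∑ j ∈ Finset.range p.N, p.len j * g j ^ 2 := by
          refine mul_le_mul ?_ ?_ ?_ zero_le_one
          · rw [p.sum_len_range]
            exact p.pt_le_one hJ
          · exact Finset.sum_le_sum_of_subset_of_nonneg (Finset.range_subset_range.2 hJ)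
              fun j hj _ => mul_nonneg (len0 j hj) (sq_nonneg _)
          · exact Finset.sum_nonneg fun j hj =>
              mul_nonneg (p.len_pos (memJ j hj)).le (sq_nonneg _)
      _ = _ := one_mul _
  -- The fluctuation enters twice: with constant 2 through the weights and with constant 1 through φ
  -- itself. The low-level sum and the correction in `high` have opposite signs and the same bound,
  -- so that bound is paid once.
  rw [← hsub, mean_split, high, φ_eq]
  have b1 := abs_le.1 bound_g
  have b2 := abs_le.1 g_bound
  rw [abs_le]
  constructor <;> linarith [b1.1, b1.2, b2.1, b2.2]

/-- The expected quadratic variation converges to `φ`, uniformly in the end point. -/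
theorem IsNested.exists_meanQV_close (h : IsNested π) (h0 : (π 0).N = 1)
    (hmesh : Tendsto (fun n => (π n).mesh) atTop (𝓝 0)) (hφ0 : φ 0 = 0)
    (hφ : MonotoneOn φ (Set.Icc 0 1)) {Λ : ℝ}
    (hΛ : ∀ n, ∀ j < (π n).N, (π n).slope φ j ≤ Λ) {ε : ℝ} (hε : 0 < ε) :
    ∃ n₀, ∀ n ≥ n₀, ∀ J ≤ (π n).N, |meanQV π φ n J - φ ((π n).pt J)| ≤ ε := by
  -- Three times `ε / 6` is half of `ε`; the other half is left for the mesh term, which vanishes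
  -- once `m` is fixed.
  obtain ⟨m, hm⟩ := h.exists_energy_sub_le (φ := φ) (fun n => energy_le hφ (π n) (hΛ n))
    (ε := (ε / 6) ^ 2) (by positivity)
  have lim : Tendsto (fun n => Λ * ((π n).mesh / (π m).minMesh)) atTop (𝓝 0) := by
    have := (hmesh.div_const (π m).minMesh).const_mul Λ
    rwa [zero_div, mul_zero] at this
  obtain ⟨n₁, hn₁⟩ := eventually_atTop.1 (lim.eventually (gt_mem_nhds (half_pos hε)))
  refine ⟨max m n₁, fun n hn J hJ => ?_⟩
  have b1 := h.abs_meanQV_sub_le h0 hφ0 hφ hΛ ((le_max_left m n₁).trans hn) hJ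
  have b2 := hn₁ n ((le_max_right m n₁).trans hn)
  have b3 : √((π n).energy φ - (π m).energy φ) ≤ ε / 6 :=
    Real.sqrt_le_iff.2 ⟨by positivity, hm n ((le_max_left m n₁).trans hn)⟩
  linarith

end mean

/-! ### Moments of order four and quadratic forms. -/

theorem integrable_pow_four {Ω : Type*} [MeasurableSpace Ω] {P : Measure Ω} {X : Ω → ℝ}
    (hX : MemLp X 4 P) : Integrable (fun ω => X ω ^ 4) P := by
  have h := hX.integrable_norm_pow (p := 4) (by norm_num)
  refine h.congr (ae_of_all _ fun ω => ?_)
  simp only [Real.norm_eq_abs]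
  exact (by decide : Even 4).pow_abs _

theorem memLp_two_mul {Ω : Type*} [MeasurableSpace Ω] {P : Measure Ω} {X Y : Ω → ℝ}
    (hX : MemLp X 4 P) (hY : MemLp Y 4 P) : MemLp (fun ω => X ω * Y ω) 2 P := by
  have hm : AEStronglyMeasurable (fun ω => X ω * Y ω) P := hX.1.mul hY.1
  rw [memLp_two_iff_integrable_sq hm]
  refine ((integrable_pow_four hX).add (integrable_pow_four hY)).mono' (hm.pow 2)
    (ae_of_all _ fun ω => ?_)
  rw [Real.norm_eq_abs, abs_of_nonneg (sq_nonneg _)]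
  simp only [Pi.add_apply]
  nlinarith [sq_nonneg (X ω ^ 2 - Y ω ^ 2), sq_nonneg (X ω ^ 2), sq_nonneg (Y ω ^ 2)]

theorem integral_sq_sum {Ω ι : Type*} [MeasurableSpace Ω] {P : Measure Ω} (s : Finset ι)
    (f : ι → Ω → ℝ) (hf : ∀ i ∈ s, MemLp (f i) 2 P) :
    ∫ ω, (∑ i ∈ s, f i ω) ^ 2 ∂P = ∑ i ∈ s, ∑ j ∈ s, ∫ ω, f i ω * f j ω ∂P := by
  simp only [sq, Finset.sum_mul_sum]
  have key : ∀ i ∈ s, ∀ j ∈ s, Integrable (fun ω => f i ω * f j ω) P := fun i hi j hj =>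
    (hf i hi).integrable_mul (hf j hj)
  rw [integral_finsetSum _ fun i hi => integrable_finsetSum _ (key i hi)]
  exact Finset.sum_congr rfl fun i hi => integral_finsetSum _ (key i hi)

/-- A family of centred random variables, orthogonal with variances `w`, with bounded fourth
moments and factorizing mixed moments of order four. -/
structure HasFactorizingMoments {Ω ι : Type*} [MeasurableSpace Ω] (P : Measure Ω) (S : Set ι)
    (X : ι → Ω → ℝ) (w : ι → ℝ) (M : ℝ) : Prop where
  infinite : S.Infinite
  memLp : ∀ q ∈ S, MemLp (X q) 4 P
  moment_four_le : ∀ q ∈ S, ∫ ω, X q ω ^ 4 ∂P ≤ M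
  mean_eq_zero : ∀ q ∈ S, ∫ ω, X q ω ∂P = 0
  second : ∀ q ∈ S, ∀ r ∈ S, q ≠ r → ∫ ω, X q ω * X r ω ∂P = 0
  variance_eq : ∀ q ∈ S, ∫ ω, X q ω ^ 2 ∂P = w q
  factor : ∀ q : Fin 4 → ι, Function.Injective q → (∀ j, q j ∈ S) → ∀ α : Fin 4 → ℕ,
    ∑ j, α j = 4 → ∫ ω, ∏ j, X (q j) ω ^ α j ∂P = ∏ j, ∫ ω, X (q j) ω ^ α j ∂P

namespace HasFactorizingMoments

variable {Ω ι : Type*} [MeasurableSpace Ω] {P : Measure Ω} {S : Set ι}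
  {X : ι → Ω → ℝ} {w : ι → ℝ} {M : ℝ}

theorem factor_four (H : HasFactorizingMoments P S X w M) {a b c d : ι} (ha : a ∈ S) (hb : b ∈ S)
    (hc : c ∈ S) (hd : d ∈ S) (hab : a ≠ b) (hac : a ≠ c) (had : a ≠ d) (hbc : b ≠ c)
    (hbd : b ≠ d) (hcd : c ≠ d) {i j k l : ℕ} (hs : i + j + k + l = 4) :
    ∫ ω, X a ω ^ i * X b ω ^ j * X c ω ^ k * X d ω ^ l ∂P =
      (∫ ω, X a ω ^ i ∂P) * (∫ ω, X b ω ^ j ∂P) * (∫ ω, X c ω ^ k ∂P) * ∫ ω, X d ω ^ l ∂P := by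
  have inj : Function.Injective ![a, b, c, d] := by
    intro x y
    fin_cases x <;> fin_cases y <;>
      simp [hab, hac, had, hbc, hbd, hcd, hab.symm, hac.symm, had.symm, hbc.symm, hbd.symm,
        hcd.symm]
  have := H.factor ![a, b, c, d] inj (by intro x; fin_cases x <;> simp [ha, hb, hc, hd])
    ![i, j, k, l] (by simp [Fin.sum_univ_four, hs])
  simpa [Fin.prod_univ_four] using this

/-- Factorization is assumed for four distinct indices only. A product of two or three variables is
padded with unused indices of exponent 0, which exist because the index set is infinite. -/
theorem exists_notMem (H : HasFactorizingMoments P S X w M) (F : Finset ι) :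
    ∃ d ∈ S, d ∉ F := by
  obtain ⟨d, h1, h2⟩ := (H.infinite.sdiff F.finite_toSet).nonempty
  exact ⟨d, h1, h2⟩

theorem integral_sq_mul_mul [IsProbabilityMeasure P]
    (H : HasFactorizingMoments P S X w M) {a b c : ι} (ha : a ∈ S)
    (hb : b ∈ S) (hc : c ∈ S) (hab : a ≠ b) (hac : a ≠ c) (hbc : b ≠ c) :
    ∫ ω, X a ω ^ 2 * X b ω * X c ω ∂P = 0 := by
  classical
  obtain ⟨d, hd, hd'⟩ := H.exists_notMem {a, b, c}
  simp only [Finset.mem_insert, Finset.mem_singleton, not_or] at hd'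
  have := H.factor_four ha hb hc hd hab hac (Ne.symm hd'.1) hbc (Ne.symm hd'.2.1)
    (Ne.symm hd'.2.2) (i := 2) (j := 1) (k := 1) (l := 0) rfl
  simpa [H.mean_eq_zero b hb] using this

theorem integral_sq_mul_sq [IsProbabilityMeasure P]
    (H : HasFactorizingMoments P S X w M) {a b : ι} (ha : a ∈ S)
    (hb : b ∈ S) (hab : a ≠ b) : ∫ ω, X a ω ^ 2 * X b ω ^ 2 ∂P = w a * w b := by
  classical
  obtain ⟨c, hc, hc'⟩ := H.exists_notMem {a, b}
  obtain ⟨d, hd, hd'⟩ := H.exists_notMem {a, b, c}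
  simp only [Finset.mem_insert, Finset.mem_singleton, not_or] at hc' hd'
  have := H.factor_four ha hb hc hd hab (Ne.symm hc'.1) (Ne.symm hd'.1) (Ne.symm hc'.2)
    (Ne.symm hd'.2.1) (Ne.symm hd'.2.2) (i := 2) (j := 2) (k := 0) (l := 0) rfl
  simpa [H.variance_eq a ha, H.variance_eq b hb] using this

theorem integral_mul_four [IsProbabilityMeasure P]
    (H : HasFactorizingMoments P S X w M) {a b c d : ι} (ha : a ∈ S)
    (hb : b ∈ S) (hc : c ∈ S) (hd : d ∈ S) (hab : a ≠ b) (hac : a ≠ c) (had : a ≠ d) (hbc : b ≠ c)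
    (hbd : b ≠ d) (hcd : c ≠ d) : ∫ ω, X a ω * X b ω * X c ω * X d ω ∂P = 0 := by
  have := H.factor_four ha hb hc hd hab hac had hbc hbd hcd (i := 1) (j := 1) (k := 1) (l := 1) rfl
  simpa [H.mean_eq_zero a ha] using this

theorem integrable_sq [IsProbabilityMeasure P]
    (H : HasFactorizingMoments P S X w M) {a : ι} (ha : a ∈ S) :
    Integrable (fun ω => X a ω ^ 2) P :=
  ((H.memLp a ha).mono_exponent (by norm_num)).integrable_sq

/-- From x² ≤ 1 + x⁴. This is the bound that later controls the slopes of φ. -/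
theorem weight_le [IsProbabilityMeasure P]
    (H : HasFactorizingMoments P S X w M) {a : ι} (ha : a ∈ S) : w a ≤ 1 + M := by
  rw [← H.variance_eq a ha]
  have h1 : ∫ ω, X a ω ^ 2 ∂P ≤ ∫ ω, (1 + X a ω ^ 4) ∂P := by
    refine integral_mono (H.integrable_sq ha)
      ((integrable_const _).add (integrable_pow_four (H.memLp a ha))) fun ω => ?_
    simp only
    nlinarith [sq_nonneg (X a ω ^ 2 - 1), sq_nonneg (X a ω ^ 2)]
  rw [integral_add (integrable_const _) (integrable_pow_four (H.memLp a ha))] at h1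
  simp only [integral_const, probReal_univ, smul_eq_mul, mul_one] at h1
  linarith [H.moment_four_le a ha]

theorem bound_nonneg (H : HasFactorizingMoments P S X w M) : 0 ≤ M := by
  obtain ⟨a, ha⟩ := H.infinite.nonempty
  exact (integral_nonneg fun ω => by positivity).trans (H.moment_four_le a ha)

theorem weight_mul_le [IsProbabilityMeasure P]
    (H : HasFactorizingMoments P S X w M) {a b : ι} (ha : a ∈ S) (hb : b ∈ S)
    (hab : a ≠ b) : w a * w b ≤ M := by
  rw [← H.integral_sq_mul_sq ha hb hab]
  have i1 := integrable_pow_four (H.memLp a ha)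
  have i2 := integrable_pow_four (H.memLp b hb)
  have h1 : ∫ ω, X a ω ^ 2 * X b ω ^ 2 ∂P ≤ ∫ ω, (1 / 2 * X a ω ^ 4 + 1 / 2 * X b ω ^ 4) ∂P := by
    refine integral_mono ?_ ((i1.const_mul _).add (i2.const_mul _)) fun ω => ?_
    · have := (memLp_two_mul (H.memLp a ha) (H.memLp b hb)).integrable_sq
      simpa only [mul_pow] using this
    · simp only
      nlinarith [sq_nonneg (X a ω ^ 2 - X b ω ^ 2)]
  rw [integral_add (i1.const_mul _) (i2.const_mul _), integral_const_mul, integral_const_mul] at h1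
  linarith [H.moment_four_le a ha, H.moment_four_le b hb]

/-- Second moment of a linear combination. -/
theorem integral_sq_linear [IsProbabilityMeasure P]
    (H : HasFactorizingMoments P S X w M) (Q : Finset ι)
    (hQ : ∀ q ∈ Q, q ∈ S) (c : ι → ℝ) :
    ∫ ω, (∑ q ∈ Q, X q ω * c q) ^ 2 ∂P = ∑ q ∈ Q, c q ^ 2 * w q := by
  rw [integral_sq_sum Q (fun q ω => X q ω * c q) fun q hq =>
    ((H.memLp q (hQ q hq)).mono_exponent (by norm_num)).mul_const _]
  refine Finset.sum_congr rfl fun q hq => ?_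
  have e : ∀ r, ∀ ω, X q ω * c q * (X r ω * c r) = (c q * c r) * (X q ω * X r ω) := by
    intro r ω
    ring
  simp only [e, integral_const_mul]
  rw [Finset.sum_eq_single q]
  · simp only [← sq, H.variance_eq q (hQ q hq)]
  · intro r hr hrq
    rw [H.second q (hQ q hq) r (hQ r hr) hrq.symm, mul_zero]
  · exact fun hh => absurd hq hh

theorem memLp_quadratic [IsProbabilityMeasure P]
    (H : HasFactorizingMoments P S X w M) (Q : Finset ι)
    (hQ : ∀ q ∈ Q, q ∈ S) (A : ι → ι → ℝ) (e : ℝ) :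
    MemLp (fun ω => ∑ q ∈ Q, ∑ r ∈ Q, A q r * (X q ω * X r ω) - e) 2 P :=
  (memLp_finsetSum _ fun q hq => memLp_finsetSum _ fun r hr =>
    (memLp_two_mul (H.memLp q (hQ q hq)) (H.memLp r (hQ r hr))).const_mul _).sub (memLp_const e)

/-- Squares of distinct variables are uncorrelated, so only the diagonal terms survive. -/
theorem integral_sq_diag [IsProbabilityMeasure P]
    (H : HasFactorizingMoments P S X w M) (Q : Finset ι)
    (hQ : ∀ q ∈ Q, q ∈ S) (c : ι → ℝ) :
    ∫ ω, (∑ q ∈ Q, c q * (X q ω ^ 2 - w q)) ^ 2 ∂P ≤ M * ∑ q ∈ Q, c q ^ 2 := by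
  have i2 : ∀ q ∈ Q, Integrable (fun ω => X q ω ^ 2) P := fun q hq => H.integrable_sq (hQ q hq)
  have L2 : ∀ q ∈ Q, MemLp (fun ω => X q ω ^ 2) 2 P := fun q hq => by
    simpa only [sq] using memLp_two_mul (H.memLp q (hQ q hq)) (H.memLp q (hQ q hq))
  rw [integral_sq_sum Q (fun q ω => c q * (X q ω ^ 2 - w q)) fun q hq =>
    ((L2 q hq).sub (memLp_const _)).const_mul _, Finset.mul_sum]
  refine Finset.sum_le_sum fun q hq => ?_
  have key : ∀ r ∈ Q, ∫ ω, c q * (X q ω ^ 2 - w q) * (c r * (X r ω ^ 2 - w r)) ∂P =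
      c q * c r * (∫ ω, X q ω ^ 2 * X r ω ^ 2 ∂P - w q * w r) := by
    intro r hr
    have e : ∀ ω, c q * (X q ω ^ 2 - w q) * (c r * (X r ω ^ 2 - w r)) =
        c q * c r * ((X q ω ^ 2 * X r ω ^ 2 - w q * X r ω ^ 2) - (w r * X q ω ^ 2 - w q * w r)) :=
      fun ω => by ring
    simp only [e, integral_const_mul]
    have j1 : Integrable (fun ω => X q ω ^ 2 * X r ω ^ 2) P := (L2 q hq).integrable_mul (L2 r hr)
    have j2 : Integrable (fun ω => w q * X r ω ^ 2) P := (i2 r hr).const_mul _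
    have j3 : Integrable (fun ω => w r * X q ω ^ 2) P := (i2 q hq).const_mul _
    have j4 : Integrable (fun ω => X q ω ^ 2 * X r ω ^ 2 - w q * X r ω ^ 2) P := j1.sub j2
    have j5 : Integrable (fun ω => w r * X q ω ^ 2 - w q * w r) P := j3.sub (integrable_const _)
    rw [integral_sub j4 j5, integral_sub j1 j2, integral_sub j3 (integrable_const _),
      integral_const_mul, integral_const_mul, H.variance_eq q (hQ q hq), H.variance_eq r (hQ r hr)]
    simp only [integral_const, probReal_univ, smul_eq_mul, one_mul]
    ring
  rw [Finset.sum_congr rfl key, Finset.sum_eq_single q]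
  · have e : ∀ ω, X q ω ^ 2 * X q ω ^ 2 = X q ω ^ 4 := fun ω => by ring
    simp only [e]
    have := H.moment_four_le q (hQ q hq)
    have h2 : 0 ≤ w q * w q := mul_self_nonneg _
    nlinarith [sq_nonneg (c q)]
  · intro r hr hrq
    rw [H.integral_sq_mul_sq (hQ q hq) (hQ r hr) hrq.symm, sub_self, mul_zero]
  · exact fun hh => absurd hq hh

/-- Two different pairs share at most one index, so some variable occurs with exponent one and its
zero mean factors out. -/
theorem integral_mul_mul_of_ne [IsProbabilityMeasure P]
    (H : HasFactorizingMoments P S X w M) {a b c d : ι} (ha : a ∈ S)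
    (hb : b ∈ S) (hc : c ∈ S) (hd : d ∈ S) (hab : a ≠ b) (hcd : c ≠ d)
    (h1 : ¬(c = a ∧ d = b)) (h2 : ¬(c = b ∧ d = a)) :
    ∫ ω, (X a ω * X b ω) * (X c ω * X d ω) ∂P = 0 := by
  by_cases hac : a = c
  · subst hac
    have hbd : b ≠ d := fun h => h1 ⟨rfl, h.symm⟩
    rw [← H.integral_sq_mul_mul ha hb hd hab hcd hbd]
    exact integral_congr_ae (ae_of_all _ fun ω => by ring)
  by_cases had : a = d
  · subst had
    have hbc : b ≠ c := fun h => h2 ⟨h.symm, rfl⟩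
    rw [← H.integral_sq_mul_mul ha hb hc hab hac hbc]
    exact integral_congr_ae (ae_of_all _ fun ω => by ring)
  by_cases hbc : b = c
  · subst hbc
    rw [← H.integral_sq_mul_mul hb ha hd hab.symm hcd had]
    exact integral_congr_ae (ae_of_all _ fun ω => by ring)
  by_cases hbd : b = d
  · subst hbd
    rw [← H.integral_sq_mul_mul hb ha hc hab.symm hbc hac]
    exact integral_congr_ae (ae_of_all _ fun ω => by ring)
  rw [← H.integral_mul_four ha hb hc hd hab hac had hbc hbd hcd]
  exact integral_congr_ae (ae_of_all _ fun ω => by ring)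

/-- The term of `(a, b)` correlates only with itself and with `(b, a)`; by symmetry of `A` both give
the same value, hence the factor 2. -/
theorem integral_sq_offDiag [IsProbabilityMeasure P] [DecidableEq ι]
    (H : HasFactorizingMoments P S X w M) (Q : Finset ι)
    (hQ : ∀ q ∈ Q, q ∈ S) (A : ι → ι → ℝ) (hA : ∀ q r, A q r = A r q) :
    ∫ ω, (∑ p ∈ Q.offDiag, A p.1 p.2 * (X p.1 ω * X p.2 ω)) ^ 2 ∂P ≤
      2 * M * ∑ p ∈ Q.offDiag, A p.1 p.2 ^ 2 := by
  rw [integral_sq_sum Q.offDiag (fun p ω => A p.1 p.2 * (X p.1 ω * X p.2 ω)) fun p hp =>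
    (memLp_two_mul (H.memLp _ (hQ _ (Finset.mem_offDiag.1 hp).1))
      (H.memLp _ (hQ _ (Finset.mem_offDiag.1 hp).2.1))).const_mul _, Finset.mul_sum]
  refine Finset.sum_le_sum fun p hp => ?_
  obtain ⟨a, b⟩ := p
  obtain ⟨ha, hb, hab⟩ := Finset.mem_offDiag.1 hp
  dsimp only at ha hb hab ⊢
  have e : ∀ (r : ι × ι) (ω : Ω), A a b * (X a ω * X b ω) * (A r.1 r.2 * (X r.1 ω * X r.2 ω)) =
      A a b * A r.1 r.2 * ((X a ω * X b ω) * (X r.1 ω * X r.2 ω)) := fun r ω => by ring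
  simp only [e, integral_const_mul]
  have hne : ((a, b) : ι × ι) ≠ (b, a) := fun hh => hab (Prod.mk.inj hh).1
  have hsub : ({(a, b), (b, a)} : Finset (ι × ι)) ⊆ Q.offDiag := by
    intro r hr
    rw [Finset.mem_insert, Finset.mem_singleton] at hr
    rcases hr with rfl | rfl
    · exact hp
    · exact Finset.mem_offDiag.2 ⟨hb, ha, hab.symm⟩
  rw [← Finset.sum_subset hsub, Finset.sum_pair hne]
  · have e1 : ∀ ω, (X a ω * X b ω) * (X a ω * X b ω) = X a ω ^ 2 * X b ω ^ 2 := fun ω => by ring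
    have e2 : ∀ ω, (X a ω * X b ω) * (X b ω * X a ω) = X a ω ^ 2 * X b ω ^ 2 := fun ω => by ring
    simp only [e1, e2, H.integral_sq_mul_sq (hQ a ha) (hQ b hb) hab, hA b a]
    nlinarith [H.weight_mul_le (hQ a ha) (hQ b hb) hab, sq_nonneg (A a b)]
  · rintro ⟨c, d⟩ hr hr'
    obtain ⟨hc, hd, hcd⟩ := Finset.mem_offDiag.1 hr
    dsimp only at hc hd hcd ⊢
    simp only [Finset.mem_insert, Finset.mem_singleton, Prod.mk.injEq, not_or] at hr'
    rw [H.integral_mul_mul_of_ne (hQ a ha) (hQ b hb) (hQ c hc) (hQ d hd) hab hcd hr'.1 hr'.2,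
      mul_zero]

/-- The variance of a quadratic form is bounded by its Hilbert–Schmidt norm. -/
theorem integral_sq_quadratic_le [IsProbabilityMeasure P]
    (H : HasFactorizingMoments P S X w M) (Q : Finset ι)
    (hQ : ∀ q ∈ Q, q ∈ S) (A : ι → ι → ℝ) (hA : ∀ q r, A q r = A r q) :
    ∫ ω, (∑ q ∈ Q, ∑ r ∈ Q, A q r * (X q ω * X r ω) - ∑ q ∈ Q, A q q * w q) ^ 2 ∂P ≤
      4 * M * ∑ q ∈ Q, ∑ r ∈ Q, A q r ^ 2 := by
  classical
  have split : ∀ f : ι → ι → ℝ, ∑ q ∈ Q, ∑ r ∈ Q, f q r =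
      ∑ q ∈ Q, f q q + ∑ p ∈ Q.offDiag, f p.1 p.2 := by
    intro f
    rw [← Finset.sum_product', ← Finset.diag_union_offDiag,
      Finset.sum_union (Finset.disjoint_diag_offDiag Q), Finset.sum_diag]
  have D2 : MemLp (fun ω => ∑ q ∈ Q, A q q * (X q ω ^ 2 - w q)) 2 P := by
    refine memLp_finsetSum _ fun q hq => MemLp.const_mul ?_ _
    have := memLp_two_mul (H.memLp q (hQ q hq)) (H.memLp q (hQ q hq))
    simp only [← sq] at this
    exact this.sub (memLp_const _)
  have O2 : MemLp (fun ω => ∑ p ∈ Q.offDiag, A p.1 p.2 * (X p.1 ω * X p.2 ω)) 2 P :=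
    memLp_finsetSum _ fun p hp => (memLp_two_mul (H.memLp _ (hQ _ (Finset.mem_offDiag.1 hp).1))
      (H.memLp _ (hQ _ (Finset.mem_offDiag.1 hp).2.1))).const_mul _
  have e : ∀ ω, ∑ q ∈ Q, ∑ r ∈ Q, A q r * (X q ω * X r ω) - ∑ q ∈ Q, A q q * w q =
      ∑ q ∈ Q, A q q * (X q ω ^ 2 - w q) +
        ∑ p ∈ Q.offDiag, A p.1 p.2 * (X p.1 ω * X p.2 ω) := by
    intro ω
    rw [split fun q r => A q r * (X q ω * X r ω), add_sub_right_comm, ← Finset.sum_sub_distrib]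
    congr 1
    exact Finset.sum_congr rfl fun q _ => by ring
  simp only [e]
  rw [split fun q r => A q r ^ 2]
  calc _ ≤ ∫ ω, (2 * (∑ q ∈ Q, A q q * (X q ω ^ 2 - w q)) ^ 2 +
        2 * (∑ p ∈ Q.offDiag, A p.1 p.2 * (X p.1 ω * X p.2 ω)) ^ 2) ∂P := by
        refine integral_mono (D2.add O2).integrable_sq
          ((D2.integrable_sq.const_mul _).add (O2.integrable_sq.const_mul _)) fun ω => ?_
        simp only
        rw [← mul_add]
        exact add_sq_le
    _ ≤ 2 * (M * ∑ q ∈ Q, A q q ^ 2) + 2 * (2 * M * ∑ p ∈ Q.offDiag, A p.1 p.2 ^ 2) := by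
        rw [integral_add (D2.integrable_sq.const_mul _) (O2.integrable_sq.const_mul _),
          integral_const_mul, integral_const_mul]
        exact add_le_add (mul_le_mul_of_nonneg_left (H.integral_sq_diag Q hQ _) zero_le_two)
          (mul_le_mul_of_nonneg_left (H.integral_sq_offDiag Q hQ A hA) zero_le_two)
    _ ≤ _ := by
        have := mul_nonneg H.bound_nonneg (Finset.sum_nonneg fun q (_ : q ∈ Q) => sq_nonneg (A q q))
        linarith

end HasFactorizingMoments

/-! ### Increments of the Schauder series: variance bounds and path identities. -/

/-- The increment over the `j`-th interval of `π n` of the Schauder series with coefficients `θ`. -/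
noncomputable def schauderIncr (π : ℕ → UnitPartition) (θ : ℕ × ℕ × ℕ → ℝ) (n j : ℕ) : ℝ :=
  ∑ q ∈ haarIdx π n, θ q * ((π n).len j * haarFn π q ((π n).pt j))

section path

variable {π : ℕ → UnitPartition}

/-- Finitely many Haar functions would keep the kernel at (0, 0) bounded, but it equals `1 / len -
1` for the first interval, whose length tends to 0. -/
theorem IsNested.infinite_haarIndex (h : IsNested π) (h0 : (π 0).N = 1)
    (hmesh : Tendsto (fun n => (π n).mesh) atTop (𝓝 0)) : {q | IsHaarIndex π q}.Infinite := by
  intro hfin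
  set B := ∑ q ∈ hfin.toFinset, haarFn π q 0 ^ 2 with hB
  have hB0 : 0 ≤ B := Finset.sum_nonneg fun q _ => sq_nonneg _
  have hpos : (0 : ℝ) < 1 / (B + 2) := by positivity
  obtain ⟨n, hn⟩ := (hmesh.eventually (gt_mem_nhds hpos)).exists
  have h1 := h.sum_haarFn_sq h0 (n := n) (π n).N_pos
  have h2 : ∑ q ∈ haarIdx π n, haarFn π q ((π n).pt 0) ^ 2 ≤ B := by
    rw [(π n).pt_zero]
    refine Finset.sum_le_sum_of_subset_of_nonneg (fun q hq => ?_) fun q _ _ => sq_nonneg _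
    exact hfin.mem_toFinset.2 (mem_haarIdx.1 hq).2
  have h3 := (π n).len_pos (π n).N_pos
  have h4 := ((π n).len_le_mesh (π n).N_pos).trans_lt hn
  have h5 : B + 2 < 1 / (π n).len 0 := by
    rw [lt_div_iff₀ h3]
    rw [lt_div_iff₀ (by positivity)] at h4
    linarith
  linarith

/-- Expanding the square and exchanging sums leaves squares of the reproducing kernel weighted by
len_j² len_l². The factor 1/len_j on its diagonal turns into (len_j - len_j²)², and ∑ len² ≤ mesh ≤
1 does the rest. -/
theorem IsNested.sum_sq_kernel_le (h : IsNested π) (h0 : (π 0).N = 1) (n : ℕ) {J : ℕ}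
    (hJ : J ≤ (π n).N) :
    ∑ q ∈ haarIdx π n, ∑ r ∈ haarIdx π n, (∑ j ∈ Finset.range J, (π n).len j ^ 2 *
      (haarFn π q ((π n).pt j) * haarFn π r ((π n).pt j))) ^ 2 ≤ 4 * (π n).mesh := by
  set p := π n
  have memJ : ∀ j ∈ Finset.range J, j < p.N := fun j hj => (Finset.mem_range.1 hj).trans_le hJ
  have ker : ∀ j ∈ Finset.range J, ∀ l ∈ Finset.range J,
      ∑ q ∈ haarIdx π n, haarFn π q (p.pt j) * haarFn π q (p.pt l) =
        (if j = l then 1 / p.len j else 0) - 1 := by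
    intro j hj l hl
    have h1 : ∀ i < p.N, p.pt i ∈ Set.Ico (0 : ℝ) 1 := fun i hi =>
      ⟨p.pt_nonneg hi.le, p.pt_lt_one hi⟩
    rw [h.sum_haarFn_mul h0 n (h1 j (memJ j hj)) (h1 l (memJ l hl)), p.cell_pt (memJ j hj),
      p.cell_pt (memJ l hl)]
  have S : ∑ j ∈ Finset.range J, p.len j ^ 2 ≤ p.mesh :=
    (Finset.sum_le_sum_of_subset_of_nonneg (Finset.range_subset_range.2 hJ)
      fun j _ _ => sq_nonneg _).trans p.sum_len_sq_le
  have S0 : 0 ≤ ∑ j ∈ Finset.range J, p.len j ^ 2 := Finset.sum_nonneg fun j _ => sq_nonneg _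
  calc _ = ∑ j ∈ Finset.range J, ∑ l ∈ Finset.range J, p.len j ^ 2 * p.len l ^ 2 *
        (∑ q ∈ haarIdx π n, haarFn π q (p.pt j) * haarFn π q (p.pt l)) ^ 2 := by
        have e1 : ∀ q r, (∑ j ∈ Finset.range J, p.len j ^ 2 *
            (haarFn π q (p.pt j) * haarFn π r (p.pt j))) ^ 2 =
            ∑ j ∈ Finset.range J, ∑ l ∈ Finset.range J, p.len j ^ 2 * p.len l ^ 2 *
              ((haarFn π q (p.pt j) * haarFn π q (p.pt l)) *
                (haarFn π r (p.pt j) * haarFn π r (p.pt l))) := by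
          intro q r
          rw [sq, Finset.sum_mul_sum]
          exact Finset.sum_congr rfl fun j _ => Finset.sum_congr rfl fun l _ => by ring
        have e2 : ∀ j l, p.len j ^ 2 * p.len l ^ 2 *
            (∑ q ∈ haarIdx π n, haarFn π q (p.pt j) * haarFn π q (p.pt l)) ^ 2 =
            ∑ q ∈ haarIdx π n, ∑ r ∈ haarIdx π n, p.len j ^ 2 * p.len l ^ 2 *
              ((haarFn π q (p.pt j) * haarFn π q (p.pt l)) *
                (haarFn π r (p.pt j) * haarFn π r (p.pt l))) := by
          intro j l
          rw [sq (∑ q ∈ haarIdx π n, _), Finset.sum_mul_sum, Finset.mul_sum]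
          exact Finset.sum_congr rfl fun q _ => by rw [Finset.mul_sum]
        simp only [e1, e2]
        rw [Finset.sum_congr rfl fun q _ => Finset.sum_comm, Finset.sum_comm]
        refine Finset.sum_congr rfl fun j _ => ?_
        rw [Finset.sum_congr rfl fun q _ => Finset.sum_comm, Finset.sum_comm]
    _ ≤ ∑ j ∈ Finset.range J, ∑ l ∈ Finset.range J,
          ((if j = l then 2 * p.len j ^ 2 else 0) + 2 * (p.len j ^ 2 * p.len l ^ 2)) := by
        refine Finset.sum_le_sum fun j hj => Finset.sum_le_sum fun l hl => ?_
        rw [ker j hj l hl]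
        by_cases hjl : j = l
        · subst hjl
          have hlen := p.len_pos (memJ j hj)
          rw [if_pos rfl, if_pos rfl]
          have e : p.len j ^ 2 * p.len j ^ 2 * (1 / p.len j - 1) ^ 2 =
              (p.len j - p.len j ^ 2) ^ 2 := by
            field_simp
          rw [e]
          nlinarith [sq_nonneg (p.len j + p.len j ^ 2)]
        · rw [if_neg hjl, if_neg hjl]
          nlinarith [mul_nonneg (sq_nonneg (p.len j)) (sq_nonneg (p.len l))]
    _ = 2 * (∑ j ∈ Finset.range J, p.len j ^ 2) + 2 * ((∑ j ∈ Finset.range J, p.len j ^ 2) *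
          ∑ j ∈ Finset.range J, p.len j ^ 2) := by
        rw [Finset.sum_mul_sum]
        simp only [Finset.sum_add_distrib, Finset.sum_ite_eq, Finset.mul_sum]
        congr 1
        exact Finset.sum_congr rfl fun j hj => if_pos hj
    _ ≤ 4 * p.mesh := by
        have := p.mesh_le_one
        have := p.mesh_pos
        nlinarith

section moments

variable {Ω : Type*} [MeasurableSpace Ω] {P : Measure Ω} [IsProbabilityMeasure P] {φ : ℝ → ℝ}
  {η : ℕ × ℕ × ℕ → Ω → ℝ} {M : ℝ}

theorem sum_schauderIncr_sq (θ : ℕ × ℕ × ℕ → ℝ) (n J : ℕ) :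
    ∑ j ∈ Finset.range J, schauderIncr π θ n j ^ 2 =
      ∑ q ∈ haarIdx π n, ∑ r ∈ haarIdx π n, (∑ j ∈ Finset.range J, (π n).len j ^ 2 *
        (haarFn π q ((π n).pt j) * haarFn π r ((π n).pt j))) * (θ q * θ r) := by
  have e : ∀ j, schauderIncr π θ n j ^ 2 = ∑ q ∈ haarIdx π n, ∑ r ∈ haarIdx π n,
      (π n).len j ^ 2 * (haarFn π q ((π n).pt j) * haarFn π r ((π n).pt j)) * (θ q * θ r) := by
    intro j
    rw [schauderIncr, sq, Finset.sum_mul_sum]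
    exact Finset.sum_congr rfl fun q _ => Finset.sum_congr rfl fun r _ => by ring
  simp only [e, Finset.sum_mul]
  rw [Finset.sum_comm]
  exact Finset.sum_congr rfl fun q _ => Finset.sum_comm

theorem meanQV_eq (n J : ℕ) : meanQV π φ n J =
    ∑ q ∈ haarIdx π n, (∑ j ∈ Finset.range J, (π n).len j ^ 2 *
      (haarFn π q ((π n).pt j) * haarFn π q ((π n).pt j))) * schauderWeight π φ q :=
  Finset.sum_congr rfl fun q _ => by simp only [sq, mul_comm]

theorem IsNested.integral_sq_qv_sub_mean_le (h : IsNested π) (h0 : (π 0).N = 1)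
    (H : HasFactorizingMoments P {q | IsHaarIndex π q} η (schauderWeight π φ) M) (n : ℕ) {J : ℕ}
    (hJ : J ≤ (π n).N) :
    MemLp (fun ω => ∑ j ∈ Finset.range J, schauderIncr π (fun q => η q ω) n j ^ 2 -
      meanQV π φ n J) 2 P ∧
    ∫ ω, (∑ j ∈ Finset.range J, schauderIncr π (fun q => η q ω) n j ^ 2 -
      meanQV π φ n J) ^ 2 ∂P ≤ 16 * M * (π n).mesh := by
  have hQ : ∀ q ∈ haarIdx π n, q ∈ {q | IsHaarIndex π q} := fun q hq => (mem_haarIdx.1 hq).2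
  simp only [sum_schauderIncr_sq, meanQV_eq]
  refine ⟨H.memLp_quadratic _ hQ _ _, ?_⟩
  refine (H.integral_sq_quadratic_le _ hQ _ fun q r => ?_).trans ?_
  · exact Finset.sum_congr rfl fun j _ => by ring
  · have := mul_le_mul_of_nonneg_left (h.sum_sq_kernel_le h0 n hJ) H.bound_nonneg
    linarith

/-- Serves the one interval cut by `t`, which the sum of squares up to the cell of `t` leaves out.
-/
theorem IsNested.integral_sq_incr_le (h : IsNested π) (h0 : (π 0).N = 1)
    (H : HasFactorizingMoments P {q | IsHaarIndex π q} η (schauderWeight π φ) M) (n : ℕ) {j : ℕ}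
    (hj : j < (π n).N) :
    MemLp (fun ω => schauderIncr π (fun q => η q ω) n j) 2 P ∧
    ∫ ω, schauderIncr π (fun q => η q ω) n j ^ 2 ∂P ≤ (1 + M) * (π n).mesh := by
  have hQ : ∀ q ∈ haarIdx π n, q ∈ {q | IsHaarIndex π q} := fun q hq => (mem_haarIdx.1 hq).2
  have hlen := (π n).len_pos hj
  constructor
  · exact memLp_finsetSum _ fun q hq =>
      ((H.memLp q (hQ q hq)).mono_exponent (by norm_num)).mul_const _
  simp only [schauderIncr]
  rw [H.integral_sq_linear _ hQ]
  calc ∑ q ∈ haarIdx π n, ((π n).len j * haarFn π q ((π n).pt j)) ^ 2 * schauderWeight π φ q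
      ≤ ∑ q ∈ haarIdx π n, ((π n).len j * haarFn π q ((π n).pt j)) ^ 2 * (1 + M) :=
        Finset.sum_le_sum fun q hq =>
          mul_le_mul_of_nonneg_left (H.weight_le (hQ q hq)) (sq_nonneg _)
    _ = (1 + M) * ((π n).len j ^ 2 * (1 / (π n).len j - 1)) := by
        rw [← h.sum_haarFn_sq h0 hj, Finset.mul_sum, Finset.mul_sum]
        exact Finset.sum_congr rfl fun q _ => by ring
    _ ≤ (1 + M) * (π n).mesh := by
        refine mul_le_mul_of_nonneg_left ?_ (by linarith [H.bound_nonneg])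
        have e : (π n).len j ^ 2 * (1 / (π n).len j - 1) = (π n).len j - (π n).len j ^ 2 := by
          field_simp
        rw [e]
        linarith [(π n).len_le_mesh hj, sq_nonneg ((π n).len j)]

end moments

theorem IsNested.schauderFn_eq (h : IsNested π) {q : ℕ × ℕ × ℕ} (hq : IsHaarIndex π q) {t : ℝ}
    (ht : 0 ≤ t) : schauderFn π q t =
      haarL (suppLeft π q) (suppMid π q) (suppRight π q) *
        (min t (suppMid π q) - min t (suppLeft π q)) -
      haarR (suppLeft π q) (suppMid π q) (suppRight π q) *
        (min t (suppRight π q) - min t (suppMid π q)) :=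
  integral_stepHaar (h.suppLeft_nonneg hq) (h.suppLeft_lt hq) (h.suppMid_lt hq) ht

theorem IsNested.schauderFn_of_le (h : IsNested π) {q : ℕ × ℕ × ℕ} (hq : IsHaarIndex π q) {t : ℝ}
    (ht : 0 ≤ t) (ht' : t ≤ suppLeft π q) : schauderFn π q t = 0 := by
  have h1 := h.suppLeft_lt hq
  have h2 := h.suppMid_lt hq
  rw [h.schauderFn_eq hq ht, min_eq_left ht', min_eq_left (ht'.trans h1.le),
    min_eq_left (ht'.trans (h1.trans h2).le)]
  ring

theorem IsNested.schauderFn_of_ge (h : IsNested π) {q : ℕ × ℕ × ℕ} (hq : IsHaarIndex π q) {t : ℝ}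
    (ht' : suppRight π q ≤ t) : schauderFn π q t = 0 := by
  have h1 := h.suppLeft_lt hq
  have h2 := h.suppMid_lt hq
  have ht : 0 ≤ t := ((h.suppLeft_nonneg hq).trans (h1.trans h2).le).trans ht'
  rw [h.schauderFn_eq hq ht, min_eq_right ht', min_eq_right (h2.le.trans ht'),
    min_eq_right ((h1.trans h2).le.trans ht'), haarL_mul_len h1 h2, sub_self]

/-- The support lies within one interval of `π q.1`, and every point of the coarser `π n` is a point
of `π q.1`, hence not interior to it. -/
theorem IsNested.schauderFn_pt_eq_zero (h : IsNested π) {q : ℕ × ℕ × ℕ} (hq : IsHaarIndex π q)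
    {n j : ℕ} (hn : n ≤ q.1) (hj : j ≤ (π n).N) : schauderFn π q ((π n).pt j) = 0 := by
  obtain ⟨k, hk, hk'⟩ := (π q.1).mem_points.1 (h n q.1 hn ((π n).mem_points.2 ⟨j, hj, rfl⟩))
  rw [← hk']
  rcases le_or_gt k q.2.1 with hle | hgt
  · refine h.schauderFn_of_le hq ((π q.1).pt_nonneg hk) ?_
    rw [h.suppLeft_eq hq]
    exact (π q.1).pt_le_pt hle hq.1.le
  · exact h.schauderFn_of_ge hq ((h.suppRight_le hq).trans ((π q.1).pt_le_pt hgt hk))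

/-- The nodes are points of `π n`, so each of them lies on one side of the whole `j`-th interval and
every minimum resolves uniformly there. -/
theorem IsNested.schauderFn_sub (h : IsNested π) {q : ℕ × ℕ × ℕ} (hq : IsHaarIndex π q)
    {n j : ℕ} (hn : q.1 < n) (hj : j < (π n).N) {t : ℝ} (h1 : (π n).pt j ≤ t)
    (h2 : t ≤ (π n).pt (j + 1)) :
    schauderFn π q t - schauderFn π q ((π n).pt j) =
      (t - (π n).pt j) * haarFn π q ((π n).pt j) := by
  obtain ⟨j₁, j₂, j₃, h12, h23, h3, e1, e2, e3⟩ := h.exists_nodes hq hn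
  have p0 := (π n).pt_nonneg hj.le
  rw [h.schauderFn_eq hq (p0.trans h1), h.schauderFn_eq hq p0, haarFn_eq_stepHaar, ← e1, ← e2, ← e3]
  have low : ∀ {i}, i ≤ (π n).N → i ≤ j → min t ((π n).pt i) = (π n).pt i ∧
      min ((π n).pt j) ((π n).pt i) = (π n).pt i := fun _ hi' => by
    have := (π n).pt_le_pt hi' hj.le
    exact ⟨min_eq_right (this.trans h1), min_eq_right this⟩
  have high : ∀ {i}, i ≤ (π n).N → j < i → min t ((π n).pt i) = t ∧
      min ((π n).pt j) ((π n).pt i) = (π n).pt j := fun hi hi' => by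
    have := (π n).pt_le_pt hi' hi
    exact ⟨min_eq_left (h2.trans this), min_eq_left (h1.trans (h2.trans this))⟩
  have l12 := (π n).pt_lt_pt h12 (by omega)
  have l23 := (π n).pt_lt_pt h23 h3
  by_cases c1 : j < j₁
  · rw [(high (by omega) c1).1, (high (by omega) c1).2,
      (high (i := j₂) (by omega) (by omega)).1, (high (i := j₂) (by omega) (by omega)).2,
      (high (i := j₃) (by omega) (by omega)).1, (high (i := j₃) (by omega) (by omega)).2,
      stepHaar_of_lt l12 ((π n).pt_lt_pt c1 (by omega))]
    ring
  rw [(low (i := j₁) (by omega) (by omega)).1, (low (i := j₁) (by omega) (by omega)).2]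
  by_cases c2 : j < j₂
  · rw [(high (by omega) c2).1, (high (by omega) c2).2,
      (high (i := j₃) (by omega) (by omega)).1, (high (i := j₃) (by omega) (by omega)).2,
      stepHaar_left ((π n).pt_le_pt (by omega) hj.le) ((π n).pt_lt_pt c2 (by omega))]
    ring
  rw [(low (i := j₂) (by omega) (by omega)).1, (low (i := j₂) (by omega) (by omega)).2]
  by_cases c3 : j < j₃
  · rw [(high (by omega) c3).1, (high (by omega) c3).2,
      stepHaar_right ((π n).pt_le_pt (by omega) hj.le) ((π n).pt_lt_pt c3 (by omega))]
    ring
  rw [(low (i := j₃) (by omega) (by omega)).1, (low (i := j₃) (by omega) (by omega)).2,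
    stepHaar_of_le l23 ((π n).pt_le_pt (by omega) hj.le)]
  ring

theorem schauderPartialSum_eq (a₀ a₁ : ℝ) (θ : ℕ × ℕ × ℕ → ℝ) (n : ℕ) (t : ℝ) :
    schauderPartialSum π a₀ a₁ θ n t =
      a₀ + (a₁ - a₀) * t + ∑ q ∈ haarIdx π n, θ q * schauderFn π q t := by
  rw [schauderPartialSum, sum_haarIdx]

theorem IsNested.schauderPartialSum_sub (h : IsNested π) (a₀ a₁ : ℝ) (θ : ℕ × ℕ × ℕ → ℝ)
    {n j : ℕ} (hj : j < (π n).N) {t : ℝ} (h1 : (π n).pt j ≤ t) (h2 : t ≤ (π n).pt (j + 1)) :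
    schauderPartialSum π a₀ a₁ θ n t - schauderPartialSum π a₀ a₁ θ n ((π n).pt j) =
      (t - (π n).pt j) / (π n).len j * (schauderIncr π θ n j + (a₁ - a₀) * (π n).len j) := by
  have hlen := (π n).len_pos hj
  rw [schauderPartialSum_eq, schauderPartialSum_eq]
  have e : ∑ q ∈ haarIdx π n, θ q * schauderFn π q t -
      ∑ q ∈ haarIdx π n, θ q * schauderFn π q ((π n).pt j) =
      (t - (π n).pt j) / (π n).len j * schauderIncr π θ n j := by
    rw [schauderIncr, ← Finset.sum_sub_distrib, Finset.mul_sum]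
    refine Finset.sum_congr rfl fun q hq => ?_
    rw [mem_haarIdx] at hq
    rw [← mul_sub, h.schauderFn_sub hq.2 hq.1 hj h1 h2]
    field_simp
  have e2 : (t - (π n).pt j) / (π n).len j * ((a₁ - a₀) * (π n).len j) =
      (a₁ - a₀) * (t - (π n).pt j) := by
    field_simp
  rw [mul_add, ← e, e2]
  ring

theorem IsNested.schauderPartialSum_pt (h : IsNested π) (a₀ a₁ : ℝ) (θ : ℕ × ℕ × ℕ → ℝ)
    {m n j : ℕ} (hmn : n ≤ m) (hj : j ≤ (π n).N) :
    schauderPartialSum π a₀ a₁ θ m ((π n).pt j) =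
      schauderPartialSum π a₀ a₁ θ n ((π n).pt j) := by
  rw [schauderPartialSum_eq, schauderPartialSum_eq]
  congr 1
  refine (Finset.sum_subset (haarIdx_mono hmn) fun q hq hq' => ?_).symm
  rw [mem_haarIdx] at hq hq'
  have : n ≤ q.1 := by
    by_contra hc
    exact hq' ⟨by omega, hq.2⟩
  rw [h.schauderFn_pt_eq_zero hq.2 this hj, mul_zero]

/-- The last term is the incomplete interval; at `t = 1` it is the full last interval, because `cell
1` is `N - 1`. -/
theorem qvAlong_eq (p : UnitPartition) (x : ℝ → ℝ) {t : ℝ} (ht : t ∈ Set.Icc (0 : ℝ) 1) :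
    qvAlong p x t = ∑ i ∈ Finset.range (p.cell t), (x (p.pt (i + 1)) - x (p.pt i)) ^ 2 +
      (x t - x (p.pt (p.cell t))) ^ 2 := by
  have hc := p.cell_lt t
  have h1 := p.pt_cell_le ht.1
  have h2 := p.le_pt_cell_succ ht.1 ht.2
  rw [qvAlong, ← Finset.sum_range_add_sum_Ico _ (Nat.succ_le_of_lt hc), Finset.sum_range_succ,
    Finset.sum_eq_zero (s := Finset.Ico _ _), add_zero]
  · congr 1
    · refine Finset.sum_congr rfl fun i hi => ?_
      rw [Finset.mem_range] at hi
      rw [min_eq_left ((p.pt_le_pt hi hc.le).trans h1),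
        min_eq_left ((p.pt_le_pt hi.le hc.le).trans h1)]
    · rw [min_eq_right h2, min_eq_left h1]
  · intro i hi
    rw [Finset.mem_Ico] at hi
    rw [min_eq_right (h2.trans (p.pt_le_pt hi.1 hi.2.le)),
      min_eq_right (h2.trans (p.pt_le_pt (by omega) hi.2)), sub_self]
    norm_num

/-- Adding a multiple of the length to the increments does not change the limit of the sums of
their squares. -/
theorem tendsto_sum_sq_add_len (hmesh : Tendsto (fun n => (π n).mesh) atTop (𝓝 0))
    {ι : Type*} {u : Filter ι} {ν : ι → ℕ} (hν : Tendsto ν u atTop) (D : ι → ℕ → ℝ) (J : ι → ℕ)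
    (hJ : ∀ i, J i ≤ (π (ν i)).N) (c : ℝ) {L : ℝ}
    (hD : Tendsto (fun i => ∑ j ∈ Finset.range (J i), D i j ^ 2) u (𝓝 L)) :
    Tendsto (fun i => ∑ j ∈ Finset.range (J i), (D i j + c * (π (ν i)).len j) ^ 2) u (𝓝 L) := by
  have hm : Tendsto (fun i => (π (ν i)).mesh) u (𝓝 0) := hmesh.comp hν
  have S : ∀ i, ∑ j ∈ Finset.range (J i), (π (ν i)).len j ^ 2 ≤ (π (ν i)).mesh := fun i =>
    (Finset.sum_le_sum_of_subset_of_nonneg (Finset.range_subset_range.2 (hJ i))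
      fun j _ _ => sq_nonneg _).trans (π (ν i)).sum_len_sq_le
  have sq_lim : Tendsto (fun i => ∑ j ∈ Finset.range (J i), (π (ν i)).len j ^ 2) u (𝓝 0) :=
    squeeze_zero (fun i => Finset.sum_nonneg fun j _ => sq_nonneg _) S hm
  have cross : Tendsto (fun i => ∑ j ∈ Finset.range (J i), D i j * (π (ν i)).len j) u (𝓝 0) := by
    have b : Tendsto (fun i => √((∑ j ∈ Finset.range (J i), D i j ^ 2) *
        ∑ j ∈ Finset.range (J i), (π (ν i)).len j ^ 2)) u (𝓝 0) := by
      have := (hD.mul sq_lim).sqrt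
      rwa [mul_zero, Real.sqrt_zero] at this
    refine squeeze_zero_norm (fun i => ?_) b
    exact Real.abs_le_sqrt (Finset.sum_mul_sq_le_sq_mul_sq _ _ _)
  have e : ∀ i, ∑ j ∈ Finset.range (J i), (D i j + c * (π (ν i)).len j) ^ 2 =
      ∑ j ∈ Finset.range (J i), D i j ^ 2 +
        2 * c * ∑ j ∈ Finset.range (J i), D i j * (π (ν i)).len j +
        c ^ 2 * ∑ j ∈ Finset.range (J i), (π (ν i)).len j ^ 2 := by
    intro i
    rw [Finset.mul_sum, Finset.mul_sum, ← Finset.sum_add_distrib, ← Finset.sum_add_distrib]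
    exact Finset.sum_congr rfl fun j _ => by ring
  simp only [e]
  have := (hD.add (cross.const_mul (2 * c))).add (sq_lim.const_mul (c ^ 2))
  rwa [mul_zero, mul_zero, add_zero, add_zero] at this

/-- A function that agrees with the sum of the Schauder series has the increments of the partial
sums. -/
theorem IsNested.increment_eq (h : IsNested π) {x : ℝ → ℝ} {θ : ℕ × ℕ × ℕ → ℝ}
    (hx : ∀ t ∈ Set.Icc (0 : ℝ) 1, ∀ l : ℝ,
      Tendsto (fun n => schauderPartialSum π (x 0) (x 1) θ n t) atTop (𝓝 l) → x t = l)
    (n : ℕ) :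
    (∀ j ≤ (π n).N, x ((π n).pt j) = schauderPartialSum π (x 0) (x 1) θ n ((π n).pt j)) ∧
    ∀ j < (π n).N, x ((π n).pt (j + 1)) - x ((π n).pt j) =
      schauderIncr π θ n j + (x 1 - x 0) * (π n).len j := by
  have key : ∀ j ≤ (π n).N,
      x ((π n).pt j) = schauderPartialSum π (x 0) (x 1) θ n ((π n).pt j) := by
    intro j hj
    refine hx _ ((π n).pt_mem hj) _ ?_
    -- At a partition point the partial sums are eventually constant, so the series converges there
    -- whatever the coefficients are.
    refine tendsto_const_nhds.congr' ?_
    filter_upwards [eventually_ge_atTop n] with m hm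
    exact (h.schauderPartialSum_pt _ _ _ hm hj).symm
  refine ⟨key, fun j hj => ?_⟩
  rw [key _ hj, key _ hj.le, h.schauderPartialSum_sub _ _ _ hj ((π n).pt_lt j hj).le le_rfl]
  have hlen := (π n).len_pos hj
  rw [show (π n).pt (j + 1) - (π n).pt j = (π n).len j from rfl, div_self hlen.ne', one_mul]

end path

/-! ### Almost sure convergence from summable moments. -/

/-- By Tonelli the sum has finite expectation, so it is finite almost surely. -/
theorem ae_summable_of_integral_le {Ω : Type*} [MeasurableSpace Ω] {P : Measure Ω}
    {f : ℕ → Ω → ℝ} (hf : ∀ k, Integrable (f k) P) (h0 : ∀ k ω, 0 ≤ f k ω) {b : ℕ → ℝ}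
    (hb : Summable b) (hfb : ∀ k, ∫ ω, f k ω ∂P ≤ b k) :
    ∀ᵐ ω ∂P, Summable fun k => f k ω := by
  have hm : ∀ k, AEMeasurable (fun ω => ENNReal.ofReal (f k ω)) P := fun k =>
    (hf k).1.aemeasurable.ennreal_ofReal
  have h1 : ∫⁻ ω, ∑' k, ENNReal.ofReal (f k ω) ∂P ≠ ⊤ := by
    rw [lintegral_tsum hm]
    have e : ∀ k, ∫⁻ ω, ENNReal.ofReal (f k ω) ∂P = ENNReal.ofReal (∫ ω, f k ω ∂P) := fun k =>
      (ofReal_integral_eq_lintegral_ofReal (hf k) (ae_of_all _ (h0 k))).symm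
    simp only [e]
    have i0 : ∀ k, 0 ≤ ∫ ω, f k ω ∂P := fun k => integral_nonneg (h0 k)
    have hs : Summable fun k => ∫ ω, f k ω ∂P := Summable.of_nonneg_of_le i0 hfb hb
    rw [← ENNReal.ofReal_tsum_of_nonneg i0 hs]
    exact ENNReal.ofReal_ne_top
  filter_upwards [ae_lt_top' (AEMeasurable.tsum hm) h1] with ω hω
  have := ENNReal.summable_toReal hω.ne
  simpa only [ENNReal.toReal_ofReal (h0 _ ω)] using this

theorem ae_tendsto_zero_of_integral_sq_le {Ω : Type*} [MeasurableSpace Ω] {P : Measure Ω}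
    {f : ℕ → Ω → ℝ} (hf : ∀ k, MemLp (f k) 2 P) {b : ℕ → ℝ} (hb : Summable b)
    (hfb : ∀ k, ∫ ω, f k ω ^ 2 ∂P ≤ b k) : ∀ᵐ ω ∂P, Tendsto (fun k => f k ω) atTop (𝓝 0) := by
  filter_upwards [ae_summable_of_integral_le (fun k => (hf k).integrable_sq)
    (fun k ω => sq_nonneg _) hb hfb] with ω hω
  have h1 := hω.tendsto_atTop_zero.sqrt
  simp only [Real.sqrt_sq_eq_abs, Real.sqrt_zero] at h1
  exact (tendsto_zero_iff_abs_tendsto_zero _).2 h1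

/-! ### Convergence in probability at a fixed time. -/

section probability

variable {π : ℕ → UnitPartition} {φ : ℝ → ℝ}

/-- Convergence of the quadratic variation of a path along its Schauder increments. -/
theorem IsNested.tendsto_qvAlong (h : IsNested π)
    (hmesh : Tendsto (fun n => (π n).mesh) atTop (𝓝 0)) {x : ℝ → ℝ} {θ : ℕ × ℕ × ℕ → ℝ}
    (hx : ∀ t ∈ Set.Icc (0 : ℝ) 1, ∀ l : ℝ,
      Tendsto (fun n => schauderPartialSum π (x 0) (x 1) θ n t) atTop (𝓝 l) → x t = l)
    {t : ℝ} (ht : t ∈ Set.Icc (0 : ℝ) 1) {ν : ℕ → ℕ} (hν : Tendsto ν atTop atTop) {L : ℝ}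
    (hD : Tendsto (fun k => ∑ j ∈ Finset.range ((π (ν k)).cell t), schauderIncr π θ (ν k) j ^ 2)
      atTop (𝓝 L))
    (hr : Tendsto (fun k => x t - x ((π (ν k)).pt ((π (ν k)).cell t))) atTop (𝓝 0)) :
    Tendsto (fun k => qvAlong (π (ν k)) x t) atTop (𝓝 L) := by
  simp only [qvAlong_eq _ x ht]
  have h1 := tendsto_sum_sq_add_len hmesh hν (fun k j => schauderIncr π θ (ν k) j)
    (fun k => (π (ν k)).cell t) (fun k => ((π (ν k)).cell_lt t).le) (x 1 - x 0) hD
  have h2 := h1.add (hr.pow 2)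
  rw [zero_pow two_ne_zero, add_zero] at h2
  refine h2.congr fun k => ?_
  congr 1
  refine Finset.sum_congr rfl fun j hj => ?_
  rw [(h.increment_eq hx (ν k)).2 j ((Finset.mem_range.1 hj).trans ((π (ν k)).cell_lt t))]

theorem tendsto_pt_cell (hmesh : Tendsto (fun n => (π n).mesh) atTop (𝓝 0)) {t : ℝ}
    (ht : t ∈ Set.Icc (0 : ℝ) 1) :
    Tendsto (fun n => (π n).pt ((π n).cell t)) atTop (𝓝 t) ∧
    ∀ n, |t - (π n).pt ((π n).cell t)| ≤ (π n).mesh := by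
  have key : ∀ n, |t - (π n).pt ((π n).cell t)| ≤ (π n).mesh := by
    intro n
    have h1 := (π n).pt_cell_le ht.1
    have h2 := (π n).le_pt_cell_succ ht.1 ht.2
    have h3 := (π n).len_le_mesh ((π n).cell_lt t)
    rw [abs_of_nonneg (sub_nonneg.2 h1)]
    rw [UnitPartition.len] at h3
    linarith
  refine ⟨?_, key⟩
  rw [tendsto_iff_norm_sub_tendsto_zero]
  refine squeeze_zero (fun _ => norm_nonneg _) (fun n => ?_) hmesh
  rw [Real.norm_eq_abs, abs_sub_comm]
  exact key n

theorem tendsto_comp_pt_cell (hmesh : Tendsto (fun n => (π n).mesh) atTop (𝓝 0)) {f : ℝ → ℝ}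
    (hf : ContinuousOn f (Set.Icc 0 1)) {t : ℝ} (ht : t ∈ Set.Icc (0 : ℝ) 1) :
    Tendsto (fun n => f ((π n).pt ((π n).cell t))) atTop (𝓝 (f t)) :=
  (hf t ht).tendsto.comp (tendsto_nhdsWithin_iff.2 ⟨(tendsto_pt_cell hmesh ht).1,
    Eventually.of_forall fun n => (π n).pt_mem ((π n).cell_lt t).le⟩)

variable {Ω : Type*} [MeasurableSpace Ω] {P : Measure Ω}
  {η : ℕ × ℕ × ℕ → Ω → ℝ} {M : ℝ}

theorem IsNested.tendsto_meanQV [IsProbabilityMeasure P] (h : IsNested π) (h0 : (π 0).N = 1)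
    (hmesh : Tendsto (fun n => (π n).mesh) atTop (𝓝 0)) (hφ0 : φ 0 = 0)
    (hφ : MonotoneOn φ (Set.Icc 0 1)) (hc : ContinuousOn φ (Set.Icc 0 1))
    (H : HasFactorizingMoments P {q | IsHaarIndex π q} η (schauderWeight π φ) M) {t : ℝ}
    (ht : t ∈ Set.Icc (0 : ℝ) 1) :
    Tendsto (fun n => meanQV π φ n ((π n).cell t)) atTop (𝓝 (φ t)) := by
  have hM := H.bound_nonneg
  have lim : Tendsto (fun n => meanQV π φ n ((π n).cell t) - φ ((π n).pt ((π n).cell t)))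
      atTop (𝓝 0) := by
    rw [Metric.tendsto_atTop]
    intro ε hε
    -- The slope bound is twice the bound `1 + M` on the weights.
    obtain ⟨n₀, hn₀⟩ := h.exists_meanQV_close h0 hmesh hφ0 hφ (Λ := 2 * (1 + M))
      (fun n j hj => slope_le_of_weight_le h hmesh hφ hc (by linarith)
        (fun q hq => H.weight_le hq) n hj) (half_pos hε)
    refine ⟨n₀, fun n hn => ?_⟩
    rw [Real.dist_eq, sub_zero]
    linarith [hn₀ n hn _ ((π n).cell_lt t).le]
  have := lim.add (tendsto_comp_pt_cell hmesh hc ht)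
  simpa only [sub_add_cancel, zero_add] using this

theorem aemeasurable_schauderPartialSum
    (H : HasFactorizingMoments P {q | IsHaarIndex π q} η (schauderWeight π φ) M)
    {x₀ x₁ : Ω → ℝ} (hx0 : AEMeasurable x₀ P) (hx1 : AEMeasurable x₁ P) (n : ℕ) (t : ℝ) :
    AEMeasurable (fun ω => schauderPartialSum π (x₀ ω) (x₁ ω) (fun q => η q ω) n t) P := by
  simp only [schauderPartialSum_eq]
  refine (hx0.add ((hx1.sub hx0).mul_const t)).add
    (Finset.aemeasurable_fun_sum _ fun q hq => ?_)
  exact (H.memLp q (mem_haarIdx.1 hq).2).1.aemeasurable.mul_const _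

/-- Convergence in probability of the quadratic variation at a time at which the Schauder series
converges almost surely. -/
theorem IsNested.tendsto_measure_qvAlong [IsProbabilityMeasure P] (h : IsNested π) (h0 : (π 0).N = 1)
    (hmesh : Tendsto (fun n => (π n).mesh) atTop (𝓝 0)) (hφ0 : φ 0 = 0)
    (hφ : MonotoneOn φ (Set.Icc 0 1)) (hc : ContinuousOn φ (Set.Icc 0 1))
    (H : HasFactorizingMoments P {q | IsHaarIndex π q} η (schauderWeight π φ) M)
    {x : ℝ → Ω → ℝ} (hx0 : AEMeasurable (x 0) P) (hx1 : AEMeasurable (x 1) P)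
    (hx : ∀ᵐ ω ∂P, ∀ t ∈ Set.Icc (0 : ℝ) 1, ∀ l : ℝ,
      Tendsto (fun n => schauderPartialSum π (x 0 ω) (x 1 ω) (fun q => η q ω) n t)
        atTop (𝓝 l) → x t ω = l)
    {t : ℝ} (ht : t ∈ Set.Icc (0 : ℝ) 1)
    (hconv : ∀ᵐ ω ∂P, ∃ l : ℝ,
      Tendsto (fun n => schauderPartialSum π (x 0 ω) (x 1 ω) (fun q => η q ω) n t)
        atTop (𝓝 l)) {ε : ℝ} (hε : 0 < ε) :
    Tendsto (fun n => P {ω | ε < |qvAlong (π n) (fun s => x s ω) t - φ t|}) atTop (𝓝 0) := by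
  have meas_t : AEMeasurable (x t) P := by
    refine aemeasurable_of_tendsto_metrizable_ae atTop
      (fun n => aemeasurable_schauderPartialSum H hx0 hx1 n t) ?_
    filter_upwards [hx, hconv] with ω h1 ⟨l, hl⟩
    rwa [h1 t ht l hl]
  have meas_pt : ∀ n, ∀ j ≤ (π n).N, AEMeasurable (x ((π n).pt j)) P := by
    intro n j hj
    refine (aemeasurable_schauderPartialSum H hx0 hx1 n ((π n).pt j)).congr ?_
    filter_upwards [hx] with ω h1
    exact ((h.increment_eq (x := fun s => x s ω) h1 n).1 j hj).symm
  have meas_min : ∀ n, ∀ j ≤ (π n).N, AEMeasurable (x (min ((π n).pt j) t)) P := by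
    intro n j hj
    rcases min_choice ((π n).pt j) t with hm | hm <;> rw [hm]
    · exact meas_pt n j hj
    · exact meas_t
  have meas_qv : ∀ n, AEMeasurable (fun ω => qvAlong (π n) (fun s => x s ω) t) P := by
    intro n
    simp only [qvAlong]
    exact Finset.aemeasurable_fun_sum _ fun i hi =>
      ((meas_min n (i + 1) (Finset.mem_range.1 hi)).sub
        (meas_min n i (Finset.mem_range.1 hi).le)).pow_const 2
  -- Nothing is known here about the speed of the mesh. Along a further subsequence with mesh at
  -- most 2^{-k} the second moments are summable, which gives almost sure convergence there.
  refine tendsto_of_subseq_tendsto fun ν hν => ?_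
  obtain ⟨ms, hms, hms'⟩ := extraction_forall_of_eventually' (P := fun k n =>
    (π (ν n)).mesh ≤ (1 / 2 : ℝ) ^ k) (fun k => by
      have := (hmesh.comp hν).eventually (gt_mem_nhds (show (0 : ℝ) < (1 / 2 : ℝ) ^ k by positivity))
      obtain ⟨N, hN⟩ := eventually_atTop.1 this
      exact ⟨N, fun n hn => (hN n hn).le⟩)
  have hν' : Tendsto (fun k => ν (ms k)) atTop atTop := hν.comp hms.tendsto_atTop
  refine ⟨ms, ?_⟩
  have sumb : Summable fun k : ℕ => (1 / 2 : ℝ) ^ k := summable_geometric_two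
  have a1 : ∀ᵐ ω ∂P, Tendsto (fun k => ∑ j ∈ Finset.range ((π (ν (ms k))).cell t),
      schauderIncr π (fun q => η q ω) (ν (ms k)) j ^ 2 -
      meanQV π φ (ν (ms k)) ((π (ν (ms k))).cell t)) atTop (𝓝 0) := by
    refine ae_tendsto_zero_of_integral_sq_le
      (fun k => (h.integral_sq_qv_sub_mean_le h0 H (ν (ms k)) ((π _).cell_lt t).le).1)
      (sumb.mul_left (16 * M)) fun k => ?_
    refine (h.integral_sq_qv_sub_mean_le h0 H (ν (ms k)) ((π _).cell_lt t).le).2.trans ?_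
    exact mul_le_mul_of_nonneg_left (hms' k) (by linarith [H.bound_nonneg])
  have a2 : ∀ᵐ ω ∂P, Tendsto (fun k =>
      schauderIncr π (fun q => η q ω) (ν (ms k)) ((π (ν (ms k))).cell t)) atTop (𝓝 0) := by
    refine ae_tendsto_zero_of_integral_sq_le
      (fun k => (h.integral_sq_incr_le h0 H (ν (ms k)) ((π _).cell_lt t)).1)
      (sumb.mul_left (1 + M)) fun k => ?_
    refine (h.integral_sq_incr_le h0 H (ν (ms k)) ((π _).cell_lt t)).2.trans ?_
    exact mul_le_mul_of_nonneg_left (hms' k) (by linarith [H.bound_nonneg])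
  have ae_lim : ∀ᵐ ω ∂P, Tendsto (fun k => qvAlong (π (ν (ms k))) (fun s => x s ω) t) atTop
      (𝓝 (φ t)) := by
    filter_upwards [hx, hconv, a1, a2] with ω hω ⟨l, hl⟩ b1 b2
    refine h.tendsto_qvAlong hmesh (x := fun s => x s ω) hω ht hν' ?_ ?_
    · have := b1.add ((h.tendsto_meanQV h0 hmesh hφ0 hφ hc H ht).comp hν')
      simpa only [Function.comp_def, sub_add_cancel, zero_add] using this
    · have hxl := hω t ht l hl
      -- The incomplete increment splits into the tail of the series at `t` and an increment of a
      -- partial sum. The latter is affine on the interval, hence a fraction at most 1 of the full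
      -- increment, which `a2` controls.
      have c1 : Tendsto (fun k => x t ω - schauderPartialSum π (x 0 ω) (x 1 ω)
          (fun q => η q ω) (ν (ms k)) t) atTop (𝓝 0) := by
        have := (hl.comp hν').const_sub (x t ω)
        rw [hxl, sub_self] at this
        rw [hxl]
        exact this
      have c2 : Tendsto (fun k => |schauderIncr π (fun q => η q ω) (ν (ms k))
          ((π (ν (ms k))).cell t)| + |x 1 ω - x 0 ω| * (π (ν (ms k))).mesh) atTop (𝓝 0) := by
        have := b2.abs.add ((hmesh.comp hν').const_mul |x 1 ω - x 0 ω|)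
        rwa [abs_zero, mul_zero, add_zero] at this
      have c3 : Tendsto (fun k => schauderPartialSum π (x 0 ω) (x 1 ω)
          (fun q => η q ω) (ν (ms k)) t - schauderPartialSum π (x 0 ω) (x 1 ω)
          (fun q => η q ω) (ν (ms k)) ((π (ν (ms k))).pt ((π (ν (ms k))).cell t)))
          atTop (𝓝 0) := by
        refine squeeze_zero_norm (fun k => ?_) c2
        set p := π (ν (ms k))
        have d1 := p.pt_cell_le ht.1
        have d2 := p.le_pt_cell_succ ht.1 ht.2
        have d3 := p.len_pos (p.cell_lt t)
        rw [h.schauderPartialSum_sub _ _ _ (p.cell_lt t) d1 d2, Real.norm_eq_abs, abs_mul]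
        have d4 : |(t - p.pt (p.cell t)) / p.len (p.cell t)| ≤ 1 := by
          rw [abs_of_nonneg (div_nonneg (sub_nonneg.2 d1) d3.le), div_le_one d3,
            UnitPartition.len]
          linarith
        refine (mul_le_of_le_one_left (abs_nonneg _) d4).trans ((abs_add_le _ _).trans ?_)
        rw [abs_mul, abs_of_pos d3]
        gcongr
        exact p.len_le_mesh (p.cell_lt t)
      have := c1.add c3
      rw [add_zero] at this
      refine this.congr fun k => ?_
      rw [sub_add_sub_cancel]
      congr 1
      exact ((h.increment_eq (x := fun s => x s ω) hω (ν (ms k))).1 _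
        ((π (ν (ms k))).cell_lt t).le).symm
  have inM := tendstoInMeasure_of_tendsto_ae
    (fun k => (meas_qv (ν (ms k))).aestronglyMeasurable) ae_lim
  rw [tendstoInMeasure_iff_norm] at inM
  refine tendsto_of_tendsto_of_tendsto_of_le_of_le tendsto_const_nhds (inM ε hε)
    (fun _ => zero_le) fun k => measure_mono fun ω hω => ?_
  exact le_of_lt (show ε < |qvAlong (π (ν (ms k))) (fun s => x s ω) t - φ t| from hω)

end probability

/-! ### Uniform convergence of the Schauder series. -/

section levels

variable {π : ℕ → UnitPartition}

/-- With half-lengths x and y the squared peak is xy/(x + y) ≤ y, and y is the length of one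
interval of the next partition. The size of the left half plays no role. -/
theorem IsNested.abs_schauderFn_le (h : IsNested π) {q : ℕ × ℕ × ℕ} (hq : IsHaarIndex π q)
    {t : ℝ} (ht : 0 ≤ t) : |schauderFn π q t| ≤ √(π (q.1 + 1)).mesh := by
  have h1 := h.suppLeft_lt hq
  have h2 := h.suppMid_lt hq
  have a := sub_pos.2 h1
  have b := sub_pos.2 h2
  have c := sub_pos.2 (h1.trans h2)
  have hab := haarL_mul_len h1 h2
  have hL := haarL_nonneg (t₁ := suppLeft π q) (t₂ := suppMid π q) (t₃ := suppRight π q)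
  have hR := haarR_nonneg (t₁ := suppLeft π q) (t₂ := suppMid π q) (t₃ := suppRight π q)
  have diff : ∀ {u v : ℝ}, u < v → 0 ≤ min t v - min t u ∧ min t v - min t u ≤ v - u := by
    intro u v huv
    rcases le_total t u with c1 | c1
    · rw [min_eq_left c1, min_eq_left (c1.trans huv.le)]
      constructor <;> linarith
    · rw [min_eq_right c1]
      constructor
      · exact sub_nonneg.2 (le_min c1 huv.le)
      · linarith [min_le_right t v]
  have d1 := diff h1
  have d2 := diff h2
  have top : haarL (suppLeft π q) (suppMid π q) (suppRight π q) *
      (suppMid π q - suppLeft π q) ≤ √(π (q.1 + 1)).mesh := by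
    refine Real.le_sqrt_of_sq_le (le_trans ?_ (h.suppRight_sub_le hq))
    rw [mul_pow, haarL_sq h1 h2, div_mul_eq_mul_div, div_le_iff₀ (by positivity)]
    nlinarith [mul_pos (mul_pos a b) b]
  rw [h.schauderFn_eq hq ht]
  have e1 := mul_le_mul_of_nonneg_left d1.2 hL
  have e2 := mul_le_mul_of_nonneg_left d2.2 hR
  have e3 := mul_nonneg hL d1.1
  have e4 := mul_nonneg hR d2.1
  rw [abs_le]
  constructor <;> linarith

theorem IsNested.schauderFn_eq_zero_of_ne_cell (h : IsNested π) {q : ℕ × ℕ × ℕ}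
    (hq : IsHaarIndex π q) {t : ℝ} (ht : t ∈ Set.Icc (0 : ℝ) 1) (hne : q.2.1 ≠ (π q.1).cell t) :
    schauderFn π q t = 0 := by
  have hc := (π q.1).cell_lt t
  rcases lt_or_gt_of_ne hne with hlt | hgt
  · exact h.schauderFn_of_ge hq ((h.suppRight_le hq).trans
      (((π q.1).pt_le_pt hlt hc.le).trans ((π q.1).pt_cell_le ht.1)))
  · refine h.schauderFn_of_le hq ht.1 (((π q.1).le_pt_cell_succ ht.1 ht.2).trans ?_)
    rw [h.suppLeft_eq hq]
    exact (π q.1).pt_le_pt hgt hq.1.le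

theorem IsFinitelyRefining.exists_card_branchRange_le (hπ : IsFinitelyRefining π) :
    ∃ R : ℕ, ∀ m, ∀ k < (π m).N, (branchRange π m k).card ≤ R := by
  have h : IsNested π := hπ.1
  obtain ⟨M, hM⟩ := hπ.2.2
  -- The uniform bound on new points covers levels `m ≥ 1`; level 0 has at most `(π 1).N` branches.
  refine ⟨M + (π 1).N, fun m k hk => ?_⟩
  have hlt := h.refIndex_lt hk
  obtain ⟨b1, e1⟩ := h.refIndex_spec (m := m) (k := k) hk.le
  obtain ⟨b2, e2⟩ := h.refIndex_spec (m := m) (k := k + 1) hk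
  have hcard : (branchRange π m k).card ≤ refIndex π m (k + 1) - refIndex π m k - 1 := by
    rw [branchRange, Nat.card_Icc]
    omega
  rcases Nat.eq_zero_or_pos m with rfl | hm
  · simp only [zero_add] at b2
    omega
  · have := hM m hm k hk
    have inj : (Finset.Ioo (refIndex π m k) (refIndex π m (k + 1))).card ≤
        ((π (m + 1)).points.filter
          (fun u => (π m).pt k < u ∧ u < (π m).pt (k + 1))).card := by
      refine Finset.card_le_card_of_injOn (fun j => (π (m + 1)).pt j) ?_ ?_
      · intro j hj
        have hj' := Finset.mem_Ioo.1 (Finset.mem_coe.1 hj)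
        refine Finset.mem_coe.2 (Finset.mem_filter.2
          ⟨(π (m + 1)).mem_points.2 ⟨j, by omega, rfl⟩, ?_, ?_⟩)
        · rw [← e1]
          exact (π (m + 1)).pt_lt_pt hj'.1 (by omega)
        · rw [← e2]
          exact (π (m + 1)).pt_lt_pt hj'.2 b2
      · intro i hi j hj hij
        have hi' := Finset.mem_Ioo.1 (Finset.mem_coe.1 hi)
        have hj' := Finset.mem_Ioo.1 (Finset.mem_coe.1 hj)
        exact (π (m + 1)).pt_injOn (by omega) (by omega) hij
    rw [Nat.card_Ioo] at inj
    omega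

theorem IsNested.card_haarPairs_le (h : IsNested π) (m : ℕ) :
    ((haarPairs π m).card : ℝ) ≤ (π (m + 1)).N := by
  have e := sum_haarPairs (π := π) m (fun _ => (1 : ℝ))
  simp only [Finset.sum_const, nsmul_eq_mul, mul_one] at e
  have e2 : ∑ k ∈ Finset.range (π m).N, ((refIndex π m (k + 1) : ℝ) - refIndex π m k) =
      (π (m + 1)).N := by
    rw [Finset.sum_range_sub (fun k => (refIndex π m k : ℝ))]
    have z1 : refIndex π m 0 = 0 := UnitPartition.subIndex_zero
    have z2 : refIndex π m (π m).N = (π (m + 1)).N := UnitPartition.subIndex_last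
    rw [z1, z2, Nat.cast_zero, sub_zero]
  rw [e, ← e2]
  refine Finset.sum_le_sum fun k hk => ?_
  have hlt := h.refIndex_lt (Finset.mem_range.1 hk)
  rw [← Nat.cast_sub hlt.le]
  refine Nat.cast_le.2 ?_
  rw [branchRange, Nat.card_Icc]
  omega

theorem IsBalanced.exists_N_mul_mesh_le (hb : IsBalanced π) :
    ∃ c : ℝ, 0 ≤ c ∧ ∀ n, ((π (n + 1)).N : ℝ) * (π (n + 1)).mesh ≤ c := by
  obtain ⟨c, hc, H⟩ := hb
  refine ⟨c, hc.le, fun n => ?_⟩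
  have h1 := H (n + 1) (by omega)
  have h2 := (π (n + 1)).minMesh_pos
  rw [div_le_iff₀ h2] at h1
  have h3 := (π (n + 1)).N_mul_minMesh_le
  calc ((π (n + 1)).N : ℝ) * (π (n + 1)).mesh ≤ (π (n + 1)).N * (c * (π (n + 1)).minMesh) := by
        gcongr
    _ = c * ((π (n + 1)).N * (π (n + 1)).minMesh) := by ring
    _ ≤ c * 1 := by gcongr
    _ = c := mul_one c

theorem IsCompleteRefining.exists_mesh_le_pow (hc : IsCompleteRefining π) :
    ∃ ρ : ℝ, 0 ≤ ρ ∧ ρ < 1 ∧ ∀ n, (π (n + 1)).mesh ≤ ρ ^ n := by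
  obtain ⟨ε, M, hε, -, H⟩ := hc
  refine ⟨1 / (1 + ε), by positivity, by rw [div_lt_one (by positivity)]; linarith, fun n => ?_⟩
  induction n with
  | zero => simpa using (π 1).mesh_le_one
  | succ n ih =>
    have h1 := (H (n + 1) (by omega)).1
    have h2 := (π (n + 1 + 1)).mesh_pos
    rw [le_div_iff₀ h2] at h1
    rw [pow_succ, mul_one_div, le_div_iff₀ (by positivity), mul_comm]
    exact h1.trans ih

theorem IsCompleteRefining.summable (hc : IsCompleteRefining π) :
    (Summable fun n => (π n).mesh) ∧ Summable fun n => √√(π (n + 1)).mesh := by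
  obtain ⟨ρ, h0, h1, H⟩ := hc.exists_mesh_le_pow
  constructor
  · rw [← summable_nat_add_iff 1]
    exact Summable.of_nonneg_of_le (fun n => (π (n + 1)).mesh_pos.le) H
      (summable_geometric_of_lt_one h0 h1)
  · refine Summable.of_nonneg_of_le (fun n => Real.sqrt_nonneg _) (fun n => ?_)
      (summable_geometric_of_lt_one (Real.sqrt_nonneg (√ρ)) ?_)
    · refine Real.sqrt_le_sqrt (Real.sqrt_le_sqrt (H n)) |>.trans_eq ?_
      rw [Real.sqrt_eq_iff_mul_self_eq (Real.sqrt_nonneg _) (by positivity), ← mul_pow,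
        Real.mul_self_sqrt (Real.sqrt_nonneg _), Real.sqrt_eq_iff_mul_self_eq (by positivity) (by positivity), ← mul_pow,
        Real.mul_self_sqrt h0]
    · rw [Real.sqrt_lt' one_pos, one_pow, Real.sqrt_lt' one_pos, one_pow]
      exact h1

/-- The contribution of one level to the Schauder series is uniformly small. -/
theorem IsNested.abs_sum_level_le (h : IsNested π) {R : ℕ} {m : ℕ}
    (hR : ∀ k < (π m).N, (branchRange π m k).card ≤ R) (θ : ℕ × ℕ × ℕ → ℝ) {t : ℝ}
    (ht : t ∈ Set.Icc (0 : ℝ) 1) :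
    |∑ p ∈ haarPairs π m, θ (m, p) * schauderFn π (m, p) t| ≤
      R * √√(π (m + 1)).mesh *
        (1 + (π (m + 1)).mesh * ∑ p ∈ haarPairs π m, θ (m, p) ^ 4) := by
  set s := √√(π (m + 1)).mesh with hs
  have hmesh := (π (m + 1)).mesh_pos
  have s0 : 0 ≤ s := Real.sqrt_nonneg _
  have s2 : s ^ 2 = √(π (m + 1)).mesh := Real.sq_sqrt (Real.sqrt_nonneg _)
  have s4 : s ^ 4 = (π (m + 1)).mesh := by
    rw [show 4 = 2 * 2 by rfl, pow_mul, s2, Real.sq_sqrt hmesh.le]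
  have term : ∀ p ∈ haarPairs π m, |θ (m, p) * schauderFn π (m, p) t| ≤
      s * (1 + (π (m + 1)).mesh * ∑ p ∈ haarPairs π m, θ (m, p) ^ 4) := by
    intro p hp
    have hq : IsHaarIndex π (m, p) := isHaarIndex_of_mem_pairs hp
    have b1 := h.abs_schauderFn_le hq ht.1
    have b2 : θ (m, p) ^ 4 ≤ ∑ p ∈ haarPairs π m, θ (m, p) ^ 4 :=
      Finset.single_le_sum (f := fun p => θ (m, p) ^ 4) (fun p _ => by positivity) hp
    rw [abs_mul]
    calc |θ (m, p)| * |schauderFn π (m, p) t| ≤ |θ (m, p)| * s ^ 2 := by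
          rw [s2]
          exact mul_le_mul_of_nonneg_left b1 (abs_nonneg _)
      _ = s * (s * |θ (m, p)|) := by ring
      -- From u ≤ 1 + u⁴, with `s` the fourth root of the mesh. Fourth powers may be summed over the
      -- whole level, since only their expectations matter, and one factor `s` is kept for
      -- summability over levels.
      _ ≤ s * (1 + (s * |θ (m, p)|) ^ 4) := by
          refine mul_le_mul_of_nonneg_left ?_ s0
          nlinarith [sq_nonneg ((s * |θ (m, p)|) ^ 2 - 1), sq_nonneg (s * |θ (m, p)| - 1),
            sq_nonneg ((s * |θ (m, p)|) ^ 2)]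
      _ = s * (1 + (π (m + 1)).mesh * θ (m, p) ^ 4) := by
          rw [mul_pow, s4, (by decide : Even 4).pow_abs]
      _ ≤ _ := by gcongr
  have B0 : 0 ≤ s * (1 + (π (m + 1)).mesh * ∑ p ∈ haarPairs π m, θ (m, p) ^ 4) := by
    have : 0 ≤ ∑ p ∈ haarPairs π m, θ (m, p) ^ 4 := Finset.sum_nonneg fun p _ => by positivity
    positivity
  have hcN := (π m).cell_lt t
  -- Only the interval of `π m` containing `t` contributes, with at most `R` functions.
  rw [sum_haarPairs m fun p => θ (m, p) * schauderFn π (m, p) t,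
    Finset.sum_eq_single ((π m).cell t)]
  · calc _ ≤ ∑ i ∈ branchRange π m ((π m).cell t),
          |θ (m, (π m).cell t, i) * schauderFn π (m, (π m).cell t, i) t| :=
          Finset.abs_sum_le_sum_abs _ _
      _ ≤ ∑ i ∈ branchRange π m ((π m).cell t),
          s * (1 + (π (m + 1)).mesh * ∑ p ∈ haarPairs π m, θ (m, p) ^ 4) :=
          Finset.sum_le_sum fun i hi => term ((π m).cell t, i)
            (mem_haarPairs.2 ⟨Finset.mem_range.2 hcN, hi⟩)
      _ ≤ R * (s * (1 + (π (m + 1)).mesh * ∑ p ∈ haarPairs π m, θ (m, p) ^ 4)) := by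
          rw [Finset.sum_const, nsmul_eq_mul]
          exact mul_le_mul_of_nonneg_right (Nat.cast_le.2 (hR _ hcN)) B0
      _ = _ := by ring
  · intro k hk hne
    refine Finset.sum_eq_zero fun i hi => ?_
    have hq : IsHaarIndex π (m, k, i) := ⟨Finset.mem_range.1 hk, hi⟩
    rw [h.schauderFn_eq_zero_of_ne_cell hq ht hne, mul_zero]
  · exact fun hh => absurd (Finset.mem_range.2 hcN) hh

theorem IsNested.continuousOn_schauderPartialSum (h : IsNested π) (a₀ a₁ : ℝ)
    (θ : ℕ × ℕ × ℕ → ℝ) (n : ℕ) :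
    ContinuousOn (schauderPartialSum π a₀ a₁ θ n) (Set.Icc 0 1) := by
  have e : schauderPartialSum π a₀ a₁ θ n =
      fun t => a₀ + (a₁ - a₀) * t + ∑ q ∈ haarIdx π n, θ q * schauderFn π q t :=
    funext fun t => schauderPartialSum_eq a₀ a₁ θ n t
  rw [e]
  refine ContinuousOn.add (by fun_prop) (continuousOn_finsetSum _ fun q hq => ?_)
  refine continuousOn_const.mul ?_
  have hq' := (mem_haarIdx.1 hq).2
  refine ContinuousOn.congr (f := fun t =>
      haarL (suppLeft π q) (suppMid π q) (suppRight π q) *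
        (min t (suppMid π q) - min t (suppLeft π q)) -
      haarR (suppLeft π q) (suppMid π q) (suppRight π q) *
        (min t (suppRight π q) - min t (suppMid π q))) (by fun_prop) fun t ht => ?_
  exact h.schauderFn_eq hq' ht.1

/-- Uniform convergence of a Schauder series whose levels are summable. -/
theorem IsNested.tendstoUniformlyOn (h : IsNested π) {R : ℕ}
    (hR : ∀ m, ∀ k < (π m).N, (branchRange π m k).card ≤ R) {x : ℝ → ℝ} {θ : ℕ × ℕ × ℕ → ℝ}
    (hx : ∀ t ∈ Set.Icc (0 : ℝ) 1, ∀ l : ℝ,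
      Tendsto (fun n => schauderPartialSum π (x 0) (x 1) θ n t) atTop (𝓝 l) → x t = l)
    (hsum : Summable fun m => R * √√(π (m + 1)).mesh *
      (1 + (π (m + 1)).mesh * ∑ p ∈ haarPairs π m, θ (m, p) ^ 4)) :
    TendstoUniformlyOn (fun n t => schauderPartialSum π (x 0) (x 1) θ n t) x atTop
      (Set.Icc 0 1) := by
  have base := tendstoUniformlyOn_tsum_nat (s := Set.Icc (0 : ℝ) 1)
    (f := fun m t => ∑ p ∈ haarPairs π m, θ (m, p) * schauderFn π (m, p) t) hsum
    fun m t ht => h.abs_sum_level_le (hR m) θ ht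
  have e : ∀ n t, schauderPartialSum π (x 0) (x 1) θ n t = x 0 + (x 1 - x 0) * t +
      ∑ m ∈ Finset.range n, ∑ p ∈ haarPairs π m, θ (m, p) * schauderFn π (m, p) t := by
    intro n t
    rw [schauderPartialSum_eq, sum_haarIdx_eq_sum_pairs]
  have hlim : ∀ t ∈ Set.Icc (0 : ℝ) 1, x t = x 0 + (x 1 - x 0) * t +
      ∑' m, ∑ p ∈ haarPairs π m, θ (m, p) * schauderFn π (m, p) t := by
    intro t ht
    refine hx t ht _ ?_
    simp only [e]
    exact (base.tendsto_at ht).const_add _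
  rw [Metric.tendstoUniformlyOn_iff] at base ⊢
  intro ε hε
  filter_upwards [base ε hε] with n hn t ht
  rw [hlim t ht, e, dist_add_left]
  exact hn t ht

end levels

/-! ### From pointwise convergence to quadratic variation in the measure sense. -/

section variation

variable {π : ℕ → UnitPartition} {φ : ℝ → ℝ}

theorem qvAlong_pt (p : UnitPartition) (x : ℝ → ℝ) {j : ℕ} (hj : j ≤ p.N) :
    qvAlong p x (p.pt j) = ∑ i ∈ Finset.range j, (x (p.pt (i + 1)) - x (p.pt i)) ^ 2 := by
  rw [qvAlong, ← Finset.sum_range_add_sum_Ico _ hj, Finset.sum_eq_zero (s := Finset.Ico _ _),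
    add_zero]
  · refine Finset.sum_congr rfl fun i hi => ?_
    rw [Finset.mem_range] at hi
    rw [min_eq_left (p.pt_le_pt hi hj), min_eq_left (p.pt_le_pt hi.le hj)]
  · intro i hi
    rw [Finset.mem_Ico] at hi
    rw [min_eq_right (p.pt_le_pt (by omega) hi.2), min_eq_right (p.pt_le_pt hi.1 hi.2.le), sub_self]
    norm_num

/-- Convergence of monotone functions at rational times gives convergence at all times. -/
theorem tendsto_of_tendsto_rat {F : ℕ → ℝ → ℝ} (hF : ∀ n, MonotoneOn (F n) (Set.Icc 0 1))
    (hc : ContinuousOn φ (Set.Icc 0 1))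
    (hr : ∀ r : ℚ, (r : ℝ) ∈ Set.Icc (0 : ℝ) 1 → Tendsto (fun n => F n r) atTop (𝓝 (φ r)))
    {t : ℝ} (ht : t ∈ Set.Icc (0 : ℝ) 1) : Tendsto (fun n => F n t) atTop (𝓝 (φ t)) := by
  rw [Metric.tendsto_atTop]
  intro ε hε
  obtain ⟨δ, hδ, H⟩ := Metric.continuousWithinAt_iff.1 (hc t ht) (ε / 2) (half_pos hε)
  have lower : ∃ r : ℚ, (r : ℝ) ∈ Set.Icc (0 : ℝ) 1 ∧ (r : ℝ) ≤ t ∧ t - r < δ := by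
    rcases ht.1.eq_or_lt with h0 | h0
    · exact ⟨0, by norm_num, by rw [← h0]; norm_num, by rw [← h0]; simpa using hδ⟩
    · obtain ⟨r, hr1, hr2⟩ := exists_rat_btwn (max_lt h0 (sub_lt_self t hδ))
      have h1 := (le_max_left _ _).trans_lt hr1
      have h2 := (le_max_right _ _).trans_lt hr1
      exact ⟨r, ⟨h1.le, hr2.le.trans ht.2⟩, hr2.le, by linarith⟩
  have upper : ∃ r : ℚ, (r : ℝ) ∈ Set.Icc (0 : ℝ) 1 ∧ t ≤ (r : ℝ) ∧ r - t < δ := by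
    rcases ht.2.eq_or_lt with h0 | h0
    · exact ⟨1, by norm_num, by rw [h0]; norm_num, by rw [h0]; simpa using hδ⟩
    · obtain ⟨r, hr1, hr2⟩ := exists_rat_btwn (lt_min h0 (lt_add_of_pos_right t hδ))
      have h1 := hr2.trans_le (min_le_left _ _)
      have h2 := hr2.trans_le (min_le_right _ _)
      exact ⟨r, ⟨ht.1.trans hr1.le, h1.le⟩, hr1.le, by linarith⟩
  obtain ⟨r, hr1, hr2, hr3⟩ := lower
  obtain ⟨r', hr1', hr2', hr3'⟩ := upper
  have c1 := H hr1 (by rw [Real.dist_eq, abs_sub_comm, abs_of_nonneg (sub_nonneg.2 hr2)]; exact hr3)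
  have c2 := H hr1' (by rw [Real.dist_eq, abs_of_nonneg (sub_nonneg.2 hr2')]; exact hr3')
  obtain ⟨n₁, hn₁⟩ := Metric.tendsto_atTop.1 (hr r hr1) (ε / 2) (half_pos hε)
  obtain ⟨n₂, hn₂⟩ := Metric.tendsto_atTop.1 (hr r' hr1') (ε / 2) (half_pos hε)
  refine ⟨max n₁ n₂, fun n hn => ?_⟩
  have d1 := hn₁ n ((le_max_left _ _).trans hn)
  have d2 := hn₂ n ((le_max_right _ _).trans hn)
  have m1 := hF n hr1 ht hr2
  have m2 := hF n ht hr1' hr2'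
  rw [Real.dist_eq, abs_lt] at *
  constructor <;> linarith [c1.1, c1.2, c2.1, c2.2, d1.1, d1.2, d2.1, d2.2]

/-- The Stieltjes function of the extension of `φ` by constants. -/
noncomputable def unitStieltjes (hφ : MonotoneOn φ (Set.Icc 0 1))
    (hc : ContinuousOn φ (Set.Icc 0 1)) : StieltjesFunction ℝ where
  toFun t := φ (max 0 (min t 1))
  mono' s t hst := hφ ⟨le_max_left _ _, max_le zero_le_one (min_le_right _ _)⟩
    ⟨le_max_left _ _, max_le zero_le_one (min_le_right _ _)⟩
    (max_le_max le_rfl (min_le_min hst le_rfl))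
  right_continuous' t := (hc.comp_continuous (f := fun t : ℝ => max 0 (min t 1)) (by fun_prop)
    fun t => ⟨le_max_left _ _, max_le zero_le_one (min_le_right _ _)⟩).continuousWithinAt

theorem unitStieltjes_real_Ioc (hφ : MonotoneOn φ (Set.Icc 0 1))
    (hc : ContinuousOn φ (Set.Icc 0 1)) {s t : ℝ} (hs : s ∈ Set.Icc (0 : ℝ) 1)
    (ht : t ∈ Set.Icc (0 : ℝ) 1) (hst : s ≤ t) :
    (unitStieltjes hφ hc).measure.real (Set.Ioc s t) = φ t - φ s := by
  have e : ∀ u ∈ Set.Icc (0 : ℝ) 1, unitStieltjes hφ hc u = φ u := fun u hu => by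
    change φ (max 0 (min u 1)) = φ u
    rw [min_eq_left hu.2, max_eq_right hu.1]
  rw [measureReal_def, StieltjesFunction.measure_Ioc, e s hs, e t ht,
    ENNReal.toReal_ofReal (sub_nonneg.2 (hφ hs ht hst))]

/-- Weak convergence of the discrete quadratic variation measures. -/
theorem IsNested.tendsto_sum_sq_mul (h : IsNested π)
    (hmesh : Tendsto (fun n => (π n).mesh) atTop (𝓝 0))
    (hφ : MonotoneOn φ (Set.Icc 0 1)) (hc : ContinuousOn φ (Set.Icc 0 1)) {x : ℝ → ℝ}
    (hqv : ∀ t ∈ Set.Icc (0 : ℝ) 1, Tendsto (fun n => qvAlong (π n) x t) atTop (𝓝 (φ t)))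
    {f : ℝ → ℝ} (hf : Continuous f) :
    Tendsto (fun n => ∑ j ∈ Finset.range (π n).N,
      (x ((π n).pt (j + 1)) - x ((π n).pt j)) ^ 2 * f ((π n).pt j)) atTop
      (𝓝 (∫ s in Set.Ioc (0 : ℝ) 1, f s ∂(unitStieltjes hφ hc).measure)) := by
  set μ := (unitStieltjes hφ hc).measure with hμ
  have zero_mem : (0 : ℝ) ∈ Set.Icc (0 : ℝ) 1 := ⟨le_rfl, zero_le_one⟩
  have one_mem : (1 : ℝ) ∈ Set.Icc (0 : ℝ) 1 := ⟨zero_le_one, le_rfl⟩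
  have incr : ∀ n, ∀ j < (π n).N, (x ((π n).pt (j + 1)) - x ((π n).pt j)) ^ 2 =
      qvAlong (π n) x ((π n).pt (j + 1)) - qvAlong (π n) x ((π n).pt j) := by
    intro n j hj
    rw [qvAlong_pt _ _ hj, qvAlong_pt _ _ hj.le, Finset.sum_range_succ, add_sub_cancel_left]
  have total : ∀ n, ∑ j ∈ Finset.range (π n).N, (x ((π n).pt (j + 1)) - x ((π n).pt j)) ^ 2 =
      qvAlong (π n) x 1 := by
    intro n
    have := qvAlong_pt (π n) x le_rfl
    rw [(π n).pt_last] at this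
    exact this.symm
  have Δ0 : 0 ≤ φ 1 - φ 0 := sub_nonneg.2 (hφ zero_mem one_mem zero_le_one)
  rw [Metric.tendsto_atTop]
  intro ε hε
  -- Three errors share `ε`: integral against Riemann–Stieltjes sum, `e * (φ 1 - φ 0)`; convergence
  -- at the points of `π m`, `e`; and freezing `f` on the intervals of `π m`, `e * (|φ 1| + 1)`.
  obtain ⟨e, he, heε⟩ : ∃ e > 0, e * (|φ 1| + 2 + (φ 1 - φ 0)) < ε := by
    have hp : 0 < |φ 1| + 2 + (φ 1 - φ 0) := by positivity
    refine ⟨ε / 2 / (|φ 1| + 2 + (φ 1 - φ 0)), by positivity, ?_⟩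
    rw [div_mul_cancel₀ _ hp.ne']
    linarith
  obtain ⟨m, hm⟩ := exists_forall_mesh_osc hmesh hf.continuousOn he
  have osc := hm m le_rfl
  set S := ∑ k ∈ Finset.range (π m).N, (φ ((π m).pt (k + 1)) - φ ((π m).pt k)) * f ((π m).pt k)
    with hS
  have int_close : |∫ s in Set.Ioc (0 : ℝ) 1, f s ∂μ - S| ≤ e * (φ 1 - φ 0) := by
    have adj := intervalIntegral.sum_integral_adjacent_intervals (f := f) (μ := μ)
      (a := fun k => (π m).pt k) (n := (π m).N) fun k _ => hf.intervalIntegrable _ _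
    rw [(π m).pt_zero, (π m).pt_last, intervalIntegral.integral_of_le zero_le_one] at adj
    have tel : φ 1 - φ 0 = ∑ k ∈ Finset.range (π m).N,
        (φ ((π m).pt (k + 1)) - φ ((π m).pt k)) := by
      rw [Finset.sum_range_sub (fun k => φ ((π m).pt k)), (π m).pt_last, (π m).pt_zero]
    rw [← adj, hS, ← Finset.sum_sub_distrib, tel, Finset.mul_sum]
    refine (Finset.abs_sum_le_sum_abs _ _).trans (Finset.sum_le_sum fun k hk => ?_)
    have hk' := Finset.mem_range.1 hk
    have p1 := (π m).pt_mem hk'.le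
    have p2 := (π m).pt_mem (i := k + 1) hk'
    have hlt := (π m).pt_lt k hk'
    have r := unitStieltjes_real_Ioc hφ hc p1 p2 hlt.le
    have fin : μ (Set.Ioc ((π m).pt k) ((π m).pt (k + 1))) < ⊤ := by
      rw [hμ, StieltjesFunction.measure_Ioc]
      exact ENNReal.ofReal_lt_top
    have ec : ∫ s in Set.Ioc ((π m).pt k) ((π m).pt (k + 1)), f ((π m).pt k) ∂μ =
        (φ ((π m).pt (k + 1)) - φ ((π m).pt k)) * f ((π m).pt k) := by
      rw [setIntegral_const, r, smul_eq_mul]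
    rw [intervalIntegral.integral_of_le hlt.le, ← ec, ← integral_sub
      (hf.intervalIntegrable (μ := μ) _ _).1 (integrableOn_const fin.ne), ← r]
    refine norm_setIntegral_le_of_norm_le_const (f := fun s => f s - f ((π m).pt k)) fin
      fun s hs => ?_
    refine osc s ⟨p1.1.trans hs.1.le, hs.2.trans p2.2⟩ _ p1 ?_
    rw [abs_of_nonneg (sub_nonneg.2 hs.1.le)]
    have := (π m).len_le_mesh hk'
    rw [UnitPartition.len] at this
    linarith [hs.2]
  have step_lim : Tendsto (fun n => ∑ k ∈ Finset.range (π m).N,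
      (qvAlong (π n) x ((π m).pt (k + 1)) - qvAlong (π n) x ((π m).pt k)) * f ((π m).pt k))
      atTop (𝓝 S) :=
    tendsto_finsetSum _ fun k hk => ((hqv _ ((π m).pt_mem (i := k + 1)
      (Finset.mem_range.1 hk))).sub (hqv _ ((π m).pt_mem (Finset.mem_range.1 hk).le))).mul_const _
  obtain ⟨n₁, hn₁⟩ := Metric.tendsto_atTop.1 step_lim e he
  obtain ⟨n₂, hn₂⟩ := Metric.tendsto_atTop.1 (hqv 1 one_mem) 1 one_pos
  refine ⟨max m (max n₁ n₂), fun n hn => ?_⟩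
  have hmn : m ≤ n := (le_max_left _ _).trans hn
  have b1 := hn₁ n (((le_max_left _ _).trans (le_max_right _ _)).trans hn)
  have b2 := hn₂ n (((le_max_right _ _).trans (le_max_right _ _)).trans hn)
  have qv1 : qvAlong (π n) x 1 ≤ |φ 1| + 1 := by
    rw [Real.dist_eq] at b2
    linarith [(abs_lt.1 b2).2, le_abs_self (φ 1)]
  have reg := UnitPartition.sum_regroup (h m n hmn) (fun k => f ((π m).pt k)) (qvAlong (π n) x)
  have sum_close : |∑ j ∈ Finset.range (π n).N,
      (x ((π n).pt (j + 1)) - x ((π n).pt j)) ^ 2 * f ((π n).pt j) -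
      ∑ k ∈ Finset.range (π m).N,
        (qvAlong (π n) x ((π m).pt (k + 1)) - qvAlong (π n) x ((π m).pt k)) * f ((π m).pt k)| ≤
      e * (|φ 1| + 1) := by
    rw [← reg, ← Finset.sum_sub_distrib]
    calc _ ≤ ∑ j ∈ Finset.range (π n).N, (x ((π n).pt (j + 1)) - x ((π n).pt j)) ^ 2 * e := by
          refine (Finset.abs_sum_le_sum_abs _ _).trans (Finset.sum_le_sum fun j hj => ?_)
          have hj' := Finset.mem_range.1 hj
          rw [← incr n j hj', ← mul_sub, abs_mul, abs_of_nonneg (sq_nonneg _)]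
          refine mul_le_mul_of_nonneg_left ?_ (sq_nonneg _)
          have pj := (π n).pt_mem hj'.le
          exact osc _ pj _ ((π m).pt_mem ((π m).cell_lt _).le) ((tendsto_pt_cell hmesh pj).2 m)
      _ ≤ e * (|φ 1| + 1) := by
          rw [← Finset.sum_mul, total, mul_comm]
          gcongr
  rw [Real.dist_eq] at b1 ⊢
  have c1 := abs_le.1 int_close
  have c2 := abs_le.1 sum_close
  have c3 := abs_lt.1 b1
  have expand : e * (|φ 1| + 2 + (φ 1 - φ 0)) = e * (|φ 1| + 1) + e + e * (φ 1 - φ 0) := by ring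
  rw [abs_lt]
  constructor <;> linarith [c1.1, c1.2, c2.1, c2.2, c3.1, c3.2]

/-- A continuous path whose quadratic variation sums converge to a continuous increasing function
at all times has that function as its quadratic variation. -/
theorem IsNested.hasQuadraticVariation (h : IsNested π)
    (hmesh : Tendsto (fun n => (π n).mesh) atTop (𝓝 0)) (hφ0 : φ 0 = 0)
    (hφ : MonotoneOn φ (Set.Icc 0 1)) (hc : ContinuousOn φ (Set.Icc 0 1)) {x : ℝ → ℝ}
    (hx : ContinuousOn x (Set.Icc 0 1))
    (hqv : ∀ t ∈ Set.Icc (0 : ℝ) 1, Tendsto (fun n => qvAlong (π n) x t) atTop (𝓝 (φ t))) :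
    HasQuadraticVariation π x φ := by
  have right : ∀ t ∈ Set.Ico (0 : ℝ) 1, Tendsto x (𝓝[>] t) (𝓝 (x t)) := fun t ht =>
    (hx t ⟨ht.1, ht.2.le⟩).tendsto.mono_left
      (nhdsWithin_le_of_mem (mem_of_superset (Ioc_mem_nhdsGT ht.2) fun s hs =>
        ⟨ht.1.trans hs.1.le, hs.2⟩))
  have left : ∀ t ∈ Set.Ioc (0 : ℝ) 1, Tendsto x (𝓝[<] t) (𝓝 (x t)) := fun t ht =>
    (hx t ⟨ht.1.le, ht.2⟩).tendsto.mono_left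
      (nhdsWithin_le_of_mem (mem_of_superset (Ico_mem_nhdsLT ht.1) fun s hs =>
        ⟨hs.1, hs.2.le.trans ht.2⟩))
  have jump : ∀ t ∈ Set.Icc (0 : ℝ) 1, ∀ s : Set.Ioc (0 : ℝ) t,
      |x s - Function.leftLim x s| ^ 2 = 0 := by
    intro t ht s
    rw [leftLim_eq_of_tendsto (left s ⟨s.2.1, s.2.2.trans ht.2⟩),
      sub_self, abs_zero, zero_pow two_ne_zero]
  -- Leaving out 0 loses nothing: φ extended by constants is continuous, so there is no atom, and `φ
  -- 0 = 0` normalizes the distribution function.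
  set μ := (unitStieltjes hφ hc).measure.restrict (Set.Ioc 0 1) with hμ
  have zero_mem : (0 : ℝ) ∈ Set.Icc (0 : ℝ) 1 := ⟨le_rfl, zero_le_one⟩
  have one_mem : (1 : ℝ) ∈ Set.Icc (0 : ℝ) 1 := ⟨zero_le_one, le_rfl⟩
  have cdf : ∀ t ∈ Set.Icc (0 : ℝ) 1, μ.real (Set.Icc 0 t) = φ t := by
    intro t ht
    have e : Set.Icc 0 t ∩ Set.Ioc 0 1 = Set.Ioc 0 t := by
      ext s
      simp only [Set.mem_inter_iff, Set.mem_Icc, Set.mem_Ioc]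
      exact ⟨fun hs => ⟨hs.2.1, hs.1.2⟩, fun hs => ⟨⟨hs.1.le, hs.2⟩, hs.1, hs.2.trans ht.2⟩⟩
    rw [hμ, measureReal_restrict_apply measurableSet_Icc, e,
      unitStieltjes_real_Ioc hφ hc zero_mem ht ht.1, hφ0, sub_zero]
  have cont_part : ∀ t ∈ Set.Icc (0 : ℝ) 1, μ.real (Set.Icc 0 t) -
      ∑' s : Set.Ioc (0 : ℝ) t, |x s - Function.leftLim x s| ^ 2 = φ t := by
    intro t ht
    rw [cdf t ht, tsum_congr (jump t ht), tsum_zero, sub_zero]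
  refine ⟨⟨right, fun t ht => ⟨x t, left t ht⟩⟩, hmesh, μ, ?_, ?_, ?_, ?_, ?_, ?_, ?_⟩
  · refine ⟨?_⟩
    rw [hμ, Measure.restrict_apply_univ, StieltjesFunction.measure_Ioc]
    exact ENNReal.ofReal_lt_top
  · rw [hμ, Measure.restrict_apply measurableSet_Icc.compl]
    have e : (Set.Icc (0 : ℝ) 1)ᶜ ∩ Set.Ioc 0 1 = ∅ := by
      ext s
      simp only [Set.mem_inter_iff, Set.mem_compl_iff, Set.mem_Icc, Set.mem_Ioc,
        Set.mem_empty_iff_false, iff_false]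
      exact fun hs => hs.1 ⟨hs.2.1.le, hs.2.2⟩
    rw [e, measure_empty]
  · exact fun f hf => h.tendsto_sum_sq_mul hmesh hφ hc hqv hf
  · exact (summable_zero (α := ℝ)).congr fun s => (jump 1 one_mem s).symm
  · exact hc.congr cont_part
  · exact hφ.congr fun t ht => (cont_part t ht).symm
  · exact fun t ht => ⟨(cdf t ht).symm, hqv t ht⟩

end variation

/-! ### Almost sure statements under summable mesh. -/

section almostSure

variable {π : ℕ → UnitPartition} {φ : ℝ → ℝ} {Ω : Type*} [MeasurableSpace Ω] {P : Measure Ω}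
  {η : ℕ × ℕ × ℕ → Ω → ℝ} {M : ℝ}

/-- Balance bounds the number of intervals times the mesh, hence mesh times the expected sum of
fourth powers on a level. What remains is a multiple of the fourth root of the mesh, which complete
refinement makes summable. -/
theorem IsNested.ae_summable_level [IsProbabilityMeasure P] (h : IsNested π)
    (H : HasFactorizingMoments P {q | IsHaarIndex π q} η (schauderWeight π φ) M)
    (hcr : IsCompleteRefining π) (hb : IsBalanced π) (R : ℕ) :
    ∀ᵐ ω ∂P, Summable fun m => R * √√(π (m + 1)).mesh *
      (1 + (π (m + 1)).mesh * ∑ p ∈ haarPairs π m, η (m, p) ω ^ 4) := by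
  obtain ⟨c, hc0, hc⟩ := hb.exists_N_mul_mesh_le
  have i4 : ∀ m, ∀ p ∈ haarPairs π m, Integrable (fun ω => η (m, p) ω ^ 4) P := fun m p hp =>
    integrable_pow_four (H.memLp _ (isHaarIndex_of_mem_pairs hp))
  have iZ : ∀ m, Integrable (fun ω => ∑ p ∈ haarPairs π m, η (m, p) ω ^ 4) P := fun m =>
    integrable_finsetSum _ (i4 m)
  refine ae_summable_of_integral_le
    (fun m => ((integrable_const 1).add ((iZ m).const_mul _)).const_mul _) (fun m ω => ?_)
    (hcr.summable.2.mul_left (R * (1 + c * M))) fun m => ?_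
  · have := (π (m + 1)).mesh_pos
    have : 0 ≤ ∑ p ∈ haarPairs π m, η (m, p) ω ^ 4 := Finset.sum_nonneg fun p _ => by positivity
    positivity
  · have hmesh := (π (m + 1)).mesh_pos
    have EZ : ∫ ω, ∑ p ∈ haarPairs π m, η (m, p) ω ^ 4 ∂P ≤ (π (m + 1)).N * M := by
      rw [integral_finsetSum _ (i4 m)]
      calc _ ≤ ∑ p ∈ haarPairs π m, M := Finset.sum_le_sum fun p hp =>
            H.moment_four_le _ (isHaarIndex_of_mem_pairs hp)
        _ ≤ _ := by
            rw [Finset.sum_const, nsmul_eq_mul]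
            exact mul_le_mul_of_nonneg_right (h.card_haarPairs_le m) H.bound_nonneg
    rw [integral_const_mul, integral_add (integrable_const _) ((iZ m).const_mul _),
      integral_const_mul, integral_const, probReal_univ, one_smul]
    calc _ ≤ R * √√(π (m + 1)).mesh * (1 + (π (m + 1)).mesh * ((π (m + 1)).N * M)) := by gcongr
      _ = R * √√(π (m + 1)).mesh * (1 + ((π (m + 1)).N * (π (m + 1)).mesh) * M) := by ring
      _ ≤ R * √√(π (m + 1)).mesh * (1 + c * M) := by
          have := H.bound_nonneg
          gcongr
          exact hc m
      _ = _ := by ring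

/-- The variances are at most 16M times the mesh, hence summable, so one null set serves all
rational times. Monotonicity of the sums in `t` and continuity of φ cover the remaining times. -/
theorem IsNested.ae_tendsto_sum_schauderIncr_sq [IsProbabilityMeasure P] (h : IsNested π)
    (h0 : (π 0).N = 1) (hmesh : Tendsto (fun n => (π n).mesh) atTop (𝓝 0)) (hφ0 : φ 0 = 0)
    (hφ : MonotoneOn φ (Set.Icc 0 1)) (hc : ContinuousOn φ (Set.Icc 0 1))
    (H : HasFactorizingMoments P {q | IsHaarIndex π q} η (schauderWeight π φ) M)
    (hs : Summable fun n => (π n).mesh) :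
    ∀ᵐ ω ∂P, ∀ t ∈ Set.Icc (0 : ℝ) 1,
      Tendsto (fun n => ∑ j ∈ Finset.range ((π n).cell t),
        schauderIncr π (fun q => η q ω) n j ^ 2) atTop (𝓝 (φ t)) := by
  have rat : ∀ᵐ ω ∂P, ∀ r : ℚ, (r : ℝ) ∈ Set.Icc (0 : ℝ) 1 →
      Tendsto (fun n => ∑ j ∈ Finset.range ((π n).cell r),
        schauderIncr π (fun q => η q ω) n j ^ 2) atTop (𝓝 (φ r)) := by
    rw [ae_all_iff]
    intro r
    have := ae_tendsto_zero_of_integral_sq_le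
      (fun n => (h.integral_sq_qv_sub_mean_le h0 H n ((π n).cell_lt r).le).1)
      (hs.mul_left (16 * M))
      (fun n => (h.integral_sq_qv_sub_mean_le h0 H n ((π n).cell_lt r).le).2)
    filter_upwards [this] with ω hω hr
    have := hω.add (h.tendsto_meanQV h0 hmesh hφ0 hφ hc H hr)
    simpa only [sub_add_cancel, zero_add] using this
  filter_upwards [rat] with ω hω t ht
  refine tendsto_of_tendsto_rat (F := fun n t => ∑ j ∈ Finset.range ((π n).cell t),
    schauderIncr π (fun q => η q ω) n j ^ 2) (fun n s hs t _ hst => ?_) hc hω ht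
  have hle : (π n).cell s ≤ (π n).cell t :=
    (π n).le_cell ((π n).cell_lt s) (((π n).pt_cell_le hs.1).trans hst)
  exact Finset.sum_le_sum_of_subset_of_nonneg (Finset.range_subset_range.2 hle)
    fun j _ _ => sq_nonneg _

end almostSure

/-! ### The theorem. -/

theorem mainTheorem4 {Ω : Type*} [MeasurableSpace Ω] (P : Measure Ω) [IsProbabilityMeasure P]
    (π : ℕ → UnitPartition) (hπ : IsFinitelyRefining π) (hπ0 : (π 0).N = 1)
    (φ : ℝ → ℝ) (hφ0 : φ 0 = 0) (hφmono : MonotoneOn φ (Set.Icc 0 1))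
    (hφcont : ContinuousOn φ (Set.Icc 0 1))
    -- the random Schauder coefficients
    (η : ℕ × ℕ × ℕ → Ω → ℝ)
    (hη4 : ∀ q, IsHaarIndex π q → MemLp (η q) 4 P)
    (hηM : ∃ M : ℝ, ∀ q, IsHaarIndex π q → ∫ ω, η q ω ^ 4 ∂P ≤ M)
    (hη1 : ∀ q, IsHaarIndex π q → ∫ ω, η q ω ∂P = 0)
    (hη2 : ∀ q q', IsHaarIndex π q → IsHaarIndex π q' →
      ∫ ω, η q ω * η q' ω ∂P = if q = q' then schauderWeight π φ q else 0)
    (hηfac : ∀ q : Fin 4 → ℕ × ℕ × ℕ, Function.Injective q → (∀ j, IsHaarIndex π (q j)) →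
      ∀ α : Fin 4 → ℕ, ∑ j, α j = 4 →
        ∫ ω, ∏ j, η (q j) ω ^ α j ∂P = ∏ j, ∫ ω, η (q j) ω ^ α j ∂P)
    -- the process: the sum of its Schauder series, wherever that series converges
    (x : ℝ → Ω → ℝ) (hx0 : AEMeasurable (x 0) P) (hx1 : AEMeasurable (x 1) P)
    (hx : ∀ᵐ ω ∂P, ∀ t ∈ Set.Icc (0 : ℝ) 1, ∀ l : ℝ,
      Tendsto (fun n => schauderPartialSum π (x 0 ω) (x 1 ω) (fun q => η q ω) n t)
        atTop (𝓝 l) → x t ω = l) :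
    -- convergence in probability at every time at which the process is well defined
    (∀ t ∈ Set.Icc (0 : ℝ) 1,
      (∀ᵐ ω ∂P, ∃ l : ℝ,
        Tendsto (fun n => schauderPartialSum π (x 0 ω) (x 1 ω) (fun q => η q ω) n t)
          atTop (𝓝 l)) →
      ∀ ε : ℝ, 0 < ε →
        Tendsto (fun n => P {ω | ε < |qvAlong (π n) (fun s => x s ω) t - φ t|})
          atTop (𝓝 0)) ∧
    -- almost sure convergence
    (IsCompleteRefining π → IsBalanced π → HasBoundedDerivUnit φ →
      ∀ᵐ ω ∂P,
        TendstoUniformlyOn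
          (fun n t => schauderPartialSum π (x 0 ω) (x 1 ω) (fun q => η q ω) n t)
          (fun t => x t ω) atTop (Set.Icc 0 1) ∧
        HasQuadraticVariation π (fun t => x t ω) φ) := by
  have h : IsNested π := hπ.1
  have hmesh := hπ.2.1
  obtain ⟨M, hM⟩ := hηM
  have H : HasFactorizingMoments P {q | IsHaarIndex π q} η (schauderWeight π φ) M :=
    { infinite := h.infinite_haarIndex hπ0 hmesh
      memLp := hη4
      moment_four_le := hM
      mean_eq_zero := hη1
      second := fun q hq r hr hqr => by rw [hη2 q r hq hr, if_neg hqr]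
      variance_eq := fun q hq => by simpa only [sq, if_true] using hη2 q q hq hq
      factor := hηfac }
  refine ⟨fun t ht hconv ε hε => h.tendsto_measure_qvAlong hπ0 hmesh hφ0 hφmono hφcont H hx0 hx1
    hx ht hconv hε, fun hcr hbal _ => ?_⟩
  obtain ⟨R, hR⟩ := hπ.exists_card_branchRange_le
  have level_sums := h.ae_summable_level H hcr hbal R
  have squares := h.ae_tendsto_sum_schauderIncr_sq hπ0 hmesh hφ0 hφmono hφcont H hcr.summable.1
  filter_upwards [hx, level_sums, squares] with ω hω hsum hsq
  have unif := h.tendstoUniformlyOn hR (x := fun s => x s ω) hω hsum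
  have cont : ContinuousOn (fun s => x s ω) (Set.Icc 0 1) := unif.continuousOn
    (Frequently.of_forall fun n => h.continuousOn_schauderPartialSum _ _ _ n)
  refine ⟨unif, h.hasQuadraticVariation hmesh hφ0 hφmono hφcont cont fun t ht => ?_⟩
  refine h.tendsto_qvAlong hmesh (x := fun s => x s ω) hω ht tendsto_id (hsq t ht) ?_
  have := (tendsto_comp_pt_cell hmesh cont ht).const_sub (x t ω)
  rwa [sub_self] at this
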